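/- Let $N\ge 1$ be odd. Paths have $N$ steps $U=(1,1)$ or $D=(1,-1)$ and start at the origin; a \emph{ballot path} is a path that never goes below $y=0$, and it has length $(2n,n')$ if it ends at $(2n+n',n')$. Let $\mu$ be a ballot path with $N$ steps and let $\mu_0=UDUD\cdots U$ be the lowest such path. \emph{Shapes and tilings.} For a ballot path $\lambda$ weakly below $\mu$, the shifted skew shape $\lambda/\mu$ consists of the boxes (squares with corners $(x\pm1,y),(x,y\pm1)$, which are points with even coordinate sum) whose centre $(x,y)$ satisfies $1\le x\le N$ and lies strictly between $\lambda$ and $\mu$; boxes with centre on $x=N$ are called anchor boxes. A \emph{ballot tile} of length $(2n,n')$ is a set of boxes whose centres are the vertices of a translate of a ballot path of length $(2n,n')$; it is a \emph{Dyck tile} if $n'=0$. A \emph{cover-inclusive ballot tiling} of $\lambda/\mu$ is a partition of the shape into ballot tiles such that every tile with $n'\ge1$ has an anchor box as its rightmost box, and every tile, translated downward by one box, either lies strictly below $\lambda$ or is contained in another tile. It is \emph{of type BI} if, for every $n\ge 0$, the number of tiles of length $(2n,n')$ is even for each odd $n'$ and is zero for each even $n'>0$. Let $\mathrm{tiles}(B)$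 be the number of Dyck tiles of $B$, and $$P^{I}_{*,\mu}:=\sum_{\lambda}\ \sum_{B}q^{\mathrm{tiles}(B)},$$ where $\lambda$ runs over the ballot paths weakly below $\mu$ and $B$ over the cover-inclusive ballot tilings of type BI of $\lambda/\mu$. \emph{Product side.} Let $\mathrm{D}(\mu_0)$ be the set of $D$ steps $d_1,\dots,d_{(N-1)/2}$ of $\mu_0$, from left to right. For $d\in \mathrm{D}(\mu_0)$ let $\mathrm{ht}(d;\mu)$ be one plus the number of boxes of $\mu_0/\mu$ lying in the $(1,1)$-direction from $d$. Write $[n]=1+q+\dots+q^{n-1}$. \emph{Permutations.} Let $\mathfrak S^{\mathrm{DU}}_{N+1}$ be the set of permutations $w$ of $\{1,\dots,N+1\}$ with $w_1>w_2<w_3>w_4<\cdots$ and $w_2<w_4<w_6<\cdots$. Define $\sigma=\sigma(\mu)$ as follows. Start with $S=\{1,\dots,N+1\}$. For $i=1,\dots,(N-1)/2$ let $\sigma_{2i-1}$ be the $(\mathrm{ht}(d_i;\mu)+1)$-th smallest element of $S$, remove it from $S$, then let $\sigma_{2i}$ be the smallest element of $S$ and remove it. Finally $\sigma_N=\max S$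 and $\sigma_{N+1}=\min S$ for the remaining two-element set $S$. Let $l(w)$ be the number of inversions of $w$ and $\le$ the Bruhat order on $\mathfrak S_{N+1}$. \textbf{Theorem.} For every odd $N$ and every ballot path $\mu$ with $N$ steps, $$P^{I}_{*,\mu}=\prod_{d\in \mathrm{D}(\mu_0)}[\mathrm{ht}(d;\mu)]=\sum_{\substack{\pi\in\mathfrak S^{\mathrm{DU}}_{N+1}\\ \pi\le\sigma(\mu)}}q^{\,l(\sigma(\mu))-l(\pi)} .$$ -/

import Mathlib

namespace BallotTiling

open Finset Polynomial

/-! ### Paths -/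

/-- A step of a lattice path: `U = (1, 1)` or `D = (1, -1)`. -/
inductive Step
  | U
  | D
  deriving DecidableEq

instance : Fintype Step := ⟨{.U, .D}, by rintro (_ | _) <;> simp⟩

/-- The vertical increment of a step. -/
def Step.rise : Step → ℤ
  | .U => 1
  | .D => -1

/-- A lattice path with `N` steps, starting at the origin. -/
abbrev Path (N : ℕ) : Type := Fin N → Step

/-- The height of the path `p` after `k` steps. -/
def height {N : ℕ} (p : Path N) (k : ℕ) : ℤ :=
  ∑ i : Fin N with i.val < k, (p i).rise

/-- `p` is a ballot path: it never goes below the horizontal line `y = 0`.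
Its length is `(2n, n')`, where `n'` is its final height and `N = 2n + n'`. -/
def IsBallot {N : ℕ} (p : Path N) : Prop :=
  ∀ k ≤ N, 0 ≤ height p k

/-- `lam` lies weakly below `mu`, i.e. the shifted skew shape `lam / mu` exists. -/
def Below {N : ℕ} (lam mu : Path N) : Prop :=
  ∀ k ≤ N, height lam k ≤ height mu k

/-- The lowest ballot path `UDUD⋯` with `N` steps. -/
def zigzag (N : ℕ) : Path N :=
  fun i => if Even i.val then .U else .D

/-! ### Shapes, tiles and tilings

A box is the square with corners `(x ± 1, y)` and `(x, y ± 1)`; it is represented by its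
centre `(x, y)`. The corners of a box are lattice points that paths can visit, hence
`x + y` is odd. -/

/-- The boxes of the shifted skew shape between the lower path `lam` and the upper path `mu`,
including the anchor boxes, which are those whose centre is on the line `x = N`. -/
noncomputable def skewShape {N : ℕ} (lam mu : Path N) : Finset (ℕ × ℤ) :=
  (Icc 1 N ×ˢ Icc (-(N : ℤ)) N).filter fun b =>
    Odd ((b.1 : ℤ) + b.2) ∧ height lam b.1 < b.2 ∧ b.2 < height mu b.1

/-- `t` is a ballot tile of length `(2n, n')`: a ribbon such that the centres of its boxes
are the vertices of a (translated) ballot path of length `(2n, n')`.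
It is a Dyck tile if `n' = 0`. -/
def IsBallotTile (t : Finset (ℕ × ℤ)) (n n' : ℕ) : Prop :=
  ∃ (x : ℕ) (y : ℤ) (c : Path (2 * n + n')),
    IsBallot c ∧ height c (2 * n + n') = n' ∧
      t = (range (2 * n + n' + 1)).image fun k => (x + k, y + height c k)

/-- The translate of a set of boxes downward by one box. -/
def down (t : Finset (ℕ × ℤ)) : Finset (ℕ × ℤ) :=
  t.image fun b => (b.1, b.2 - 2)

/-- `T` is a cover-inclusive ballot tiling of the shifted skew shape `lam / mu`. -/
structure IsBallotTiling {N : ℕ} (lam mu : Path N) (T : Finset (Finset (ℕ × ℤ))) : Prop where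
  /-- Every element of `T` is a ballot tile. -/
  tile : ∀ t ∈ T, ∃ n n', IsBallotTile t n n'
  /-- Different tiles have no box in common. -/
  disjoint : ∀ t ∈ T, ∀ t' ∈ T, t ≠ t' → Disjoint t t'
  /-- The tiles cover exactly the shape. -/
  cover : T.biUnion id = skewShape lam mu
  /-- The rightmost box of a ballot tile which is not a Dyck tile is an anchor box. -/
  anchor : ∀ t ∈ T, ∀ n n', IsBallotTile t n n' → 1 ≤ n' →
    ∃ b ∈ t, (∀ b' ∈ t, b'.1 ≤ b.1) ∧ b.1 = N
  /-- Translating a tile downward yields boxes strictly below `lam`, or a part of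
  another tile. -/
  coverInclusive : ∀ t ∈ T,
    (∀ b ∈ down t, b.2 < height lam b.1) ∨ ∃ t' ∈ T, t' ≠ t ∧ down t ⊆ t'

/-- The constraint of type BI: for each `(2n, n')` with `n'` odd the number of ballot tiles of
length `(2n, n')` is even, and there are none if `n'` is even and positive. -/
def IsTypeBI (T : Finset (Finset (ℕ × ℤ))) : Prop :=
  (∀ n n', Odd n' → Even {t : Finset (ℕ × ℤ) | t ∈ T ∧ IsBallotTile t n n'}.ncard) ∧
    ∀ n n', Even n' → 0 < n' → ∀ t ∈ T, ¬ IsBallotTile t n n'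

open Classical in
/-- The set of cover-inclusive ballot tilings of type BI in the shape `lam / mu`. -/
noncomputable def tilingsBI {N : ℕ} (lam mu : Path N) : Finset (Finset (Finset (ℕ × ℤ))) :=
  (skewShape lam mu).powerset.powerset.filter fun T => IsBallotTiling lam mu T ∧ IsTypeBI T

/-- The statistic `tiles` for type BI: a Dyck tile counts `1`, any other ballot tile `0`. -/
noncomputable def tiles (T : Finset (Finset (ℕ × ℤ))) : ℕ :=
  {t : Finset (ℕ × ℤ) | t ∈ T ∧ ∃ n, IsBallotTile t n 0}.ncard

open Classical in
/-- The generating function of ballot tilings of type BI with fixed upper path `mu`: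
the sum of `q ^ tiles` over all ballot paths `lam` weakly below `mu` and all cover-inclusive
ballot tilings of type BI in `lam / mu`. -/
noncomputable def upperGenFun {N : ℕ} (mu : Path N) : ℤ[X] :=
  ∑ lam : Path N with IsBallot lam ∧ Below lam mu, ∑ T ∈ tilingsBI lam mu, X ^ tiles T

/-! ### The product side -/

/-- The quantum integer `[n] = 1 + q + ⋯ + q ^ (n - 1)`. -/
noncomputable def qInt (n : ℕ) : ℤ[X] :=
  ∑ i ∈ range n, X ^ i

/-- The statistic `ht(d; mu)` of the `d`-th step of the zigzag path (steps are numbered from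
`0`), used for down steps: one plus the number of boxes of the shape between the zigzag path
and `mu` in the `(1, 1)`-direction from this step. The step goes from the point `(d, h)` with
`h` its initial height to `(d + 1, h - 1)`, so the box that has it as its southwest edge has
centre `(d + 1, h)`. -/
noncomputable def ht {N : ℕ} (mu : Path N) (d : Fin N) : ℕ :=
  1 + ((skewShape (zigzag N) mu).filter fun b =>
    ∃ k ∈ range N, b = (d.val + 1 + k, height (zigzag N) d.val + k)).card

/-! ### Permutations

A permutation `w` of `{1, …, n}` is an element of `Equiv.Perm (Fin n)`, with positions and
values shifted by one: `w_{i+1} = w i + 1`. -/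

/-- The number of inversions of a permutation. -/
def inversions {n : ℕ} (w : Equiv.Perm (Fin n)) : ℕ :=
  #{p : Fin n × Fin n | p.1 < p.2 ∧ w p.2 < w p.1}

/-- The Bruhat order: the reflexive transitive closure of the relation
`u → u t` with `t` a transposition such that `u t` has more inversions than `u`. -/
def BruhatLE {n : ℕ} (u v : Equiv.Perm (Fin n)) : Prop :=
  Relation.ReflTransGen
    (fun a b => ∃ i j : Fin n, i ≠ j ∧ b = a * Equiv.swap i j ∧ inversions a < inversions b) u v

/-- `w` is a down-up permutation, `w_1 > w_2 < w_3 > ⋯`, whose entries in the even positions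
(which are the odd indices when counted from `0`) are increasing, `w_2 < w_4 < ⋯`. -/
structure IsIncreasingDownUp {n : ℕ} (w : Equiv.Perm (Fin n)) : Prop where
  descent : ∀ i j : Fin n, j.val = i.val + 1 → Odd j.val → w j < w i
  ascent : ∀ i j : Fin n, j.val = i.val + 1 → Odd i.val → w i < w j
  increasing : ∀ i j : Fin n, j.val = i.val + 2 → Odd i.val → w i < w j

/-- Given a list `h₁, h₂, …` of numbers and an increasing list `S`, repeat for each `hᵢ`:
remove the `(hᵢ + 1)`-th smallest element of `S` and write it down, then remove the smallest
remaining element and write it down. Finally write down what is left in decreasing order. -/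
def pickWord {α : Type*} : List ℕ → List α → List α
  | [], S => S.reverse
  | h :: hs, S => S[h]?.toList ++ ((S.eraseIdx h).take 1 ++ pickWord hs ((S.eraseIdx h).drop 1))

theorem pickWord_perm {α : Type*} (hs : List ℕ) (S : List α) : (pickWord hs S).Perm S := by
  induction hs generalizing S with
  | nil => exact S.reverse_perm
  | cons h hs ih =>
    have h1 : ((S.eraseIdx h).take 1 ++ pickWord hs ((S.eraseIdx h).drop 1)).Perm
        (S.eraseIdx h) := by
      have := (ih ((S.eraseIdx h).drop 1)).append_left ((S.eraseIdx h).take 1)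
      rwa [List.take_append_drop] at this
    refine (h1.append_left _).trans ?_
    by_cases hh : h < S.length
    · rw [List.getElem?_eq_getElem hh]
      exact List.getElem_cons_eraseIdx_perm hh
    · rw [List.getElem?_eq_none (by omega), List.eraseIdx_of_length_le (by omega)]
      exact List.Perm.refl _

/-- The one-line notation of `σ(mu)`: the list `ht(d₁; mu), ht(d₂; mu), …`, where `d₁, d₂, …`
are the down steps of the zigzag path from left to right, applied to `{1, …, N + 1}`. -/
noncomputable def sigmaWord {N : ℕ} (mu : Path N) : List (Fin (N + 1)) :=
  pickWord (((List.finRange N).filter fun d => zigzag N d = .D).map (ht mu))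
    (List.finRange (N + 1))

theorem sigmaWord_perm {N : ℕ} (mu : Path N) :
    (sigmaWord mu).Perm (List.finRange (N + 1)) :=
  pickWord_perm _ _

theorem sigmaWord_length {N : ℕ} (mu : Path N) : (sigmaWord mu).length = N + 1 := by
  rw [(sigmaWord_perm mu).length_eq, List.length_finRange]

/-- The permutation `σ(mu)`, whose one-line notation is `sigmaWord mu`. -/
noncomputable def sigma {N : ℕ} (mu : Path N) : Equiv.Perm (Fin (N + 1)) :=
  (finCongr (sigmaWord_length mu).symm).trans
    (List.Nodup.getEquivOfForallMemList (sigmaWord mu)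
      ((sigmaWord_perm mu).nodup_iff.mpr (List.nodup_finRange _))
      fun a => (sigmaWord_perm mu).mem_iff.mpr (List.mem_finRange a))

end BallotTiling

namespace BallotTiling

open Finset Polynomial

/-! ### Heights -/

/-! The product formula comes from a recursion on the number of steps. Suppose `mu` starts with `k +
1` up steps followed by a down step, and look at the box just below this first peak. If the box is a
tile by itself, removing it flips the peak and costs a factor `q` (`sum_singleton_mem`). If it is
not, cover-inclusiveness forces every tile, and the lower path, to have a peak in that column; the
peak can then be contracted everywhere, which leaves a tiling for the path `nu` with two steps fewer
(`sum_singleton_notMem`). Flipping moves the first peak down and to the left without changing `nu`,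
so induction and `[k + 1] = 1 + q [k]` give `upperGenFun mu = [k + 1] * upperGenFun nu`
(`upperGenFun_of_peak`).

If `mu` has no down step, the top anchor box takes the role of the box below the peak. If it is a
tile, removing it flips the last step and creates a first peak. If it is not, the last two columns
are cut off (`sum_straight_notMem`). This is where type BI enters: the last step of the lower path
must be `U`, and the step before it is forced, since the number of boxes in the last column equals
the number of non-Dyck tiles, which is even. On the product side, `htSeq` loses its first entry `k +
1` in the same recursion (`htSeq_zero`, `htSeq_succ`), whence `upperGenFun_eq_prod`.

For the permutations, `pickWord` gives a bijection between lists `hs` and increasing down-up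
permutations, with `hs.sum + 1` inversions. Raising an entry of `hs` is a Bruhat step upwards.
Conversely, the Bruhat order preserves upper bounds on the first letters, and the inequalities
`htSeq_cases` between the entries of `htSeq mu` turn this into entrywise comparison. The
permutations below `sigma mu` thus form a box of lists (`sum_bruhatLE_pickPerm`), and summing over a
box gives the product of quantum integers. -/

theorem height_zero {N : ℕ} (p : Path N) : height p 0 = 0 := by
  simp [height]

theorem height_succ {N : ℕ} (p : Path N) {k : ℕ} (hk : k < N) :
    height p (k + 1) = height p k + (p ⟨k, hk⟩).rise := by
  unfold height
  have : (univ.filter fun i : Fin N => i.val < k + 1) =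
      insert ⟨k, hk⟩ (univ.filter fun i : Fin N => i.val < k) := by
    ext i
    simp only [mem_filter, mem_univ, true_and, mem_insert, Fin.ext_iff]
    omega
  rw [this, sum_insert (by simp), add_comm]

theorem height_step {N : ℕ} (p : Path N) {k : ℕ} (hk : k < N) :
    height p (k + 1) = height p k + 1 ∨ height p (k + 1) = height p k - 1 := by
  rw [height_succ p hk]
  cases p ⟨k, hk⟩
  · exact Or.inl rfl
  · exact Or.inr rfl

theorem height_emod {N : ℕ} (p : Path N) {k : ℕ} (hk : k ≤ N) :
    height p k % 2 = (k : ℤ) % 2 := by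
  induction k with
  | zero => simp [height_zero]
  | succ k ih =>
    have h1 := ih (by omega)
    have h2 := height_step p (k := k) (by omega)
    push_cast
    omega

theorem height_le {N : ℕ} (p : Path N) {k : ℕ} (hk : k ≤ N) : height p k ≤ k := by
  induction k with
  | zero => simp [height_zero]
  | succ k ih =>
    have h1 := ih (by omega)
    have h2 := height_step p (k := k) (by omega)
    push_cast
    omega

theorem neg_le_height {N : ℕ} (p : Path N) {k : ℕ} (hk : k ≤ N) : -(k : ℤ) ≤ height p k := by
  induction k with
  | zero => simp [height_zero]
  | succ k ih =>
    have h1 := ih (by omega)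
    have h2 := height_step p (k := k) (by omega)
    push_cast
    omega

theorem path_ext {N : ℕ} {p q : Path N} (h : ∀ k ≤ N, height p k = height q k) : p = q := by
  funext ⟨k, hk⟩
  have h1 := h k hk.le
  have h2 := h (k + 1) hk
  rw [height_succ p hk, height_succ q hk, h1] at h2
  revert h2
  cases p ⟨k, hk⟩ <;> cases q ⟨k, hk⟩ <;> simp [Step.rise]

/-- The path whose heights are given by `g`. -/
def ofHeights (N : ℕ) (g : ℕ → ℤ) : Path N :=
  fun i => if g (i.val + 1) = g i.val + 1 then .U else .D

theorem height_ofHeights {N : ℕ} {g : ℕ → ℤ} (h0 : g 0 = 0)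
    (hg : ∀ k < N, g (k + 1) = g k + 1 ∨ g (k + 1) = g k - 1) {k : ℕ} (hk : k ≤ N) :
    height (ofHeights N g) k = g k := by
  induction k with
  | zero => rw [height_zero, h0]
  | succ k ih =>
    rw [height_succ _ (by omega : k < N), ih (by omega)]
    have := hg k (by omega)
    unfold ofHeights
    split_ifs with h
    · simp only [Step.rise]; simp only at h; omega
    · simp only [Step.rise]; simp only at h; omega

/-! ### Ribbons -/

/-- The set of boxes `t` is the graph of the function `f` on the interval `[a, b]`, where `f` is
a lattice path that stays weakly above its initial height. -/
structure IsRibbon (t : Finset (ℕ × ℤ)) (a b : ℕ) (f : ℕ → ℤ) : Prop where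
  le : a ≤ b
  step : ∀ x, a ≤ x → x < b → f (x + 1) = f x + 1 ∨ f (x + 1) = f x - 1
  base : ∀ x, a ≤ x → x ≤ b → f a ≤ f x
  mem : ∀ z, z ∈ t ↔ a ≤ z.1 ∧ z.1 ≤ b ∧ z.2 = f z.1

namespace IsRibbon

variable {t : Finset (ℕ × ℤ)} {a b a' b' : ℕ} {f f' : ℕ → ℤ}

theorem mem_mk (h : IsRibbon t a b f) {x : ℕ} (h1 : a ≤ x) (h2 : x ≤ b) : (x, f x) ∈ t :=
  (h.mem _).2 ⟨h1, h2, rfl⟩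

theorem unique (h : IsRibbon t a b f) (h' : IsRibbon t a' b' f') :
    a = a' ∧ b = b' ∧ ∀ x, a ≤ x → x ≤ b → f x = f' x := by
  have h1 := (h'.mem _).1 (h.mem_mk le_rfl h.le)
  have h2 := (h'.mem _).1 (h.mem_mk h.le le_rfl)
  have h3 := (h.mem _).1 (h'.mem_mk le_rfl h'.le)
  have h4 := (h.mem _).1 (h'.mem_mk h'.le le_rfl)
  simp only at h1 h2 h3 h4
  exact ⟨by omega, by omega, fun x hx hx' => ((h'.mem _).1 (h.mem_mk hx hx')).2.2⟩

/-- The net rise of a lattice path is at most its number of steps and has the same parity, so the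
steps left over pair up. -/
theorem length (h : IsRibbon t a b f) : ∃ n n' : ℕ, b = a + (2 * n + n') ∧ f b = f a + n' := by
  have key : ∀ k : ℕ, a + k ≤ b →
      f (a + k) - f a ≤ k ∧ (f (a + k) - f a) % 2 = (k : ℤ) % 2 := by
    intro k
    induction k with
    | zero => simp
    | succ k ih =>
      intro hk
      have h1 := ih (by omega)
      have h2 := h.step (a + k) (by omega) (by omega)
      rw [← add_assoc]
      push_cast
      omega
  have h1 := key (b - a) (by have := h.le; omega)
  have h2 := h.base b h.le le_rfl
  have h3 := h.le
  rw [Nat.add_sub_cancel' h3] at h1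
  refine ⟨((b - a) - (f b - f a).toNat) / 2, (f b - f a).toNat, by omega, by omega⟩

end IsRibbon

/-- Describing tiles by absolute columns and heights makes tiles with different starting points
directly comparable. -/
theorem isBallotTile_iff {t : Finset (ℕ × ℤ)} {n n' : ℕ} :
    IsBallotTile t n n' ↔
      ∃ a b f, IsRibbon t a b f ∧ b = a + (2 * n + n') ∧ f b = f a + n' := by
  constructor
  · rintro ⟨x, y, c, hc, hn, rfl⟩
    refine ⟨x, x + (2 * n + n'), fun z => y + height c (z - x), ⟨by omega, ?_, ?_, ?_⟩, rfl, ?_⟩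
    · intro z h1 h2
      have := height_step c (k := z - x) (by omega)
      rw [show z + 1 - x = z - x + 1 by omega]
      omega
    · intro z h1 h2
      have := hc (z - x) (by omega)
      simp only [Nat.sub_self, height_zero]
      omega
    · rintro ⟨z, w⟩
      simp only [mem_image, mem_range, Prod.mk.injEq]
      constructor
      · rintro ⟨k, hk, rfl, rfl⟩
        simp
        omega
      · rintro ⟨h1, h2, h3⟩
        exact ⟨z - x, by omega, by omega, h3.symm⟩
    · simp [hn, height_zero]
  · rintro ⟨a, b, f, h, rfl, hf⟩
    have hh : ∀ k ≤ 2 * n + n',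
        height (ofHeights (2 * n + n') fun k => f (a + k) - f a) k = f (a + k) - f a := by
      intro k hk
      refine height_ofHeights (g := fun k => f (a + k) - f a) (by simp) ?_ hk
      intro k hk
      have := h.step (a + k) (by omega) (by omega)
      simp only [← add_assoc]
      omega
    refine ⟨a, f a, ofHeights (2 * n + n') fun k => f (a + k) - f a, ?_, ?_, ?_⟩
    · intro k hk
      rw [hh k hk]
      have := h.base (a + k) (by omega) (by omega)
      omega
    · rw [hh _ le_rfl, hf]; omega
    · ext ⟨z, w⟩
      rw [h.mem]
      simp only [mem_image, mem_range, Prod.mk.injEq]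
      constructor
      · rintro ⟨h1, h2, h3⟩
        refine ⟨z - a, by omega, by omega, ?_⟩
        rw [hh _ (by omega), show a + (z - a) = z by omega]
        omega
      · rintro ⟨k, hk, rfl, rfl⟩
        rw [hh _ (by omega)]
        refine ⟨by omega, by omega, by omega⟩

/-- The ribbon `t` reaches from column `a` to the column `N` and rises by `h`. -/
def HasRise (N : ℕ) (t : Finset (ℕ × ℤ)) (a : ℕ) (h : ℤ) : Prop :=
  ∃ f, IsRibbon t a N f ∧ f N - f a = h

/-- The ribbon `t` ends at the height at which it starts. -/
def IsLevel (t : Finset (ℕ × ℤ)) : Prop :=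
  ∃ a b f, IsRibbon t a b f ∧ f b = f a

theorem exists_isBallotTile_zero {t : Finset (ℕ × ℤ)} :
    (∃ n, IsBallotTile t n 0) ↔ IsLevel t := by
  constructor
  · rintro ⟨n, hn⟩
    obtain ⟨a, b, f, h, -, h2⟩ := isBallotTile_iff.1 hn
    exact ⟨a, b, f, h, by simpa using h2⟩
  · rintro ⟨a, b, f, h, h2⟩
    obtain ⟨n, n', h3, h4⟩ := h.length
    have : n' = 0 := by omega
    subst this
    exact ⟨n, isBallotTile_iff.2 ⟨a, b, f, h, h3, h4⟩⟩

theorem IsRibbon.isLevel_iff {t : Finset (ℕ × ℤ)} {a b : ℕ} {f : ℕ → ℤ} (h : IsRibbon t a b f) :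
    IsLevel t ↔ f b = f a := by
  refine ⟨?_, fun h2 => ⟨a, b, f, h, h2⟩⟩
  rintro ⟨a', b', f', h', h2⟩
  obtain ⟨rfl, rfl, h3⟩ := h'.unique h
  rw [← h3 _ le_rfl h'.le, ← h3 _ h'.le le_rfl, h2]

/-! ### Tilings of type BI as families of ribbons -/

open Classical in
/-- Cover-inclusive ballot tilings of type BI of the region between the height functions `l`
and `u`, in terms of ribbons. -/
structure Valid (N : ℕ) (l u : ℕ → ℤ) (T : Finset (Finset (ℕ × ℤ))) : Prop where
  tile : ∀ t ∈ T, ∃ a b f, IsRibbon t a b f ∧ (f b = f a ∨ b = N ∧ Odd (f b - f a))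
  disjoint : ∀ t ∈ T, ∀ t' ∈ T, ∀ z, z ∈ t → z ∈ t' → t = t'
  cover : ∀ z : ℕ × ℤ, (∃ t ∈ T, z ∈ t) ↔
    z.1 ≤ N ∧ Odd ((z.1 : ℤ) + z.2) ∧ l z.1 < z.2 ∧ z.2 < u z.1
  incl : ∀ t ∈ T, (∀ z ∈ t, z.2 - 2 < l z.1) ∨ ∃ t' ∈ T, ∀ z ∈ t, (z.1, z.2 - 2) ∈ t'
  even : ∀ a h, Odd h → Even (#{t ∈ T | HasRise N t a h})

/-- The remaining bounds in `skewShape` are automatic: a path has height at most `x` in absolute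
value after `x` steps, and both paths are at `0` in column `0`. -/
theorem mem_skewShape {N : ℕ} (lam mu : Path N) (z : ℕ × ℤ) : z ∈ skewShape lam mu ↔
    z.1 ≤ N ∧ Odd ((z.1 : ℤ) + z.2) ∧ height lam z.1 < z.2 ∧ z.2 < height mu z.1 := by
  obtain ⟨x, y⟩ := z
  simp only [skewShape, mem_filter, mem_product, mem_Icc]
  constructor
  · rintro ⟨⟨⟨h1, h2⟩, h3, h4⟩, h5, h6⟩
    exact ⟨h2, h5, h6⟩
  · rintro ⟨h1, h2, h3, h4⟩
    have h5 := height_le mu h1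
    have h6 := neg_le_height lam h1
    refine ⟨⟨⟨?_, h1⟩, by omega, by omega⟩, h2, h3, h4⟩
    by_contra hx
    have : x = 0 := by omega
    subst this
    rw [height_zero] at h3 h4
    omega

theorem mem_down {t : Finset (ℕ × ℤ)} {z : ℕ × ℤ} : z ∈ down t ↔ (z.1, z.2 + 2) ∈ t := by
  unfold down
  rw [mem_image]
  constructor
  · rintro ⟨b, hb, rfl⟩
    simpa using hb
  · intro h
    exact ⟨_, h, by simp⟩

theorem ncard_sep_eq {α : Type*} (T : Finset α) (p : α → Prop) [DecidablePred p] :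
    {t | t ∈ T ∧ p t}.ncard = #{t ∈ T | p t} := by
  rw [← Set.ncard_coe_finset]
  congr 1
  ext t
  simp

/-- A tile that is not a Dyck tile ends in column `N`, so its length `(2n, n')` carries the same
information as its starting column and its rise. The parity condition can therefore be indexed by
the latter pair. -/
theorem Valid.of_isBallotTiling {N : ℕ} {lam mu : Path N} {T : Finset (Finset (ℕ × ℤ))}
    (h : IsBallotTiling lam mu T) (h' : IsTypeBI T) : Valid N (height lam) (height mu) T where
  tile t ht := by
    obtain ⟨n, n', hn⟩ := h.tile t ht
    obtain ⟨a, b, f, h1, h2, h3⟩ := isBallotTile_iff.1 hn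
    refine ⟨a, b, f, h1, ?_⟩
    rcases Nat.eq_zero_or_pos n' with h0 | h0
    · left; subst h0; simpa using h3
    · right
      obtain ⟨z, hz, hz1, hz2⟩ := h.anchor t ht n n' hn h0
      have h4 := hz1 _ (h1.mem_mk h1.le le_rfl)
      have h5 := (h1.mem z).1 hz
      simp only at h4
      refine ⟨by omega, ?_⟩
      rw [h3, add_sub_cancel_left]
      by_contra hodd
      rw [Int.not_odd_iff_even, Int.even_coe_nat] at hodd
      exact h'.2 n n' hodd h0 t ht hn
  disjoint t ht t' ht' z hz hz' := by
    by_contra hne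
    exact disjoint_left.1 (h.disjoint t ht t' ht' hne) hz hz'
  cover z := by
    rw [← mem_skewShape, ← h.cover]
    simp
  incl t ht := by
    rcases h.coverInclusive t ht with h1 | ⟨t', ht', -, h1⟩
    · left
      intro z hz
      exact h1 (z.1, z.2 - 2) (by rw [mem_down]; simpa using hz)
    · right
      exact ⟨t', ht', fun z hz => h1 (by rw [mem_down]; simpa using hz)⟩
  even a k hk := by
    classical
    by_cases hne : ∃ t ∈ T, HasRise N t a k
    · obtain ⟨t, ht, f, h1, h2⟩ := hne
      obtain ⟨n, n', h3, h4⟩ := h1.length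
      have hk' : (n' : ℤ) = k := by omega
      subst hk'
      have hn' : Odd n' := by simpa using hk
      have := h'.1 n n' hn'
      rw [ncard_sep_eq] at this
      convert this using 2
      refine filter_congr fun s hs => ?_
      rw [isBallotTile_iff]
      constructor
      · rintro ⟨g, h5, h6⟩
        exact ⟨a, N, g, h5, h3, by omega⟩
      · rintro ⟨a', b', g, h5, h6, h7⟩
        obtain ⟨z, hz, hz1, hz2⟩ := h.anchor s hs n n' (isBallotTile_iff.2 ⟨a', b', g, h5, h6, h7⟩)
          hn'.pos
        have h8 := hz1 _ (h5.mem_mk h5.le le_rfl)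
        have h9 := (h5.mem z).1 hz
        simp only at h8
        obtain rfl : b' = N := by omega
        obtain rfl : a' = a := by omega
        exact ⟨g, h5, by omega⟩
    · rw [filter_false_of_mem fun t ht h2 => hne ⟨t, ht, h2⟩]
      simp

theorem Valid.isBallotTiling {N : ℕ} {lam mu : Path N} {T : Finset (Finset (ℕ × ℤ))}
    (h : Valid N (height lam) (height mu) T) : IsBallotTiling lam mu T where
  tile t ht := by
    obtain ⟨a, b, f, h1, -⟩ := h.tile t ht
    obtain ⟨n, n', h3, h4⟩ := h1.length
    exact ⟨n, n', isBallotTile_iff.2 ⟨a, b, f, h1, h3, h4⟩⟩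
  disjoint t ht t' ht' hne := disjoint_left.2 fun z hz hz' => hne (h.disjoint t ht t' ht' z hz hz')
  cover := by
    ext z
    rw [mem_skewShape, ← h.cover]
    simp
  anchor t ht n n' hn hpos := by
    obtain ⟨a, b, f, h1, h2⟩ := h.tile t ht
    obtain ⟨a', b', f', h3, h4, h5⟩ := isBallotTile_iff.1 hn
    obtain ⟨rfl, rfl, h6⟩ := h1.unique h3
    have h7 := h6 _ le_rfl h1.le
    have h8 := h6 _ h1.le le_rfl
    have h9 : b = N := by omega
    subst h9
    exact ⟨_, h1.mem_mk h1.le le_rfl, fun z hz => ((h1.mem z).1 hz).2.1, rfl⟩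
  coverInclusive t ht := by
    rcases h.incl t ht with h1 | ⟨t', ht', h1⟩
    · left
      intro z hz
      rw [mem_down] at hz
      simpa using h1 _ hz
    · right
      refine ⟨t', ht', ?_, fun z hz => ?_⟩
      -- A ribbon has one box per column, so it cannot contain its own translate.
      · rintro rfl
        obtain ⟨a, b, f, h2, -⟩ := h.tile t' ht
        have h3 := (h2.mem _).1 (h1 _ (h2.mem_mk le_rfl h2.le))
        simp only at h3
        omega
      · rw [mem_down] at hz
        simpa using h1 _ hz

theorem Valid.isTypeBI {N : ℕ} {lam mu : Path N} {T : Finset (Finset (ℕ × ℤ))}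
    (h : Valid N (height lam) (height mu) T) : IsTypeBI T := by
  classical
  have key : ∀ t ∈ T, ∀ n n', IsBallotTile t n n' → 0 < n' →
      ∃ f a, IsRibbon t a N f ∧ N = a + (2 * n + n') ∧ f N = f a + n' ∧ Odd n' := by
    intro t ht n n' hn hpos
    obtain ⟨a, b, f, h1, h2⟩ := h.tile t ht
    obtain ⟨a', b', f', h3, h4, h5⟩ := isBallotTile_iff.1 hn
    obtain ⟨rfl, rfl, h6⟩ := h1.unique h3
    have h7 := h6 _ le_rfl h1.le
    have h8 := h6 _ h1.le le_rfl
    obtain ⟨rfl, h9⟩ : b = N ∧ Odd (f b - f a) := by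
      rcases h2 with h2 | h2
      · omega
      · exact h2
    have h10 : f b - f a = n' := by omega
    rw [h10] at h9
    exact ⟨f, a, h1, h4, by omega, by simpa using h9⟩
  constructor
  · intro n n' hodd
    rw [ncard_sep_eq]
    by_cases hN : 2 * n + n' ≤ N
    · have := h.even (N - (2 * n + n')) n' (by simpa using hodd)
      convert this using 2
      refine filter_congr fun s hs => ?_
      constructor
      · intro h1
        obtain ⟨f, a, h2, h3, h4, -⟩ := key s hs n n' h1 hodd.pos
        obtain rfl : a = N - (2 * n + n') := by omega
        exact ⟨f, h2, by omega⟩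
      · rintro ⟨f, h2, h3⟩
        exact isBallotTile_iff.2 ⟨_, _, f, h2, by omega, by omega⟩
    · rw [filter_false_of_mem]
      · simp
      · intro s hs h1
        obtain ⟨f, a, h2, h3, h4, -⟩ := key s hs n n' h1 hodd.pos
        omega
  · intro n n' heven hpos t ht hn
    obtain ⟨f, a, -, -, -, h1⟩ := key t ht n n' hn hpos
    exact Nat.not_odd_iff_even.2 heven h1

/-! ### The generating function as one sum over pairs of a lower path and a tiling -/

open Classical in
/-- The pairs of a lower path and a tiling of type BI for the upper path `mu`. -/
noncomputable def pairsBI {N : ℕ} (mu : Path N) : Finset (Path N × Finset (Finset (ℕ × ℤ))) :=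
  (univ.filter fun lam : Path N => IsBallot lam ∧ Below lam mu).biUnion fun lam =>
    (tilingsBI lam mu).image fun T => (lam, T)

theorem mem_pairsBI {N : ℕ} {mu : Path N} {p : Path N × Finset (Finset (ℕ × ℤ))} :
    p ∈ pairsBI mu ↔
      IsBallot p.1 ∧ Below p.1 mu ∧ Valid N (height p.1) (height mu) p.2 := by
  obtain ⟨lam, T⟩ := p
  simp only [pairsBI, mem_biUnion, mem_filter, mem_univ, true_and, mem_image, Prod.mk.injEq,
    tilingsBI, mem_powerset]
  constructor
  · rintro ⟨_, ⟨h1, h2⟩, _, ⟨-, h3, h4⟩, rfl, rfl⟩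
    exact ⟨h1, h2, Valid.of_isBallotTiling h3 h4⟩
  · rintro ⟨h1, h2, h3⟩
    refine ⟨lam, ⟨h1, h2⟩, T, ⟨?_, h3.isBallotTiling, h3.isTypeBI⟩, rfl, rfl⟩
    intro t ht
    rw [mem_powerset, ← h3.isBallotTiling.cover]
    exact subset_biUnion_of_mem id ht

theorem upperGenFun_eq {N : ℕ} (mu : Path N) :
    upperGenFun mu = ∑ p ∈ pairsBI mu, X ^ tiles p.2 := by
  classical
  unfold upperGenFun pairsBI
  rw [sum_biUnion]
  · refine sum_congr (by ext; simp) fun lam _ => ?_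
    rw [sum_image (by intro a _ b _ h; exact (Prod.mk.inj h).2)]
  · intro l1 _ l2 _ hne
    simp only [Function.onFun, disjoint_left, mem_image]
    rintro p ⟨_, _, rfl⟩ ⟨_, _, h⟩
    exact hne (Prod.mk.inj h).1.symm

open Classical in
theorem tiles_eq (T : Finset (Finset (ℕ × ℤ))) : tiles T = #{t ∈ T | IsLevel t} := by
  unfold tiles
  simp_rw [exists_isBallotTile_zero]
  exact ncard_sep_eq T IsLevel

theorem IsRibbon.hasRise_iff {t : Finset (ℕ × ℤ)} {a b : ℕ} {f : ℕ → ℤ} (h : IsRibbon t a b f)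
    {N a' : ℕ} {r : ℤ} : HasRise N t a' r ↔ a' = a ∧ b = N ∧ f b - f a = r := by
  constructor
  · rintro ⟨g, hg, hr⟩
    obtain ⟨rfl, rfl, h3⟩ := h.unique hg
    rw [h3 _ le_rfl h.le, h3 _ h.le le_rfl]
    exact ⟨rfl, rfl, hr⟩
  · rintro ⟨rfl, rfl, hr⟩
    exact ⟨f, h, hr⟩

theorem isRibbon_singleton (x : ℕ) (y : ℤ) : IsRibbon {(x, y)} x x fun _ => y where
  le := le_rfl
  step := by intros; omega
  base := by intros; rfl
  mem z := by
    rw [mem_singleton, Prod.ext_iff]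
    simp only
    omega

theorem not_hasRise_singleton {N x a : ℕ} {y r : ℤ} (hr : Odd r) :
    ¬ HasRise N {(x, y)} a r := by
  rw [(isRibbon_singleton x y).hasRise_iff]
  rintro ⟨-, -, h⟩
  obtain rfl : r = 0 := by omega
  simp at hr

theorem isLevel_singleton (x : ℕ) (y : ℤ) : IsLevel {(x, y)} :=
  ⟨x, x, _, isRibbon_singleton x y, rfl⟩

theorem Valid.congr {N : ℕ} {l u l' u' : ℕ → ℤ} {T : Finset (Finset (ℕ × ℤ))}
    (h : Valid N l u T) (hl : ∀ x ≤ N, l x = l' x) (hu : ∀ x ≤ N, u x = u' x) :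
    Valid N l' u' T where
  tile := h.tile
  disjoint := h.disjoint
  cover z := by
    rw [h.cover]
    refine and_congr_right fun hz => ?_
    rw [hl _ hz, hu _ hz]
  incl t ht := by
    refine (h.incl t ht).imp_left fun h1 z hz => ?_
    rw [← hl _ ((h.cover z).1 ⟨t, ht, hz⟩).1]
    exact h1 z hz
  even := h.even

/-! ### Flipping a peak of the upper path -/

section Flip

variable {N p : ℕ} {l u v : ℕ → ℤ} {T : Finset (Finset (ℕ × ℤ))}

theorem Valid.singleton_notMem (hvp : v p = u p - 2) (h : Valid N l v T) :
    {(p, u p - 1)} ∉ T := by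
  intro hT
  have := (h.cover (p, u p - 1)).1 ⟨_, hT, mem_singleton_self _⟩
  simp only at this
  omega

/-- The new box is the top box of column `p`. Its translate is either below `l` or a box of the old
shape, hence contained in an old tile. Being level, the new tile does not affect the parity
condition. -/
theorem Valid.insert_singleton (hp : p ≤ N) (hv : ∀ x ≤ N, x ≠ p → v x = u x)
    (hvp : v p = u p - 2) (hl : l p ≤ v p) (hlp : l p % 2 = p % 2) (hup : u p % 2 = p % 2)
    (h : Valid N l v T) : Valid N l u (insert {(p, u p - 1)} T) where
  tile t ht := by
    rcases mem_insert.1 ht with rfl | ht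
    · exact ⟨p, p, _, isRibbon_singleton _ _, Or.inl rfl⟩
    · exact h.tile t ht
  disjoint t ht t' ht' z hz hz' := by
    have key : ∀ s ∈ T, (p, u p - 1) ∉ s := by
      intro s hs hmem
      have := (h.cover _).1 ⟨s, hs, hmem⟩
      simp only at this
      omega
    rcases mem_insert.1 ht with rfl | ht <;> rcases mem_insert.1 ht' with rfl | ht'
    · rfl
    · rw [mem_singleton] at hz
      exact absurd (hz ▸ hz') (key _ ht')
    · rw [mem_singleton] at hz'
      exact absurd (hz' ▸ hz) (key _ ht)
    · exact h.disjoint t ht t' ht' z hz hz'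
  cover z := by
    rw [exists_mem_insert, h.cover, mem_singleton]
    obtain ⟨x, y⟩ := z
    simp only [Prod.mk.injEq]
    by_cases hx : x = p
    · subst hx
      rw [Int.odd_iff]
      omega
    · constructor
      · rintro (⟨h1, -⟩ | ⟨h1, h2, h3, h4⟩)
        · exact absurd h1 hx
        · exact ⟨h1, h2, h3, hv x h1 hx ▸ h4⟩
      · rintro ⟨h1, h2, h3, h4⟩
        exact Or.inr ⟨h1, h2, h3, hv x h1 hx ▸ h4⟩
  incl t ht := by
    rcases mem_insert.1 ht with rfl | ht
    · simp only [mem_singleton, forall_eq]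
      by_cases h1 : u p - 1 - 2 < l p
      · exact Or.inl h1
      · right
        obtain ⟨t', ht', hz⟩ := (h.cover (p, u p - 1 - 2)).2
          ⟨hp, by rw [Int.odd_iff]; simp only; omega, by simp only; omega, by simp only; omega⟩
        exact ⟨t', mem_insert_of_mem ht', hz⟩
    · exact (h.incl t ht).imp_right fun ⟨t', ht', h1⟩ => ⟨t', mem_insert_of_mem ht', h1⟩
  even a r hr := by
    classical
    rw [filter_insert, if_neg (not_hasRise_singleton hr)]
    exact h.even a r hr

/-- Only cover-inclusiveness could fail, if some translated tile were contained in the erased one.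
That tile would have a box above the top box of column `p`. -/
theorem Valid.erase_singleton (hp : p ≤ N) (hv : ∀ x ≤ N, x ≠ p → v x = u x)
    (hvp : v p = u p - 2) (hup : u p % 2 = p % 2) (h : Valid N l u T)
    (hT : {(p, u p - 1)} ∈ T) : Valid N l v (T.erase {(p, u p - 1)}) where
  tile t ht := h.tile t (mem_of_mem_erase ht)
  disjoint t ht t' ht' := h.disjoint t (mem_of_mem_erase ht) t' (mem_of_mem_erase ht')
  cover z := by
    have h1 : (∃ t ∈ T.erase {(p, u p - 1)}, z ∈ t) ↔ (∃ t ∈ T, z ∈ t) ∧ z ≠ (p, u p - 1) := by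
      constructor
      · rintro ⟨t, ht, hz⟩
        refine ⟨⟨t, mem_of_mem_erase ht, hz⟩, ?_⟩
        rintro rfl
        exact ne_of_mem_erase ht
          (h.disjoint t (mem_of_mem_erase ht) _ hT _ hz (mem_singleton_self _))
      · rintro ⟨⟨t, ht, hz⟩, hne⟩
        refine ⟨t, mem_erase.2 ⟨?_, ht⟩, hz⟩
        rintro rfl
        exact hne (mem_singleton.1 hz)
    rw [h1, h.cover]
    obtain ⟨x, y⟩ := z
    simp only [ne_eq, Prod.mk.injEq]
    by_cases hx : x = p
    · subst hx
      simp only [Int.odd_iff, true_and, hvp]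
      constructor
      · rintro ⟨⟨h1, h2, h3, h4⟩, h5⟩
        exact ⟨h1, h2, h3, by omega⟩
      · rintro ⟨h1, h2, h3, h4⟩
        exact ⟨⟨h1, h2, h3, by omega⟩, by omega⟩
    · constructor
      · rintro ⟨⟨h1, h2, h3, h4⟩, -⟩
        exact ⟨h1, h2, h3, (hv x h1 hx).symm ▸ h4⟩
      · rintro ⟨h1, h2, h3, h4⟩
        exact ⟨⟨h1, h2, h3, hv x h1 hx ▸ h4⟩, fun h5 => hx h5.1⟩
  incl t ht := by
    refine (h.incl t (mem_of_mem_erase ht)).imp_right fun ⟨t', ht', h1⟩ => ⟨t', ?_, h1⟩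
    refine mem_erase.2 ⟨?_, ht'⟩
    rintro rfl
    obtain ⟨a, b, f, h2, -⟩ := h.tile t (mem_of_mem_erase ht)
    have h3 := mem_singleton.1 (h1 _ (h2.mem_mk le_rfl h2.le))
    have h4 := (h.cover _).1 ⟨t, mem_of_mem_erase ht, h2.mem_mk le_rfl h2.le⟩
    simp only [Prod.mk.injEq] at h3 h4
    obtain ⟨rfl, h3⟩ := h3
    omega
  even a r hr := by
    classical
    rw [filter_erase, erase_eq_of_notMem]
    · exact h.even a r hr
    · intro h1
      exact not_hasRise_singleton hr (mem_filter.1 h1).2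

end Flip

theorem tiles_insert_singleton {T : Finset (Finset (ℕ × ℤ))} {z : ℕ × ℤ} (h : {z} ∉ T) :
    tiles (insert {z} T) = tiles T + 1 := by
  classical
  rw [tiles_eq, tiles_eq, filter_insert, if_pos (isLevel_singleton _ _), card_insert_of_notMem]
  intro h1
  exact h (mem_filter.1 h1).1

-- Erasing the top box of column `p` is a bijection onto the tilings below `nu`, and it loses one
-- Dyck tile. The case `p = N`, where the last step of the path is flipped, is included.
open Classical in
theorem sum_singleton_mem {N p : ℕ} {mu nu : Path N} (hp : p ≤ N)
    (hnu : ∀ x ≤ N, x ≠ p → height nu x = height mu x)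
    (hnup : height nu p = height mu p - 2) :
    ∑ q ∈ pairsBI mu with {(p, height mu p - 1)} ∈ q.2, (X : ℤ[X]) ^ tiles q.2 =
      X * upperGenFun nu := by
  rw [upperGenFun_eq, mul_sum]
  symm
  refine sum_bij (fun q _ => (q.1, insert {(p, height mu p - 1)} q.2)) ?_ ?_ ?_ ?_
  · rintro ⟨lam, T⟩ hq
    rw [mem_pairsBI] at hq
    obtain ⟨h1, h2, h3⟩ := hq
    simp only at h1 h2 h3
    rw [mem_filter, mem_pairsBI]
    refine ⟨⟨h1, ?_, h3.insert_singleton hp hnu hnup (h2 p hp) (height_emod _ hp)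
      (height_emod _ hp)⟩, mem_insert_self _ _⟩
    intro k hk
    by_cases hkp : k = p
    · subst hkp
      have := h2 k hk
      simp only
      omega
    · exact hnu k hk hkp ▸ h2 k hk
  · rintro ⟨l1, T1⟩ h1 ⟨l2, T2⟩ h2 h
    rw [mem_pairsBI] at h1 h2
    simp only [Prod.mk.injEq] at h h1 h2 ⊢
    refine ⟨h.1, ?_⟩
    rw [← erase_insert (h1.2.2.singleton_notMem hnup), h.2,
      erase_insert (h2.2.2.singleton_notMem hnup)]
  · rintro ⟨lam, T⟩ hq
    rw [mem_filter, mem_pairsBI] at hq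
    obtain ⟨⟨h1, h2, h3⟩, h4⟩ := hq
    simp only at h1 h2 h3 h4
    refine ⟨(lam, T.erase {(p, height mu p - 1)}), ?_, ?_⟩
    · rw [mem_pairsBI]
      refine ⟨h1, ?_, h3.erase_singleton hp hnu hnup (height_emod _ hp) h4⟩
      intro k hk
      by_cases hkp : k = p
      · subst hkp
        have h5 := (h3.cover _).1 ⟨_, h4, mem_singleton_self _⟩
        have h6 := height_emod lam hk
        have h7 := height_emod mu hk
        simp only at h5 ⊢
        omega
      · rw [hnu k hk hkp]
        exact h2 k hk
    · simp only [Prod.mk.injEq, true_and]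
      exact insert_erase h4
  · rintro ⟨lam, T⟩ hq
    rw [mem_pairsBI] at hq
    rw [tiles_insert_singleton (hq.2.2.singleton_notMem hnup), pow_succ']

/-! ### Contracting a peak of the upper path -/

/-- The map of boxes that contracts the columns `c`, `c + 1` and `c + 2` to the column `c`,
where the middle one of them is shifted upwards by one unit. -/
def retract (c : ℕ) (z : ℕ × ℤ) : ℕ × ℤ :=
  if z.1 ≤ c then z else if z.1 = c + 1 then (c, z.2 - 1) else (z.1 - 2, z.2)

/-- The height function `g` with a peak inserted at the position `c`. -/
def lift (c : ℕ) (g : ℕ → ℤ) (x : ℕ) : ℤ :=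
  if x ≤ c then g x else if x = c + 1 then g c + 1 else g (x - 2)

/-- The preimage of `t` under `retract c`. -/
def stretch (c : ℕ) (t : Finset (ℕ × ℤ)) : Finset (ℕ × ℤ) :=
  (t ∪ t.image (fun z => (z.1 + 1, z.2 + 1)) ∪ t.image (fun z => (z.1 + 2, z.2))).filter
    fun z => retract c z ∈ t

theorem mem_stretch {c : ℕ} {t : Finset (ℕ × ℤ)} {z : ℕ × ℤ} :
    z ∈ stretch c t ↔ retract c z ∈ t := by
  unfold stretch
  rw [mem_filter, and_iff_right_of_imp]
  obtain ⟨x, y⟩ := z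
  unfold retract
  simp only [mem_union, mem_image, Prod.mk.injEq]
  intro h
  split_ifs at h with h1 h2
  · exact Or.inl (Or.inl h)
  · exact Or.inl (Or.inr ⟨_, h, by simp [h2]⟩)
  · exact Or.inr ⟨_, h, by simp only; omega, rfl⟩

theorem retract_of_le {c x : ℕ} {y : ℤ} (h : x ≤ c) : retract c (x, y) = (x, y) := by
  simp [retract, h]

theorem retract_succ {c : ℕ} {y : ℤ} : retract c (c + 1, y) = (c, y - 1) := by
  simp [retract]

theorem retract_add_two {c x : ℕ} {y : ℤ} (h : c ≤ x) : retract c (x + 2, y) = (x, y) := by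
  unfold retract
  rw [if_neg (by simp only; omega), if_neg (by simp only; omega)]
  rfl

theorem lift_of_le {c x : ℕ} {g : ℕ → ℤ} (h : x ≤ c) : lift c g x = g x := by
  simp [lift, h]

theorem lift_succ {c : ℕ} {g : ℕ → ℤ} : lift c g (c + 1) = g c + 1 := by
  simp [lift]

theorem lift_add_two {c x : ℕ} {g : ℕ → ℤ} (h : c ≤ x) : lift c g (x + 2) = g x := by
  unfold lift
  rw [if_neg (by omega), if_neg (by omega)]
  rfl

theorem column_cases (c x : ℕ) : x ≤ c ∨ x = c + 1 ∨ ∃ x', x = x' + 2 ∧ c ≤ x' := by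
  rcases le_or_gt x c with h | h
  · exact Or.inl h
  · rcases Nat.eq_or_lt_of_le (Nat.succ_le_of_lt h) with h1 | h1
    · exact Or.inr (Or.inl h1.symm)
    · exact Or.inr (Or.inr ⟨x - 2, by omega, by omega⟩)

theorem retract_surjective (c : ℕ) (w : ℕ × ℤ) : ∃ z, retract c z = w := by
  obtain ⟨x, y⟩ := w
  rcases le_or_gt x c with h | h
  · exact ⟨(x, y), retract_of_le h⟩
  · exact ⟨(x + 2, y), retract_add_two h.le⟩

theorem stretch_injective (c : ℕ) : Function.Injective (stretch c) := by
  intro t t' h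
  ext w
  obtain ⟨z, rfl⟩ := retract_surjective c w
  rw [← mem_stretch, h, mem_stretch]

/-- Each box in column `c` is replaced by a hat on the columns `c`, `c + 1`, `c + 2`. A ribbon that
starts in column `c` therefore still starts there, while one that ends in column `c` now ends in `c
+ 2`; this explains the two different inequalities. -/
theorem IsRibbon.stretch {t : Finset (ℕ × ℤ)} {a b : ℕ} {f : ℕ → ℤ} (h : IsRibbon t a b f)
    (c : ℕ) : IsRibbon (stretch c t) (if a ≤ c then a else a + 2) (if b < c then b else b + 2)
      (lift c f) where
  le := by have := h.le; split_ifs <;> omega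
  step x h1 h2 := by
    have hle := h.le
    rcases column_cases c x with hx | rfl | ⟨x', rfl, hx⟩
    · rw [lift_of_le hx]
      rcases hx.lt_or_eq with hx' | rfl
      · rw [lift_of_le (by omega : x + 1 ≤ c)]
        exact h.step x (by split_ifs at h1 <;> omega) (by split_ifs at h2 <;> omega)
      · rw [lift_succ]; simp
    · rw [lift_succ, show c + 1 + 1 = c + 2 by rfl, lift_add_two le_rfl]
      simp
    · rw [lift_add_two hx, show x' + 2 + 1 = x' + 1 + 2 by omega, lift_add_two (by omega)]
      exact h.step x' (by split_ifs at h1 <;> omega) (by split_ifs at h2 <;> omega)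
  base x h1 h2 := by
    have hle := h.le
    have hfa : lift c f (if a ≤ c then a else a + 2) = f a := by
      split_ifs with h3
      · exact lift_of_le h3
      · exact lift_add_two (by omega)
    rw [hfa]
    rcases column_cases c x with hx | rfl | ⟨x', rfl, hx⟩
    · rw [lift_of_le hx]
      exact h.base x (by split_ifs at h1 <;> omega) (by split_ifs at h2 <;> omega)
    · rw [lift_succ]
      have := h.base c (by split_ifs at h1 <;> omega) (by split_ifs at h2 <;> omega)
      omega
    · rw [lift_add_two hx]
      exact h.base x' (by split_ifs at h1 <;> omega) (by split_ifs at h2 <;> omega)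
  mem z := by
    have hle := h.le
    rw [mem_stretch]
    obtain ⟨x, y⟩ := z
    rcases column_cases c x with hx | rfl | ⟨x', rfl, hx⟩
    · rw [retract_of_le hx, h.mem, lift_of_le hx]
      simp only
      split_ifs <;> omega
    · rw [retract_succ, h.mem, lift_succ]
      simp only
      split_ifs <;> omega
    · rw [retract_add_two hx, h.mem, lift_add_two hx]
      simp only
      split_ifs <;> omega

theorem lift_start {c a : ℕ} {f : ℕ → ℤ} : lift c f (if a ≤ c then a else a + 2) = f a := by
  split_ifs with h3
  · exact lift_of_le h3
  · exact lift_add_two (by omega)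

theorem lift_end {c b : ℕ} {f : ℕ → ℤ} : lift c f (if b < c then b else b + 2) = f b := by
  split_ifs with h3
  · exact lift_of_le h3.le
  · exact lift_add_two (by omega)

/-- A preimage under `retract c` that meets one of the columns `c`, `c + 1`, `c + 2` contains boxes
of equal height in the outer two, so the columns `c + 1` and `c + 2` can be cut out without breaking
the path. -/
theorem IsRibbon.of_stretch {t : Finset (ℕ × ℤ)} {a b c : ℕ} {f : ℕ → ℤ}
    (h : IsRibbon (BallotTiling.stretch c t) a b f) : ∃ a b f, IsRibbon t a b f := by
  have hle := h.le
  have key : a ≤ c + 2 → c ≤ b → a ≤ c ∧ c + 2 ≤ b ∧ f (c + 2) = f c := by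
    intro h1 h2
    have h3 : ∃ y, (c, y) ∈ t := by
      rcases column_cases c a with hx | rfl | ⟨x', rfl, hx⟩
      · exact ⟨f c, by simpa [mem_stretch, retract_of_le] using h.mem_mk hx h2⟩
      · exact ⟨f (c + 1) - 1, by
          simpa [mem_stretch, retract_succ] using h.mem_mk le_rfl hle⟩
      · obtain rfl : x' = c := by omega
        exact ⟨f (x' + 2), by
          simpa [mem_stretch, retract_add_two] using h.mem_mk le_rfl hle⟩
    obtain ⟨y, hy⟩ := h3
    have h4 : (c, y) ∈ BallotTiling.stretch c t := by rwa [mem_stretch, retract_of_le le_rfl]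
    have h5 : (c + 2, y) ∈ BallotTiling.stretch c t := by
      rwa [mem_stretch, retract_add_two le_rfl]
    rw [h.mem] at h4 h5
    simp only at h4 h5
    omega
  refine ⟨if a ≤ c then a else a - 2, if b < c then b else b - 2,
    fun x => f (if x ≤ c then x else x + 2), ?_, ?_, ?_, ?_⟩
  · split_ifs <;> omega
  · intro x h1 h2
    have h3 : a ≤ x + 2 := by split_ifs at h1 <;> omega
    rcases lt_trichotomy x c with hx | rfl | hx
    · simp only [if_pos hx.le, if_pos (Nat.succ_le_of_lt hx)]
      exact h.step x (by split_ifs at h1 <;> omega) (by split_ifs at h2 <;> omega)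
    · have h4 := key h3 (by split_ifs at h2 <;> omega)
      simp only [if_pos le_rfl, if_neg (Nat.not_succ_le_self x)]
      have := h.step (x + 2) (by omega) (by split_ifs at h2 <;> omega)
      rw [h4.2.2] at this
      exact this
    · simp only [if_neg (show ¬ x ≤ c by omega), if_neg (show ¬ x + 1 ≤ c by omega)]
      exact h.step (x + 2) (by omega) (by split_ifs at h2 <;> omega)
  · intro x h1 h2
    have h3 : a ≤ x + 2 := by split_ifs at h1 <;> omega
    have h5 : f (if (if a ≤ c then a else a - 2) ≤ c then (if a ≤ c then a else a - 2)
        else (if a ≤ c then a else a - 2) + 2) = f a := by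
      congr 1
      split_ifs <;> omega
    simp only [h5]
    refine h.base _ ?_ ?_
    · split_ifs at h1 h2 ⊢ <;> omega
    · split_ifs at h1 h2 ⊢ <;> omega
  · rintro ⟨x, y⟩
    rcases le_or_gt x c with hx | hx
    · rw [← retract_of_le (y := y) hx, ← mem_stretch, h.mem, retract_of_le hx]
      simp only [if_pos hx]
      split_ifs <;> omega
    · rw [← retract_add_two (y := y) hx.le, ← mem_stretch, h.mem, retract_add_two hx.le]
      simp only [if_neg hx.not_ge]
      split_ifs <;> omega

theorem isLevel_stretch {t : Finset (ℕ × ℤ)} {a b c : ℕ} {f : ℕ → ℤ} (h : IsRibbon t a b f) :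
    IsLevel (stretch c t) ↔ IsLevel t := by
  rw [(h.stretch c).isLevel_iff, h.isLevel_iff, lift_start, lift_end]

theorem hasRise_stretch {t : Finset (ℕ × ℤ)} {a b c N a' : ℕ} {f : ℕ → ℤ} {r : ℤ} (hc : c ≤ N)
    (h : IsRibbon t a b f) : HasRise (N + 2) (stretch c t) a' r ↔
      a' = (if a ≤ c then a else a + 2) ∧ b = N ∧ f b - f a = r := by
  rw [(h.stretch c).hasRise_iff, lift_start, lift_end]
  refine and_congr_right fun _ => and_congr_left fun _ => ?_
  split_ifs <;> omega

/-- The hat raises `l`, `u` and all tiles alike in column `c + 1`, so every condition on boxes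
transfers along `retract`. Rises are unchanged and starting columns move injectively, so the parity
classes correspond. -/
theorem Valid.stretch {N c : ℕ} {l u : ℕ → ℤ} {T : Finset (Finset (ℕ × ℤ))} (hc : c ≤ N)
    (h : Valid N l u T) : Valid (N + 2) (lift c l) (lift c u) (T.image (stretch c)) where
  tile s hs := by
    obtain ⟨t, ht, rfl⟩ := mem_image.1 hs
    obtain ⟨a, b, f, h1, h2⟩ := h.tile t ht
    refine ⟨_, _, _, h1.stretch c, ?_⟩
    rw [lift_start, lift_end]
    refine h2.imp_right fun h3 => ⟨?_, h3.2⟩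
    rw [if_neg (by omega), h3.1]
  disjoint s hs s' hs' z hz hz' := by
    obtain ⟨t, ht, rfl⟩ := mem_image.1 hs
    obtain ⟨t', ht', rfl⟩ := mem_image.1 hs'
    rw [h.disjoint t ht t' ht' _ (mem_stretch.1 hz) (mem_stretch.1 hz')]
  cover z := by
    rw [exists_mem_image]
    simp only [mem_stretch]
    rw [h.cover]
    obtain ⟨x, y⟩ := z
    simp only [Int.odd_iff]
    rcases column_cases c x with hx | rfl | ⟨x', rfl, hx⟩
    · rw [retract_of_le hx, lift_of_le hx, lift_of_le hx]
      simp only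
      omega
    · rw [retract_succ, lift_succ, lift_succ]
      simp only
      omega
    · rw [retract_add_two hx, lift_add_two hx, lift_add_two hx]
      simp only
      omega
  incl s hs := by
    obtain ⟨t, ht, rfl⟩ := mem_image.1 hs
    rcases h.incl t ht with h1 | ⟨t', ht', h1⟩
    · left
      rintro ⟨x, y⟩ hz
      have h2 := h1 _ (mem_stretch.1 hz)
      rcases column_cases c x with hx | rfl | ⟨x', rfl, hx⟩
      · rw [retract_of_le hx] at h2
        rwa [lift_of_le hx]
      · rw [retract_succ] at h2
        rw [lift_succ]
        simp only at h2 ⊢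
        omega
      · rw [retract_add_two hx] at h2
        rwa [lift_add_two hx]
    · right
      refine ⟨_, mem_image_of_mem _ ht', ?_⟩
      rintro ⟨x, y⟩ hz
      have h2 := h1 _ (mem_stretch.1 hz)
      rw [mem_stretch]
      rcases column_cases c x with hx | rfl | ⟨x', rfl, hx⟩
      · rw [retract_of_le hx] at h2 ⊢
        exact h2
      · rw [retract_succ] at h2 ⊢
        convert h2 using 2
        simp only
        omega
      · rw [retract_add_two hx] at h2 ⊢
        exact h2
  even a r hr := by
    classical
    rw [filter_image, card_image_of_injective _ (stretch_injective c)]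
    have key : ∀ a', (a' = if a ≤ c then a else a - 2) → (a ≤ c ∨ c + 3 ≤ a) →
        ∀ t ∈ T, HasRise (N + 2) (BallotTiling.stretch c t) a r ↔ HasRise N t a' r := by
      intro a' ha' hac t ht
      obtain ⟨a0, b, f, h1, -⟩ := h.tile t ht
      rw [hasRise_stretch hc h1, h1.hasRise_iff]
      refine and_congr_left fun _ => ?_
      split_ifs at ha' ⊢ <;> omega
    -- No stretched tile starts in column `c + 1` or `c + 2`.
    by_cases hac : a ≤ c ∨ c + 3 ≤ a
    · rw [filter_congr (key _ rfl hac)]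
      exact h.even _ r hr
    · rw [filter_false_of_mem]
      · simp
      · intro t ht h2
        obtain ⟨a0, b, f, h1, -⟩ := h.tile t ht
        rw [hasRise_stretch hc h1] at h2
        split_ifs at h2 <;> omega

theorem Valid.of_stretch {N c : ℕ} {l u : ℕ → ℤ} {T : Finset (Finset (ℕ × ℤ))} (hc : c ≤ N)
    (h : Valid (N + 2) (lift c l) (lift c u) (T.image (BallotTiling.stretch c))) :
    Valid N l u T := by
  have rib : ∀ t ∈ T, ∃ a b f, IsRibbon t a b f := by
    intro t ht
    obtain ⟨a, b, f, h1, -⟩ := h.tile _ (mem_image_of_mem _ ht)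
    exact h1.of_stretch
  refine ⟨?_, ?_, ?_, ?_, ?_⟩
  · intro t ht
    obtain ⟨a, b, f, h1⟩ := rib t ht
    refine ⟨a, b, f, h1, ?_⟩
    obtain ⟨a', b', f', h2, h3⟩ := h.tile _ (mem_image_of_mem _ ht)
    obtain ⟨h4, h5, h6⟩ := (h1.stretch c).unique h2
    have h7 := h6 _ le_rfl (h1.stretch c).le
    have h8 := h6 _ (h1.stretch c).le le_rfl
    rw [lift_start, h4] at h7
    rw [lift_end, h5] at h8
    rw [h7, h8]
    refine h3.imp_right fun h9 => ⟨?_, h9.2⟩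
    have := h9.1
    split_ifs at h5 <;> omega
  · intro t ht t' ht' w hw hw'
    obtain ⟨z, rfl⟩ := retract_surjective c w
    exact stretch_injective c (h.disjoint _ (mem_image_of_mem _ ht) _ (mem_image_of_mem _ ht') z
      (mem_stretch.2 hw) (mem_stretch.2 hw'))
  · rintro ⟨x, y⟩
    rcases le_or_gt x c with hx | hx
    · have := h.cover (x, y)
      rw [exists_mem_image] at this
      simp only [mem_stretch] at this
      rw [retract_of_le hx, lift_of_le hx, lift_of_le hx] at this
      rw [this]
      simp only [Int.odd_iff]
      omega
    · have := h.cover (x + 2, y)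
      rw [exists_mem_image] at this
      simp only [mem_stretch] at this
      rw [retract_add_two hx.le, lift_add_two hx.le, lift_add_two hx.le] at this
      rw [this]
      simp only [Int.odd_iff]
      omega
  · intro t ht
    refine (h.incl _ (mem_image_of_mem _ ht)).imp ?_ ?_
    · rintro h1 ⟨x, y⟩ hw
      rcases le_or_gt x c with hx | hx
      · have := h1 (x, y) (by rwa [mem_stretch, retract_of_le hx])
        rwa [lift_of_le hx] at this
      · have := h1 (x + 2, y) (by rwa [mem_stretch, retract_add_two hx.le])
        rwa [lift_add_two hx.le] at this
    · rintro ⟨s, hs, h1⟩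
      obtain ⟨t', ht', rfl⟩ := mem_image.1 hs
      refine ⟨t', ht', ?_⟩
      rintro ⟨x, y⟩ hw
      rcases le_or_gt x c with hx | hx
      · have := h1 (x, y) (by rwa [mem_stretch, retract_of_le hx])
        rwa [mem_stretch, retract_of_le hx] at this
      · have := h1 (x + 2, y) (by rwa [mem_stretch, retract_add_two hx.le])
        rwa [mem_stretch, retract_add_two hx.le] at this
  · classical
    intro a r hr
    have := h.even (if a ≤ c then a else a + 2) r hr
    rw [filter_image, card_image_of_injective _ (stretch_injective c)] at this
    convert this using 2
    refine filter_congr fun t ht => ?_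
    obtain ⟨a0, b, f, h1⟩ := rib t ht
    rw [hasRise_stretch hc h1, h1.hasRise_iff]
    refine and_congr_left fun _ => ?_
    split_ifs <;> omega

section Contract

variable {N c : ℕ} {l u : ℕ → ℤ} {T : Finset (Finset (ℕ × ℤ))}

/-- Here `k` numbers the boxes of column `c + 1` from the top. The tile of the top box has no room
to leave it except by a hat; cover-inclusiveness hands the hat down from each box to the one below
it. -/
theorem Valid.mem_beside_peak (hc : c ≤ N) (hu1 : u (c + 1) = u c + 1) (hu2 : u (c + 2) = u c)
    (hpar : u (c + 1) % 2 = ((c + 1 : ℕ) : ℤ) % 2)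
    (h : Valid (N + 2) l u T) (hT : {(c + 1, u (c + 1) - 1)} ∉ T) (k : ℕ) :
    ∀ t ∈ T, (c + 1, u (c + 1) - 1 - 2 * k) ∈ t →
      (c, u (c + 1) - 2 - 2 * k) ∈ t ∧ (c + 2, u (c + 1) - 2 - 2 * k) ∈ t := by
  induction k with
  | zero =>
    intro t ht hz
    simp only [Nat.cast_zero, mul_zero, sub_zero] at hz ⊢
    obtain ⟨a, b, f, h1, h2⟩ := h.tile t ht
    have hz1 := (h1.mem _).1 hz
    simp only at hz1
    have hcov : ∀ x, a ≤ x → x ≤ b → f x < u x := fun x hx hx' =>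
      ((h.cover _).1 ⟨t, ht, h1.mem_mk hx hx'⟩).2.2.2
    -- A longer tile starting below the peak would have to stay weakly above its first box, but `u`
    -- leaves no such room in column `c + 2`.
    have ha : a ≤ c := by
      by_contra hac
      obtain rfl : a = c + 1 := by omega
      have hb : b ≠ c + 1 := by
        rintro rfl
        apply hT
        convert ht
        ext z
        rw [h1.mem, mem_singleton, Prod.ext_iff]
        constructor
        · rintro ⟨h3, h4⟩
          rw [h3, h4]
          omega
        · rintro ⟨h3, h4, h5⟩
          rw [show z.1 = c + 1 by omega] at h5 ⊢
          omega
      have h3 := h1.base (c + 2) (by omega) (by omega)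
      have h4 := h1.step (c + 1) le_rfl (by omega)
      have h5 := hcov (c + 2) (by omega) (by omega)
      rw [show c + 1 + 1 = c + 2 by rfl] at h4
      omega
    have h3 := h1.step c ha (by omega)
    have h4 := hcov c ha (by omega)
    have h5 := h1.base c ha (by omega)
    -- A tile ending in column `c + 1` is not anchored, so it would be level; but its box in column
    -- `c` is lower than its last box, contradicting `base`.
    have hb : c + 2 ≤ b := by
      by_contra hcb
      obtain rfl : b = c + 1 := by omega
      rcases h2 with h2 | h2 <;> omega
    have h6 := h1.step (c + 1) (by omega) (by omega)
    rw [show c + 1 + 1 = c + 2 by rfl] at h6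
    have h7 := hcov (c + 2) (by omega) hb
    constructor
    · rw [h1.mem]
      exact ⟨ha, by simp only; omega, by simp only; omega⟩
    · rw [h1.mem]
      exact ⟨by simp only; omega, hb, by simp only; omega⟩
  | succ k ih =>
    intro t ht hz
    have hz1 := (h.cover _).1 ⟨t, ht, hz⟩
    push_cast at hz1 hz ⊢
    simp only [Int.odd_iff] at hz1
    obtain ⟨t1, ht1, h1⟩ := (h.cover (c + 1, u (c + 1) - 1 - 2 * k)).2
      ⟨by simp only; omega, by simp only [Int.odd_iff]; omega, by simp only; omega,
        by simp only; omega⟩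
    obtain ⟨h2, h3⟩ := ih t1 ht1 h1
    rcases h.incl t1 ht1 with h4 | ⟨t', ht', h4⟩
    · have := h4 _ h1
      simp only at this
      omega
    · have h5 := h4 _ h1
      have h6 := h4 _ h2
      have h7 := h4 _ h3
      simp only at h5 h6 h7
      rw [show u (c + 1) - 1 - 2 * (k : ℤ) - 2 = u (c + 1) - 1 - 2 * (k + 1) by ring] at h5
      rw [show u (c + 1) - 2 - 2 * (k : ℤ) - 2 = u (c + 1) - 2 - 2 * (k + 1) by ring] at h6 h7
      obtain rfl := h.disjoint t ht t' ht' _ hz h5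
      exact ⟨h6, h7⟩

theorem Valid.mem_beside_peak' (hc : c ≤ N) (hu1 : u (c + 1) = u c + 1) (hu2 : u (c + 2) = u c)
    (hpar : u (c + 1) % 2 = ((c + 1 : ℕ) : ℤ) % 2)
    (h : Valid (N + 2) l u T) (hT : {(c + 1, u (c + 1) - 1)} ∉ T) {t : Finset (ℕ × ℤ)}
    (ht : t ∈ T) {y : ℤ} (hy : (c + 1, y) ∈ t) : (c, y - 1) ∈ t ∧ (c + 2, y - 1) ∈ t := by
  have h1 := (h.cover _).1 ⟨t, ht, hy⟩
  simp only [Int.odd_iff] at h1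
  obtain ⟨k, hk⟩ : ∃ k : ℕ, y = u (c + 1) - 1 - 2 * k :=
    ⟨((u (c + 1) - 1 - y) / 2).toNat, by omega⟩
  have := h.mem_beside_peak hc hu1 hu2 hpar hT k t ht (hk ▸ hy)
  rwa [show y - 1 = u (c + 1) - 2 - 2 * k by omega]

/-- If the upper path has a peak and the box below it is not a tile by itself, then the lower
path has a peak at the same position. -/
theorem Valid.lower_peak (hc : c ≤ N) (hu1 : u (c + 1) = u c + 1) (hu2 : u (c + 2) = u c)
    (hpar : u (c + 1) % 2 = ((c + 1 : ℕ) : ℤ) % 2)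
    (hlpar : l (c + 1) % 2 = ((c + 1 : ℕ) : ℤ) % 2) (hle : ∀ x ≤ N + 2, l x ≤ u x)
    (hl1 : l (c + 1) = l c + 1 ∨ l (c + 1) = l c - 1)
    (hl2 : l (c + 2) = l (c + 1) + 1 ∨ l (c + 2) = l (c + 1) - 1)
    (h : Valid (N + 2) l u T) (hT : {(c + 1, u (c + 1) - 1)} ∉ T) :
    l (c + 1) = l c + 1 ∧ l (c + 2) = l c := by
  have h1 := hle c (by omega)
  have h2 := hle (c + 1) (by omega)
  have h3 := hle (c + 2) (by omega)
  by_cases heq : l (c + 1) = u (c + 1)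
  · omega
  · obtain ⟨t, ht, h4⟩ := (h.cover (c + 1, l (c + 1) + 1)).2
      ⟨by simp only; omega, by simp only [Int.odd_iff]; omega, by simp only; omega,
        by simp only; omega⟩
    obtain ⟨h5, h6⟩ := h.mem_beside_peak' hc hu1 hu2 hpar hT ht h4
    have h7 := (h.cover _).1 ⟨t, ht, h5⟩
    have h8 := (h.cover _).1 ⟨t, ht, h6⟩
    simp only at h7 h8
    omega

/-- Since `l` and `u` both have a peak, each box of the shape in an outer column has the middle box
of its hat in the shape too. With `mem_beside_peak'`, a tile contains a hat entirely or not at all,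
so it is a union of fibres of `retract c`. -/
theorem Valid.stretch_image_retract (hc : c ≤ N) (hu1 : u (c + 1) = u c + 1)
    (hu2 : u (c + 2) = u c) (hpar : u (c + 1) % 2 = ((c + 1 : ℕ) : ℤ) % 2)
    (hl1 : l (c + 1) = l c + 1) (hl2 : l (c + 2) = l c)
    (h : Valid (N + 2) l u T) (hT : {(c + 1, u (c + 1) - 1)} ∉ T) {t : Finset (ℕ × ℤ)}
    (ht : t ∈ T) : BallotTiling.stretch c (t.image (retract c)) = t := by
  have hside : ∀ x, x = c ∨ x = c + 2 → ∀ y, (x, y) ∈ t → (c + 1, y + 1) ∈ t := by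
    intro x hx y hy
    have h1 := (h.cover _).1 ⟨t, ht, hy⟩
    simp only [Int.odd_iff] at h1
    obtain ⟨t1, ht1, h2⟩ := (h.cover (c + 1, y + 1)).2
      ⟨by simp only; omega, by simp only [Int.odd_iff]; omega,
        by rcases hx with rfl | rfl <;> simp only <;> omega,
        by rcases hx with rfl | rfl <;> simp only <;> omega⟩
    have h3 := h.mem_beside_peak' hc hu1 hu2 hpar hT ht1 h2
    rw [add_sub_cancel_right] at h3
    have h4 : (x, y) ∈ t1 := by
      rcases hx with rfl | rfl
      · exact h3.1
      · exact h3.2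
    rwa [h.disjoint t ht t1 ht1 _ hy h4]
  have hpeak : ∀ y, (c, y) ∈ t ∨ (c + 1, y + 1) ∈ t ∨ (c + 2, y) ∈ t →
      (c, y) ∈ t ∧ (c + 1, y + 1) ∈ t ∧ (c + 2, y) ∈ t := by
    intro y hy
    have h1 : (c + 1, y + 1) ∈ t := by
      rcases hy with h1 | h1 | h1
      · exact hside _ (Or.inl rfl) y h1
      · exact h1
      · exact hside _ (Or.inr rfl) y h1
    have h3 := h.mem_beside_peak' hc hu1 hu2 hpar hT ht h1
    rw [add_sub_cancel_right] at h3
    exact ⟨h3.1, h1, h3.2⟩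
  ext ⟨x, y⟩
  rw [mem_stretch, mem_image]
  refine ⟨?_, fun h1 => ⟨_, h1, rfl⟩⟩
  rintro ⟨⟨x1, y1⟩, h1, h2⟩
  rcases column_cases c x with hx | rfl | ⟨x', rfl, hx⟩ <;>
  rcases column_cases c x1 with hx1 | rfl | ⟨x1', rfl, hx1⟩ <;>
  simp only [retract_of_le, retract_succ, retract_add_two, *, Prod.mk.injEq] at h2 <;>
  obtain ⟨h2, h3⟩ := h2
  · subst h2 h3; exact h1
  · subst h2 h3
    exact (hpeak (y1 - 1) (Or.inr (Or.inl (by rwa [sub_add_cancel])))).1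
  · obtain rfl : x1' = c := by omega
    subst h2 h3
    exact (hpeak y1 (Or.inr (Or.inr h1))).1
  · subst h2
    have := (hpeak y1 (Or.inl h1)).2.1
    rwa [show y1 + 1 = y by omega] at this
  · obtain rfl : y = y1 := by omega
    exact h1
  · subst h2
    have := (hpeak y1 (Or.inr (Or.inr h1))).2.1
    rwa [show y1 + 1 = y by omega] at this
  · obtain rfl : x' = c := by omega
    subst h2 h3
    exact (hpeak y1 (Or.inl h1)).2.2
  · subst h2 h3
    exact (hpeak (y1 - 1) (Or.inr (Or.inl (by rwa [sub_add_cancel])))).2.2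
  · subst h2 h3; exact h1

end Contract

theorem lift_step {N c : ℕ} (hc : c ≤ N) {g : ℕ → ℤ}
    (hg : ∀ k < N, g (k + 1) = g k + 1 ∨ g (k + 1) = g k - 1) (k : ℕ) (hk : k < N + 2) :
    lift c g (k + 1) = lift c g k + 1 ∨ lift c g (k + 1) = lift c g k - 1 := by
  rcases column_cases c k with hx | rfl | ⟨x', rfl, hx⟩
  · rcases hx.lt_or_eq with hx' | rfl
    · rw [lift_of_le hx, lift_of_le (by omega : k + 1 ≤ c)]
      exact hg k (by omega)
    · rw [lift_of_le hx, lift_succ]; simp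
  · rw [lift_succ, show c + 1 + 1 = c + 2 by rfl, lift_add_two le_rfl]
    simp
  · rw [lift_add_two hx, show x' + 2 + 1 = x' + 1 + 2 by omega, lift_add_two (by omega)]
    exact hg x' (by omega)

theorem tiles_image_stretch {N c : ℕ} {l u : ℕ → ℤ} {T : Finset (Finset (ℕ × ℤ))}
    (h : Valid N l u T) : tiles (T.image (stretch c)) = tiles T := by
  classical
  rw [tiles_eq, tiles_eq, filter_image, card_image_of_injective _ (stretch_injective c)]
  congr 1
  refine filter_congr fun t ht => ?_
  obtain ⟨a, b, f, h1, -⟩ := h.tile t ht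
  exact isLevel_stretch h1

theorem singleton_ne_stretch {c : ℕ} {y : ℤ} (t : Finset (ℕ × ℤ)) :
    stretch c t ≠ {(c + 1, y)} := by
  intro h
  have h1 : (c + 1, y) ∈ stretch c t := by rw [h]; exact mem_singleton_self _
  rw [mem_stretch, retract_succ] at h1
  have h2 : (c, y - 1) ∈ stretch c t := by rwa [mem_stretch, retract_of_le le_rfl]
  rw [h, mem_singleton] at h2
  simp at h2

-- Inserting a peak into the lower path and stretching all tiles is a bijection onto the tilings in
-- question, and it preserves the number of Dyck tiles. A stretched tile is never the single box
-- below the peak; conversely `lower_peak` and `stretch_image_retract` allow contraction.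
open Classical in
theorem sum_singleton_notMem {N c : ℕ} (hc : c ≤ N) {mu : Path (N + 2)} {nu : Path N}
    (hmu : ∀ x ≤ N + 2, height mu x = lift c (height nu) x) :
    ∑ q ∈ pairsBI mu with {(c + 1, height mu (c + 1) - 1)} ∉ q.2, (X : ℤ[X]) ^ tiles q.2 =
      upperGenFun nu := by
  rw [upperGenFun_eq]
  have hlift : ∀ lam : Path N, ∀ x ≤ N + 2,
      height (ofHeights (N + 2) (lift c (height lam))) x = lift c (height lam) x := by
    intro lam x hx
    refine height_ofHeights ?_ (lift_step hc fun k hk => height_step lam hk) hx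
    rw [lift_of_le (Nat.zero_le c), height_zero]
  have hu1 : height mu (c + 1) = height mu c + 1 := by
    rw [hmu _ (by omega), hmu _ (by omega), lift_succ, lift_of_le le_rfl]
  have hu2 : height mu (c + 2) = height mu c := by
    rw [hmu _ (by omega), hmu _ (by omega), lift_add_two le_rfl, lift_of_le le_rfl]
  symm
  refine sum_bij (fun q _ => (ofHeights (N + 2) (lift c (height q.1)), q.2.image (stretch c)))
    ?_ ?_ ?_ ?_
  · rintro ⟨lam, T⟩ hq
    rw [mem_pairsBI] at hq
    obtain ⟨h1, h2, h3⟩ := hq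
    simp only at h1 h2 h3
    rw [mem_filter, mem_pairsBI]
    refine ⟨⟨?_, ?_, ?_⟩, ?_⟩
    · intro k hk
      simp only
      rw [hlift _ _ hk]
      rcases column_cases c k with hx | rfl | ⟨x', rfl, hx⟩
      · rw [lift_of_le hx]; exact h1 k (by omega)
      · rw [lift_succ]; have := h1 c hc; omega
      · rw [lift_add_two hx]; exact h1 x' (by omega)
    · intro k hk
      simp only
      rw [hlift _ _ hk, hmu _ hk]
      rcases column_cases c k with hx | rfl | ⟨x', rfl, hx⟩
      · rw [lift_of_le hx, lift_of_le hx]; exact h2 k (by omega)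
      · rw [lift_succ, lift_succ]; have := h2 c hc; omega
      · rw [lift_add_two hx, lift_add_two hx]; exact h2 x' (by omega)
    · exact (h3.stretch hc).congr (fun x hx => (hlift lam x hx).symm) fun x hx => (hmu x hx).symm
    · intro h4
      obtain ⟨t, -, h5⟩ := mem_image.1 h4
      exact singleton_ne_stretch t h5
  · rintro ⟨l1, T1⟩ - ⟨l2, T2⟩ - h
    simp only [Prod.mk.injEq] at h ⊢
    refine ⟨path_ext fun k hk => ?_, image_injective (stretch_injective c) h.2⟩
    rcases le_or_gt k c with hx | hx
    · rw [← lift_of_le (g := height l1) hx, ← lift_of_le (g := height l2) hx,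
        ← hlift l1 k (by omega), h.1, hlift l2 k (by omega)]
    · rw [← lift_add_two (g := height l1) hx.le, ← lift_add_two (g := height l2) hx.le,
        ← hlift l1 (k + 2) (by omega), h.1, hlift l2 (k + 2) (by omega)]
  · rintro ⟨lam, T⟩ hq
    rw [mem_filter, mem_pairsBI] at hq
    obtain ⟨⟨h1, h2, h3⟩, h4⟩ := hq
    simp only at h1 h2 h3 h4
    have hpar := height_emod mu (by omega : c + 1 ≤ N + 2)
    obtain ⟨hl1, hl2⟩ := h3.lower_peak hc hu1 hu2 hpar (height_emod lam (by omega)) h2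
      (height_step lam (by omega)) (height_step lam (by omega)) h4
    -- The lower path without its peak; it is again a lattice path because `lam` has equal heights
    -- at `c` and `c + 2`.
    set g : ℕ → ℤ := fun x => height lam (if x ≤ c then x else x + 2) with hg
    have hgl : ∀ x ≤ N, height (ofHeights N g) x = g x := by
      intro x hx
      refine height_ofHeights (by simp [hg, height_zero]) ?_ hx
      intro k hk
      rcases lt_trichotomy k c with hx | rfl | hx
      · simp only [hg, if_pos hx.le, if_pos (Nat.succ_le_of_lt hx)]
        exact height_step lam (by omega)
      · simp only [hg, if_pos le_rfl, if_neg (Nat.not_succ_le_self k)]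
        have := height_step lam (k := k + 2) (by omega)
        rw [hl2] at this
        exact this
      · simp only [hg, if_neg (show ¬ k ≤ c by omega), if_neg (show ¬ k + 1 ≤ c by omega)]
        exact height_step lam (k := k + 2) (by omega)
    have hll : ∀ x ≤ N + 2, lift c (height (ofHeights N g)) x = height lam x := by
      intro x hx
      rcases column_cases c x with hx | rfl | ⟨x', rfl, hx'⟩
      · rw [lift_of_le hx, hgl _ (by omega)]
        simp only [hg, if_pos hx]
      · rw [lift_succ, hgl _ (by omega)]
        simp only [hg, if_pos le_rfl, hl1]
      · rw [lift_add_two hx', hgl _ (by omega)]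
        rcases hx'.eq_or_lt with rfl | hx''
        · simp only [hg, if_pos le_rfl, hl2]
        · simp only [hg, if_neg hx''.not_ge]
    have hTT : (T.image fun t => t.image (retract c)).image (stretch c) = T := by
      rw [image_image]
      conv_rhs => rw [← image_id (s := T)]
      refine image_congr fun t ht => ?_
      exact h3.stretch_image_retract hc hu1 hu2 hpar hl1 hl2 h4 ht
    refine ⟨(ofHeights N g, T.image fun t => t.image (retract c)), ?_, ?_⟩
    · rw [mem_pairsBI]
      refine ⟨?_, ?_, ?_⟩
      · intro k hk
        simp only
        rw [hgl k hk]
        exact h1 _ (by split_ifs <;> omega)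
      · intro k hk
        simp only
        rw [hgl k hk]
        simp only [hg]
        have h5 : height nu k = height mu (if k ≤ c then k else k + 2) := by
          split_ifs with hk'
          · rw [hmu _ (by omega), lift_of_le hk']
          · rw [hmu _ (by omega), lift_add_two (by omega)]
        rw [h5]
        exact h2 _ (by split_ifs <;> omega)
      · refine Valid.of_stretch hc ?_
        rw [hTT]
        exact h3.congr (fun x hx => (hll x hx).symm) hmu
    · simp only [Prod.mk.injEq]
      refine ⟨path_ext fun k hk => ?_, hTT⟩
      rw [hlift _ _ hk, hll _ hk]
  · rintro ⟨lam, T⟩ hq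
    rw [mem_pairsBI] at hq
    rw [tiles_image_stretch hq.2.2]

/-! ### Counting tiles -/

section Counting

variable {N : ℕ} {l u : ℕ → ℤ} {T : Finset (Finset (ℕ × ℤ))}

theorem Valid.not_isLevel (h : Valid N l u T) {t : Finset (ℕ × ℤ)} (ht : t ∈ T) :
    ¬ IsLevel t ↔ ∃ a r, HasRise N t a r ∧ Odd r := by
  obtain ⟨a, b, f, h1, h2⟩ := h.tile t ht
  rw [h1.isLevel_iff]
  simp only [h1.hasRise_iff]
  constructor
  · intro h3
    obtain ⟨rfl, h4⟩ := h2.resolve_left h3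
    exact ⟨a, _, ⟨rfl, rfl, rfl⟩, h4⟩
  · rintro ⟨_, _, ⟨-, -, rfl⟩, h3⟩ h4
    rw [h4, sub_self] at h3
    simp at h3

theorem HasRise.unique {t : Finset (ℕ × ℤ)} {a a' : ℕ} {r r' : ℤ} (h : HasRise N t a r)
    (h' : HasRise N t a' r') : a = a' ∧ r = r' := by
  obtain ⟨f, h1, h2⟩ := h
  obtain ⟨h3, -, h4⟩ := h1.hasRise_iff.1 h'
  exact ⟨h3.symm, by omega⟩

-- The non-level tiles split into classes by starting column and rise, and each class is even by
-- type BI.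
open Classical in
theorem Valid.even_card_not_isLevel (h : Valid N l u T) : Even (#{t ∈ T | ¬ IsLevel t}) := by
  -- The value `(0, 0)` is a dummy: every non-level tile has a starting column and a rise.
  let φ : Finset (ℕ × ℤ) → ℕ × ℤ := fun t =>
    if ht : ∃ p : ℕ × ℤ, HasRise N t p.1 p.2 then ht.choose else (0, 0)
  have hφ : ∀ t a r, HasRise N t a r → φ t = (a, r) := by
    intro t a r ht
    have hex : ∃ p : ℕ × ℤ, HasRise N t p.1 p.2 := ⟨(a, r), ht⟩
    simp only [φ, dif_pos hex]
    have := hex.choose_spec.unique ht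
    exact Prod.ext this.1 this.2
  rw [card_eq_sum_card_image φ]
  refine even_sum _ fun p hp => ?_
  obtain ⟨t, ht, rfl⟩ := mem_image.1 hp
  rw [mem_filter] at ht
  obtain ⟨a, r, h1, h2⟩ := (h.not_isLevel ht.1).1 ht.2
  rw [hφ t a r h1, filter_filter]
  refine (congrArg (fun s => Even #s) (filter_congr fun s hs => ?_)).mpr (h.even a r h2)
  refine ⟨?_, fun h3 => ⟨(h.not_isLevel hs).2 ⟨a, r, h3, h2⟩, hφ _ _ _ h3⟩⟩
  rintro ⟨h3, h4⟩
  obtain ⟨a', r', h5, h6⟩ := (h.not_isLevel hs).1 h3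
  rw [hφ _ _ _ h5, Prod.mk.injEq] at h4
  rwa [h4.1, h4.2] at h5

-- Every tile has at most one box in column `N`, and the boxes there are spaced by two, at the
-- heights `l N + 1 + 2 * k`. Validity is not assumed, so that the count also applies to extensions
-- whose parity condition is still open.
open Classical in
theorem two_mul_card_column (hrib : ∀ t ∈ T, ∃ a b f, IsRibbon t a b f)
    (hdisj : ∀ t ∈ T, ∀ t' ∈ T, ∀ z, z ∈ t → z ∈ t' → t = t')
    (hcover : ∀ y : ℤ, (∃ t ∈ T, (N, y) ∈ t) ↔ Odd ((N : ℤ) + y) ∧ l N < y ∧ y < u N)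
    (hl : l N % 2 = (N : ℤ) % 2) (hu : u N % 2 = (N : ℤ) % 2) (hlu : l N ≤ u N) :
    2 * (#{t ∈ T | ∃ y, (N, y) ∈ t} : ℤ) = u N - l N := by
  have hk : ∀ k ∈ range ((u N - l N) / 2).toNat, ∃ t ∈ T, (N, l N + 1 + 2 * (k : ℤ)) ∈ t := by
    intro k hk
    rw [mem_range] at hk
    rw [hcover, Int.odd_iff]
    omega
  choose! g hg1 hg2 using hk
  have hfun : ∀ t ∈ T, ∀ y y', (N, y) ∈ t → (N, y') ∈ t → y = y' := by
    intro t ht y y' h1 h2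
    obtain ⟨a, b, f, h3⟩ := hrib t ht
    exact ((h3.mem _).1 h1).2.2.trans ((h3.mem _).1 h2).2.2.symm
  have : #{t ∈ T | ∃ y, (N, y) ∈ t} = ((u N - l N) / 2).toNat := by
    rw [← card_range ((u N - l N) / 2).toNat]
    symm
    refine card_bij (fun k _ => g k) ?_ ?_ ?_
    · intro k hk
      exact mem_filter.2 ⟨hg1 k hk, _, hg2 k hk⟩
    · intro k hk k' hk' h
      have h1 := hg2 k hk
      rw [h] at h1
      have := hfun _ (hg1 k' hk') _ _ h1 (hg2 k' hk')
      omega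
    · intro t ht
      obtain ⟨ht, y, hy⟩ := mem_filter.1 ht
      have h1 := (hcover y).1 ⟨t, ht, hy⟩
      rw [Int.odd_iff] at h1
      have h2 : ((y - l N - 1) / 2).toNat ∈ range ((u N - l N) / 2).toNat := by
        rw [mem_range]; omega
      refine ⟨_, h2, hdisj _ (hg1 _ h2) _ ht _ (hg2 _ h2) ?_⟩
      convert hy using 2
      omega
  rw [this]
  omega

/-- Every tile is parallel to the lower path. -/
theorem Valid.lower_step (h : Valid N l u T) (hl : ∀ x ≤ N, l x % 2 = (x : ℤ) % 2) {x : ℕ}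
    {e : ℤ} (k : ℕ) : ∀ t ∈ T, ∀ y, y - l x ≤ k → (x, y) ∈ t → (x + 1, y + e) ∈ t →
      l (x + 1) = l x + e := by
  induction k using Nat.strong_induction_on with
  | _ k ih =>
    intro t ht y hk h1 h2
    have h3 := (h.cover _).1 ⟨t, ht, h1⟩
    have h4 := (h.cover _).1 ⟨t, ht, h2⟩
    simp only [Int.odd_iff] at h3 h4
    have h5 := hl x h3.1
    have h6 := hl (x + 1) h4.1
    push_cast at h4 h6
    -- If the translate lies below `l`, then by parity the two boxes are the lowest in their
    -- columns, which gives the claim. Otherwise the same step occurs in a tile two units lower.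
    rcases h.incl t ht with h7 | ⟨t', ht', h7⟩
    · have h8 := h7 _ h1
      have h9 := h7 _ h2
      simp only at h8 h9
      omega
    · have h9 := h7 _ h1
      have h8 := h7 _ h2
      have h10 := (h.cover _).1 ⟨t', ht', h9⟩
      simp only at h8 h9 h10
      refine ih (k - 2) (by omega) t' ht' (y - 2) (by omega) h9 ?_
      rwa [show y - 2 + e = y + e - 2 by ring]

end Counting

/-! ### Truncating tilings below a straight upper path -/

section Truncate

variable {M : ℕ} {l u : ℕ → ℤ} {T : Finset (Finset (ℕ × ℤ))}

/-- As for a peak: the tile of the top anchor box, if larger than that box, must arrive by an up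
step, since no higher box exists in column `M + 1`. Cover-inclusiveness hands this step down the
column. -/
theorem Valid.mem_before_last (hu : ∀ x ≤ M + 2, u x = x) (h : Valid (M + 2) l u T)
    (hT : {(M + 2, (M + 1 : ℤ))} ∉ T) (k : ℕ) :
    ∀ t ∈ T, (M + 2, (M + 1 : ℤ) - 2 * k) ∈ t → (M + 1, (M : ℤ) - 2 * k) ∈ t := by
  induction k with
  | zero =>
    intro t ht hz
    simp only [Nat.cast_zero, mul_zero, sub_zero] at hz ⊢
    obtain ⟨a, b, f, h1, -⟩ := h.tile t ht
    have hz1 := (h1.mem _).1 hz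
    have hb := (h.cover _).1 ⟨t, ht, h1.mem_mk h1.le le_rfl⟩
    simp only at hz1 hb
    obtain rfl : b = M + 2 := by omega
    have ha : a ≤ M + 1 := by
      by_contra hac
      obtain rfl : a = M + 2 := by omega
      apply hT
      convert ht
      ext z
      rw [h1.mem, mem_singleton, Prod.ext_iff]
      constructor
      · rintro ⟨h3, h4⟩
        rw [h3, h4]
        omega
      · rintro ⟨h3, h4, h5⟩
        rw [show z.1 = M + 2 by omega] at h5 ⊢
        omega
    have h3 := h1.step (M + 1) ha (by omega)
    have h4 := (h.cover _).1 ⟨t, ht, h1.mem_mk ha (by omega)⟩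
    have h5 := hu (M + 1) (by omega)
    rw [h1.mem]
    simp only at h4 ⊢
    rw [show M + 1 + 1 = M + 2 by rfl] at h3
    omega
  | succ k ih =>
    intro t ht hz
    have hz1 := (h.cover _).1 ⟨t, ht, hz⟩
    push_cast at hz1 hz ⊢
    simp only [Int.odd_iff] at hz1
    have hu2 := hu (M + 2) le_rfl
    obtain ⟨t1, ht1, h1⟩ := (h.cover (M + 2, (M + 1 : ℤ) - 2 * k)).2
      ⟨le_rfl, by simp only [Int.odd_iff]; omega, by simp only; omega, by simp only; omega⟩
    have h2 := ih t1 ht1 h1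
    rcases h.incl t1 ht1 with h4 | ⟨t', ht', h4⟩
    · have := h4 _ h1
      simp only at this
      omega
    · have h5 := h4 _ h1
      have h6 := h4 _ h2
      simp only at h5 h6
      rw [show (M + 1 : ℤ) - 2 * (k : ℤ) - 2 = M + 1 - 2 * (k + 1) by ring] at h5
      rw [show (M : ℤ) - 2 * (k : ℤ) - 2 = M - 2 * (k + 1) by ring] at h6
      obtain rfl := h.disjoint t ht t' ht' _ hz h5
      exact h6

theorem Valid.mem_before_last' (hu : ∀ x ≤ M + 2, u x = x) (h : Valid (M + 2) l u T)
    (hT : {(M + 2, (M + 1 : ℤ))} ∉ T) {t : Finset (ℕ × ℤ)} (ht : t ∈ T) {y : ℤ}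
    (hy : (M + 2, y) ∈ t) : (M + 1, y - 1) ∈ t := by
  have h1 := (h.cover _).1 ⟨t, ht, hy⟩
  have hu2 := hu (M + 2) le_rfl
  simp only [Int.odd_iff] at h1
  push_cast at h1 hu2
  obtain ⟨k, hk⟩ : ∃ k : ℕ, y = (M + 1 : ℤ) - 2 * k := ⟨((M + 1 - y) / 2).toNat, by omega⟩
  have := h.mem_before_last hu hT k t ht (hk ▸ hy)
  rwa [show y - 1 = (M : ℤ) - 2 * k by omega]

/-- If column `M + 2` has a box, the tile of its lowest box comes from a box at height `l (M + 2)`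
in column `M + 1`, which must lie above `l (M + 1)`. If it has none, `l` meets the straight path at
its end. -/
theorem Valid.lower_last (hu : ∀ x ≤ M + 2, u x = x) (h : Valid (M + 2) l u T)
    (hT : {(M + 2, (M + 1 : ℤ))} ∉ T) (hl : l (M + 2) % 2 = ((M + 2 : ℕ) : ℤ) % 2)
    (hlu : ∀ x ≤ M + 2, l x ≤ u x)
    (hls : l (M + 2) = l (M + 1) + 1 ∨ l (M + 2) = l (M + 1) - 1) :
    l (M + 2) = l (M + 1) + 1 := by
  have hu1 := hu (M + 1) (by omega)
  have hu2 := hu (M + 2) le_rfl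
  have h1 := hlu (M + 1) (by omega)
  have h2 := hlu (M + 2) le_rfl
  push_cast at hu1 hu2 hl
  by_cases heq : l (M + 2) = u (M + 2)
  · omega
  · obtain ⟨t, ht, h4⟩ := (h.cover (M + 2, l (M + 2) + 1)).2
      ⟨le_rfl, by simp only [Int.odd_iff]; omega, by simp only; omega, by simp only; omega⟩
    have h5 := h.mem_before_last' hu hT ht h4
    have h6 := (h.cover _).1 ⟨t, ht, h5⟩
    simp only at h6
    omega

theorem Valid.mem_last (hu : ∀ x ≤ M + 2, u x = x) (h : Valid (M + 2) l u T)
    (hT : {(M + 2, (M + 1 : ℤ))} ∉ T) (hlast : l (M + 2) = l (M + 1) + 1)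
    {t : Finset (ℕ × ℤ)} (ht : t ∈ T) {y : ℤ} (hy : (M + 1, y) ∈ t) : (M + 2, y + 1) ∈ t := by
  have h1 := (h.cover _).1 ⟨t, ht, hy⟩
  have hu1 := hu (M + 1) (by omega)
  have hu2 := hu (M + 2) le_rfl
  push_cast at hu1 hu2
  simp only [Int.odd_iff] at h1
  obtain ⟨t1, ht1, h2⟩ := (h.cover (M + 2, y + 1)).2
    ⟨le_rfl, by simp only [Int.odd_iff]; omega, by simp only; omega, by simp only; omega⟩
  have h3 := h.mem_before_last' hu hT ht1 h2
  rw [add_sub_cancel_right] at h3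
  rwa [h.disjoint t ht t1 ht1 _ hy h3]

/-- By `mem_last` no tile stops in column `M + 1`. A tile that reaches column `M + 2` does so by an
up step, so its rise is positive and hence odd. -/
theorem Valid.tile_cases (hu : ∀ x ≤ M + 2, u x = x) (h : Valid (M + 2) l u T)
    (hT : {(M + 2, (M + 1 : ℤ))} ∉ T) (hlast : l (M + 2) = l (M + 1) + 1)
    {t : Finset (ℕ × ℤ)} (ht : t ∈ T) : ∃ a b f, IsRibbon t a b f ∧
      (b ≤ M ∧ f b = f a ∨
        b = M + 2 ∧ a ≤ M + 1 ∧ f (M + 2) = f (M + 1) + 1 ∧ Odd (f b - f a)) := by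
  obtain ⟨a, b, f, h1, h2⟩ := h.tile t ht
  refine ⟨a, b, f, h1, ?_⟩
  have hb := (h.cover _).1 ⟨t, ht, h1.mem_mk h1.le le_rfl⟩
  simp only at hb
  rcases (show b ≤ M ∨ b = M + 1 ∨ b = M + 2 by omega) with h3 | rfl | rfl
  · left
    refine ⟨h3, h2.resolve_right fun h4 => by omega⟩
  · have h4 := (h1.mem _).1 (h.mem_last hu hT hlast ht (h1.mem_mk h1.le le_rfl))
    simp only at h4
    omega
  · right
    have h4 := (h1.mem _).1 (h.mem_before_last' hu hT ht (h1.mem_mk h1.le le_rfl))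
    simp only at h4
    have h5 := h1.base _ h4.1 h4.2.1
    refine ⟨rfl, h4.1, by omega, ?_⟩
    rcases h2 with h2 | h2
    · omega
    · exact h2.2

/-! ### Cutting off the last two columns -/

/-- The part of a tile in the columns up to `M`. -/
def truncTile (M : ℕ) (t : Finset (ℕ × ℤ)) : Finset (ℕ × ℤ) := t.filter fun z => z.1 ≤ M

/-- The parts of the tiles in the columns up to `M`. -/
def truncTiling (M : ℕ) (T : Finset (Finset (ℕ × ℤ))) : Finset (Finset (ℕ × ℤ)) :=
  (T.image (truncTile M)).erase ∅

theorem mem_truncTile {t : Finset (ℕ × ℤ)} {z : ℕ × ℤ} :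
    z ∈ truncTile M t ↔ z ∈ t ∧ z.1 ≤ M := mem_filter

theorem mem_truncTiling {s : Finset (ℕ × ℤ)} :
    s ∈ truncTiling M T ↔ s.Nonempty ∧ ∃ t ∈ T, truncTile M t = s := by
  rw [truncTiling, mem_erase, mem_image, nonempty_iff_ne_empty]

theorem IsRibbon.trunc {t : Finset (ℕ × ℤ)} {a b : ℕ} {f : ℕ → ℤ} (h : IsRibbon t a b f)
    (ha : a ≤ M) (hb : M ≤ b) : IsRibbon (truncTile M t) a M f where
  le := ha
  step x h1 h2 := h.step x h1 (by omega)
  base x h1 h2 := h.base x h1 (by omega)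
  mem z := by rw [mem_truncTile, h.mem]; omega

theorem truncTile_of_le {t : Finset (ℕ × ℤ)} {a b : ℕ} {f : ℕ → ℤ} (h : IsRibbon t a b f)
    (hb : b ≤ M) : truncTile M t = t := by
  refine filter_true_of_mem fun z hz => ?_
  have := (h.mem z).1 hz
  omega

theorem Valid.truncTile_injOn {N : ℕ} (h : Valid N l u T) {t t' : Finset (ℕ × ℤ)} (ht : t ∈ T)
    (ht' : t' ∈ T) (hne : (truncTile M t).Nonempty) (heq : truncTile M t = truncTile M t') :
    t = t' := by
  obtain ⟨z, hz⟩ := hne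
  have hz' := hz
  rw [heq] at hz'
  exact h.disjoint t ht t' ht' z (mem_truncTile.1 hz).1 (mem_truncTile.1 hz').1

/-- Tiles are parallel to the lower path, so all tiles that are cut lose the same rise `1 + (l (M +
1) - l M)`, which is `0` or `2`. Odd rises stay odd and the parity classes with starting column at
most `M` are preserved; tiles that start in column `M + 1` disappear. -/
theorem Valid.trunc (hu : ∀ x ≤ M + 2, u x = x) (hl : ∀ x ≤ M + 2, l x % 2 = (x : ℤ) % 2)
    (h : Valid (M + 2) l u T) (hT : {(M + 2, (M + 1 : ℤ))} ∉ T)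
    (hlast : l (M + 2) = l (M + 1) + 1)
    (hstep : l (M + 1) = l M + 1 ∨ l (M + 1) = l M - 1) :
    Valid M l u (truncTiling M T) where
  tile s hs := by
    obtain ⟨hne, t, ht, rfl⟩ := mem_truncTiling.1 hs
    obtain ⟨a, b, f, h1, h2⟩ := h.tile_cases hu hT hlast ht
    rcases h2 with h2 | ⟨rfl, ha, h3, h4⟩
    · rw [truncTile_of_le h1 h2.1]
      exact ⟨a, b, f, h1, Or.inl h2.2⟩
    · have ha : a ≤ M := by
        obtain ⟨z, hz⟩ := hne
        rw [mem_truncTile, h1.mem] at hz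
        omega
      refine ⟨a, M, f, h1.trunc ha (by omega), Or.inr ⟨rfl, ?_⟩⟩
      have h5 := h1.step M ha (by omega)
      rw [Int.odd_iff] at h4 ⊢
      omega
  disjoint s hs s' hs' z hz hz' := by
    obtain ⟨-, t, ht, rfl⟩ := mem_truncTiling.1 hs
    obtain ⟨-, t', ht', rfl⟩ := mem_truncTiling.1 hs'
    rw [h.disjoint t ht t' ht' z (mem_truncTile.1 hz).1 (mem_truncTile.1 hz').1]
  cover z := by
    constructor
    · rintro ⟨s, hs, hz⟩
      obtain ⟨-, t, ht, rfl⟩ := mem_truncTiling.1 hs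
      rw [mem_truncTile] at hz
      exact ⟨hz.2, ((h.cover z).1 ⟨t, ht, hz.1⟩).2⟩
    · rintro ⟨h1, h2⟩
      obtain ⟨t, ht, hz⟩ := (h.cover z).2 ⟨by omega, h2⟩
      have hz' : z ∈ truncTile M t := mem_truncTile.2 ⟨hz, h1⟩
      exact ⟨_, mem_truncTiling.2 ⟨⟨z, hz'⟩, t, ht, rfl⟩, hz'⟩
  incl s hs := by
    obtain ⟨hne, t, ht, rfl⟩ := mem_truncTiling.1 hs
    rcases h.incl t ht with h1 | ⟨t', ht', h1⟩
    · exact Or.inl fun z hz => h1 z (mem_truncTile.1 hz).1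
    · right
      have h2 : ∀ z ∈ truncTile M t, (z.1, z.2 - 2) ∈ truncTile M t' := fun z hz => by
        rw [mem_truncTile] at hz ⊢
        exact ⟨h1 z hz.1, hz.2⟩
      obtain ⟨z, hz⟩ := hne
      exact ⟨_, mem_truncTiling.2 ⟨⟨_, h2 z hz⟩, t', ht', rfl⟩, h2⟩
  even a r hr := by
    classical
    by_cases ha : a ≤ M
    · have heq : {s ∈ truncTiling M T | HasRise M s a r} =
          {t ∈ T | HasRise (M + 2) t a (r + 1 + (l (M + 1) - l M))}.image (truncTile M) := by
        ext s
        simp only [mem_filter, mem_image, mem_truncTiling]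
        constructor
        · rintro ⟨⟨hne, t, ht, rfl⟩, h1⟩
          refine ⟨t, ⟨ht, ?_⟩, rfl⟩
          obtain ⟨a', b, f, h2, h3⟩ := h.tile_cases hu hT hlast ht
          rcases h3 with h3 | ⟨rfl, h3, h4, h5⟩
          · rw [truncTile_of_le h2 h3.1, h2.hasRise_iff] at h1
            obtain ⟨-, -, h1⟩ := h1
            rw [h3.2, sub_self] at h1
            rw [← h1] at hr
            simp at hr
          · have h6 : a' ≤ M := by
              obtain ⟨z, hz⟩ := hne
              rw [mem_truncTile, h2.mem] at hz
              omega
            rw [(h2.trunc h6 (by omega)).hasRise_iff] at h1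
            rw [h2.hasRise_iff]
            have h7 := h.lower_step hl (x := M) (e := f (M + 1) - f M) (f M - l M).toNat t ht
              (f M) (by omega) (h2.mem_mk h6 (by omega)) (by
                rw [add_sub_cancel]
                exact h2.mem_mk (by omega) (by omega))
            refine ⟨h1.1, rfl, by omega⟩
        · rintro ⟨t, ⟨ht, f, h1, h2⟩, rfl⟩
          have h3 := h1.trunc ha (by omega)
          refine ⟨⟨⟨_, h3.mem_mk le_rfl ha⟩, t, ht, rfl⟩, h3.hasRise_iff.2 ⟨rfl, rfl, ?_⟩⟩
          have h7 := h.lower_step hl (x := M) (e := f (M + 1) - f M) (f M - l M).toNat t ht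
            (f M) (by omega) (h1.mem_mk ha (by omega)) (by
              rw [add_sub_cancel]
              exact h1.mem_mk (by omega) (by omega))
          have h8 := (h1.mem _).1 (h.mem_before_last' hu hT ht (h1.mem_mk (by omega) le_rfl))
          simp only at h8
          omega
      rw [heq, card_image_of_injOn]
      · convert h.even a (r + 1 + (l (M + 1) - l M)) ?_ using 1
        rw [Int.odd_iff] at hr ⊢
        omega
      · intro t ht t' ht' h1
        rw [mem_coe, mem_filter] at ht ht'
        obtain ⟨ht, f, h2, -⟩ := ht
        exact h.truncTile_injOn ht ht'.1
          ⟨_, (h2.trunc ha (by omega)).mem_mk le_rfl ha⟩ h1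
    · rw [filter_false_of_mem]
      · simp
      · rintro s hs ⟨f, h1, -⟩
        have := h1.le
        omega

end Truncate

/-! ### Extending tilings below a straight upper path -/

/-- The ribbon of two boxes that starts at the box `(M + 1, y)` and goes up. -/
def hook (M : ℕ) (y : ℤ) : Finset (ℕ × ℤ) := {(M + 1, y), (M + 2, y + 1)}

open Classical in
/-- A tile that ends in the column `M` above its initial height is extended by two boxes, the
first of them in the direction `e` and the second one upwards. -/
noncomputable def extTile (M : ℕ) (e : ℤ) (t : Finset (ℕ × ℤ)) : Finset (ℕ × ℤ) :=
  if IsLevel t then t else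
    t ∪ (t.filter fun z => z.1 = M).biUnion fun z => hook M (z.2 + e)

open Classical in
/-- The heights of the boxes in the column `M + 1` that are not met by an extended tile. -/
noncomputable def freeHeights (M : ℕ) (e k : ℤ) (T : Finset (Finset (ℕ × ℤ))) : Finset ℤ :=
  (Ioo (k + e) (M + 1)).filter fun y =>
    Odd ((M : ℤ) + 1 + y) ∧ ∀ t ∈ T, ¬ IsLevel t → (M, y - e) ∉ t

open Classical in
/-- The extension of a tiling by two columns. The height of the lower path at `M` is `k`, and its
next step is `e`. -/
noncomputable def extTiling (M : ℕ) (e k : ℤ) (T : Finset (Finset (ℕ × ℤ))) :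
    Finset (Finset (ℕ × ℤ)) :=
  T.image (extTile M e) ∪ (freeHeights M e k T).image (hook M)

theorem mem_hook {M x : ℕ} {y y' : ℤ} :
    (x, y') ∈ hook M y ↔ x = M + 1 ∧ y' = y ∨ x = M + 2 ∧ y' = y + 1 := by
  simp [hook]

theorem isRibbon_hook (M : ℕ) (y : ℤ) :
    IsRibbon (hook M y) (M + 1) (M + 2) fun x => y + (x - (M + 1)) where
  le := by omega
  step x _ _ := by push_cast; omega
  base x _ _ := by push_cast; omega
  mem z := by
    obtain ⟨x, y'⟩ := z
    rw [mem_hook]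
    simp only
    omega

theorem not_isLevel_hook (M : ℕ) (y : ℤ) : ¬ IsLevel (hook M y) := by
  rw [(isRibbon_hook M y).isLevel_iff]
  push_cast
  omega

theorem hook_injective (M : ℕ) : Function.Injective (hook M) := by
  intro y y' h
  have h1 : (M + 1, y) ∈ hook M y := mem_hook.2 (by simp)
  rw [h, mem_hook] at h1
  omega

theorem hasRise_hook {M a : ℕ} {y r : ℤ} :
    HasRise (M + 2) (hook M y) a r ↔ a = M + 1 ∧ r = 1 := by
  rw [(isRibbon_hook M y).hasRise_iff]
  push_cast
  omega

theorem extTile_of_isLevel {M : ℕ} {e : ℤ} {t : Finset (ℕ × ℤ)} (h : IsLevel t) :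
    extTile M e t = t := if_pos h

section Extend

variable {M : ℕ} {e : ℤ} {l u : ℕ → ℤ} {T : Finset (Finset (ℕ × ℤ))} {t : Finset (ℕ × ℤ)}

theorem mem_extTile_of_le {x : ℕ} {y : ℤ} (hx : x ≤ M) :
    (x, y) ∈ extTile M e t ↔ (x, y) ∈ t := by
  unfold extTile
  split_ifs with h
  · rfl
  · rw [mem_union, or_iff_left]
    rw [mem_biUnion]
    rintro ⟨z, -, hz⟩
    rw [mem_hook] at hz
    omega

theorem mem_extTile_succ {y : ℤ} (ht : ∀ z ∈ t, z.1 ≤ M) :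
    (M + 1, y) ∈ extTile M e t ↔ ¬ IsLevel t ∧ (M, y - e) ∈ t := by
  unfold extTile
  have h0 : (M + 1, y) ∉ t := fun h1 => by have := ht _ h1; simp only at this; omega
  split_ifs with h
  · simp [h0, h]
  · rw [mem_union, or_iff_right h0, and_iff_right h, mem_biUnion]
    constructor
    · rintro ⟨⟨x, y'⟩, hz, hz'⟩
      rw [mem_filter] at hz
      rw [mem_hook] at hz'
      obtain ⟨hz, rfl⟩ := hz
      rwa [show y - e = y' by simp only at hz'; omega]
    · intro h1
      exact ⟨_, mem_filter.2 ⟨h1, rfl⟩, mem_hook.2 (Or.inl ⟨rfl, by simp⟩)⟩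

theorem mem_extTile_add_two {y : ℤ} (ht : ∀ z ∈ t, z.1 ≤ M) :
    (M + 2, y) ∈ extTile M e t ↔ (M + 1, y - 1) ∈ extTile M e t := by
  rw [mem_extTile_succ ht]
  unfold extTile
  have h0 : (M + 2, y) ∉ t := fun h1 => by have := ht _ h1; simp only at this; omega
  split_ifs with h
  · simp [h0, h]
  · rw [mem_union, or_iff_right h0, and_iff_right h, mem_biUnion]
    constructor
    · rintro ⟨⟨x, y'⟩, hz, hz'⟩
      rw [mem_filter] at hz
      rw [mem_hook] at hz'
      obtain ⟨hz, rfl⟩ := hz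
      rwa [show y - 1 - e = y' by simp only at hz'; omega]
    · intro h1
      exact ⟨_, mem_filter.2 ⟨h1, rfl⟩, mem_hook.2 (Or.inr ⟨rfl, by simp only; ring⟩)⟩

theorem column_le_of_mem_extTile {z : ℕ × ℤ} (ht : ∀ z ∈ t, z.1 ≤ M) (hz : z ∈ extTile M e t) :
    z.1 ≤ M + 2 := by
  unfold extTile at hz
  split_ifs at hz with h
  · have := ht z hz; omega
  · rcases mem_union.1 hz with hz | hz
    · have := ht z hz; omega
    · obtain ⟨w, -, hw⟩ := mem_biUnion.1 hz
      obtain ⟨x, y⟩ := z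
      rw [mem_hook] at hw
      simp only
      omega

theorem Valid.column_le {N : ℕ} (h : Valid N l u T) (ht : t ∈ T) : ∀ z ∈ t, z.1 ≤ N :=
  fun z hz => ((h.cover z).1 ⟨t, ht, hz⟩).1

/-- Only a tile that ends strictly above its initial height can take the step `e = -1` and stay
weakly above that height. -/
theorem IsRibbon.ext {a : ℕ} {f : ℕ → ℤ} (he : e = 1 ∨ e = -1) (h : IsRibbon t a M f)
    (hlev : ¬ IsLevel t) : IsRibbon (extTile M e t) a (M + 2)
      (fun x => if x ≤ M then f x else f M + e + (x - (M + 1))) := by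
  have hle := h.le
  have hM := h.base M hle le_rfl
  have hne := h.isLevel_iff.not.1 hlev
  have hcol : ∀ z ∈ t, z.1 ≤ M := fun z hz => ((h.mem z).1 hz).2.1
  refine ⟨by omega, ?_, ?_, ?_⟩
  · intro x h1 h2
    rcases lt_trichotomy x M with hx | rfl | hx
    · rw [if_pos hx.le, if_pos (show x + 1 ≤ M by omega)]
      exact h.step x h1 hx
    · rw [if_pos le_rfl, if_neg (by omega)]
      push_cast
      omega
    · rw [if_neg (by omega), if_neg (by omega)]
      push_cast
      omega
  · intro x h1 h2
    simp only [if_pos hle]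
    split_ifs with hx
    · exact h.base x h1 hx
    · omega
  · rintro ⟨x, y⟩
    by_cases hx : x ≤ M
    · rw [mem_extTile_of_le hx, h.mem]
      simp only [if_pos hx]
      omega
    · by_cases hx2 : x ≤ M + 2
      · rcases (show x = M + 1 ∨ x = M + 2 by omega) with rfl | rfl
        · rw [mem_extTile_succ hcol, h.mem, if_neg hx]
          simp only [hlev, not_false_eq_true, true_and, le_refl]
          push_cast
          omega
        · rw [mem_extTile_add_two hcol, mem_extTile_succ hcol, h.mem, if_neg hx]
          simp only [hlev, not_false_eq_true, true_and, le_refl]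
          push_cast
          omega
      · constructor
        · intro hz
          exact absurd (column_le_of_mem_extTile hcol hz) hx2
        · rintro ⟨-, h3, -⟩
          exact absurd h3 hx2

theorem Valid.ribbon_cases {N : ℕ} (h : Valid N l u T) (ht : t ∈ T) :
    (∃ a b f, IsRibbon t a b f ∧ b ≤ N ∧ f b = f a ∧ IsLevel t) ∨
      (∃ a f, IsRibbon t a N f ∧ Odd (f N - f a) ∧ ¬ IsLevel t) := by
  obtain ⟨a, b, f, h1, h2⟩ := h.tile t ht
  by_cases h3 : f b = f a
  · exact Or.inl ⟨a, b, f, h1, h.column_le ht _ (h1.mem_mk h1.le le_rfl), h3, h1.isLevel_iff.2 h3⟩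
  · obtain ⟨rfl, h4⟩ := h2.resolve_left h3
    exact Or.inr ⟨a, f, h1, h4, h1.isLevel_iff.not.2 h3⟩

theorem Valid.truncTile_extTile (h : Valid M l u T) (ht : t ∈ T) :
    truncTile M (extTile M e t) = t := by
  ext ⟨x, y⟩
  rw [mem_truncTile]
  constructor
  · rintro ⟨h1, h2⟩
    exact (mem_extTile_of_le h2).1 h1
  · intro h1
    have h2 := h.column_le ht _ h1
    exact ⟨(mem_extTile_of_le h2).2 h1, h2⟩

theorem truncTile_hook (M : ℕ) (y : ℤ) : truncTile M (hook M y) = ∅ := by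
  refine eq_empty_of_forall_notMem ?_
  rintro ⟨x, y'⟩ hz
  rw [mem_truncTile, mem_hook] at hz
  omega

theorem Valid.extTile_injOn (h : Valid M l u T) : Set.InjOn (extTile M e) T := by
  intro t ht t' ht' heq
  rw [← h.truncTile_extTile (e := e) ht, heq, h.truncTile_extTile ht']

theorem Valid.nonempty {N : ℕ} (h : Valid N l u T) (ht : t ∈ T) : t.Nonempty := by
  obtain ⟨a, b, f, h1, -⟩ := h.tile t ht
  exact ⟨_, h1.mem_mk le_rfl h1.le⟩

theorem Valid.truncTiling_extTiling (h : Valid M l u T) (k : ℤ) :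
    truncTiling M (extTiling M e k T) = T := by
  classical
  ext s
  rw [mem_truncTiling]
  simp only [extTiling, mem_union, mem_image]
  constructor
  · rintro ⟨hne, s', ⟨t, ht, rfl⟩ | ⟨y, hy, rfl⟩, rfl⟩
    · rwa [h.truncTile_extTile ht]
    · rw [truncTile_hook] at hne
      exact absurd hne not_nonempty_empty
  · intro hs
    exact ⟨h.nonempty hs, _, Or.inl ⟨s, hs, rfl⟩, h.truncTile_extTile hs⟩

theorem Valid.isLevel_extTile (he : e = 1 ∨ e = -1) (h : Valid M l u T) (ht : t ∈ T) :
    IsLevel (extTile M e t) ↔ IsLevel t := by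
  rcases h.ribbon_cases ht with ⟨a, b, f, -, -, -, h1⟩ | ⟨a, f, h1, h2, h3⟩
  · rw [extTile_of_isLevel h1]
  · simp only [h3, iff_false]
    rw [(h1.ext he h3).isLevel_iff, if_neg (by omega), if_pos h1.le]
    have := h1.base M h1.le le_rfl
    rw [Int.odd_iff] at h2
    push_cast
    omega

/-- Level tiles are left alone, extended tiles remain non-level because their rise grows by `1 + e ≥
0`, and hooks are not level. -/
theorem Valid.tiles_extTiling (he : e = 1 ∨ e = -1) (h : Valid M l u T) (k : ℤ) :
    tiles (extTiling M e k T) = tiles T := by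
  classical
  rw [tiles_eq, tiles_eq]
  congr 1
  ext s
  simp only [mem_filter, extTiling, mem_union, mem_image]
  constructor
  · rintro ⟨⟨t, ht, rfl⟩ | ⟨y, hy, rfl⟩, h1⟩
    · rw [h.isLevel_extTile he ht] at h1
      rw [extTile_of_isLevel h1]
      exact ⟨ht, h1⟩
    · exact absurd h1 (not_isLevel_hook M y)
  · rintro ⟨h1, h2⟩
    exact ⟨Or.inl ⟨s, h1, extTile_of_isLevel h2⟩, h2⟩

theorem Valid.hasRise_extTile (he : e = 1 ∨ e = -1) (h : Valid M l u T) (ht : t ∈ T) {a : ℕ}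
    {r : ℤ} (hr : Odd r) : HasRise (M + 2) (extTile M e t) a r ↔ HasRise M t a (r - 1 - e) := by
  rcases h.ribbon_cases ht with ⟨a', b, f, h1, h2, h3, h4⟩ | ⟨a', f, h1, h2, h3⟩
  · rw [extTile_of_isLevel h4, h1.hasRise_iff, h1.hasRise_iff, h3, sub_self]
    rw [Int.odd_iff] at hr
    omega
  · rw [(h1.ext he h3).hasRise_iff, h1.hasRise_iff, if_neg (by omega), if_pos h1.le]
    push_cast
    omega

theorem Valid.singleton_notMem_extTiling (h : Valid M l u T) (k y : ℤ) :
    {(M + 2, y)} ∉ extTiling M e k T := by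
  classical
  simp only [extTiling, mem_union, mem_image, not_or]
  constructor
  · rintro ⟨t, ht, h1⟩
    obtain ⟨z, hz⟩ := h.nonempty ht
    have h2 := h.column_le ht z hz
    have h3 : z ∈ extTile M e t := (mem_extTile_of_le h2).2 hz
    rw [h1, mem_singleton] at h3
    subst h3
    simp only at h2
    omega
  · rintro ⟨y', -, h1⟩
    have h2 : (M + 1, y') ∈ hook M y' := mem_hook.2 (by simp)
    rw [h1, mem_singleton] at h2
    simp at h2

theorem mem_freeHeights {k y : ℤ} : y ∈ freeHeights M e k T ↔
    (k + e < y ∧ y < M + 1) ∧ Odd ((M : ℤ) + 1 + y) ∧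
      ∀ t ∈ T, ¬ IsLevel t → (M, y - e) ∉ t := by
  classical
  rw [freeHeights, mem_filter, mem_Ioo]

theorem Valid.exists_mem_extTiling_succ (h : Valid M l u T) (hu : u M = M) (he : e = 1 ∨ e = -1)
    (y : ℤ) : (∃ s ∈ extTiling M e (l M) T, (M + 1, y) ∈ s) ↔
      (l M + e < y ∧ y < M + 1) ∧ Odd ((M : ℤ) + 1 + y) := by
  classical
  constructor
  · rintro ⟨s, hs, hy⟩
    rcases mem_union.1 hs with hs | hs
    · obtain ⟨t, ht, rfl⟩ := mem_image.1 hs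
      rw [mem_extTile_succ (h.column_le ht)] at hy
      have := (h.cover _).1 ⟨t, ht, hy.2⟩
      simp only [Int.odd_iff] at this ⊢
      omega
    · obtain ⟨y', hy', rfl⟩ := mem_image.1 hs
      rw [mem_freeHeights] at hy'
      rw [mem_hook] at hy
      obtain rfl : y = y' := by omega
      exact ⟨hy'.1, hy'.2.1⟩
  · rintro ⟨h1, h2⟩
    by_cases h3 : ∃ t ∈ T, ¬ IsLevel t ∧ (M, y - e) ∈ t
    · obtain ⟨t, ht, h4⟩ := h3
      exact ⟨_, mem_union_left _ (mem_image_of_mem _ ht),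
        (mem_extTile_succ (h.column_le ht)).2 h4⟩
    · push Not at h3
      exact ⟨_, mem_union_right _ (mem_image_of_mem _ (mem_freeHeights.2 ⟨h1, h2, h3⟩)),
        mem_hook.2 (Or.inl ⟨rfl, rfl⟩)⟩

theorem Valid.mem_extTiling_add_two (h : Valid M l u T) {k : ℤ} {s : Finset (ℕ × ℤ)}
    (hs : s ∈ extTiling M e k T) (y : ℤ) : (M + 2, y) ∈ s ↔ (M + 1, y - 1) ∈ s := by
  classical
  rcases mem_union.1 hs with hs | hs
  · obtain ⟨t, ht, rfl⟩ := mem_image.1 hs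
    exact mem_extTile_add_two (h.column_le ht)
  · obtain ⟨y', -, rfl⟩ := mem_image.1 hs
    rw [mem_hook, mem_hook]
    omega

theorem Valid.column_le_extTiling (h : Valid M l u T) {k : ℤ} {s : Finset (ℕ × ℤ)}
    (hs : s ∈ extTiling M e k T) {z : ℕ × ℤ} (hz : z ∈ s) : z.1 ≤ M + 2 := by
  classical
  rcases mem_union.1 hs with hs | hs
  · obtain ⟨t, ht, rfl⟩ := mem_image.1 hs
    exact column_le_of_mem_extTile (h.column_le ht) hz
  · obtain ⟨y', -, rfl⟩ := mem_image.1 hs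
    obtain ⟨x, y⟩ := z
    rw [mem_hook] at hz
    simp only
    omega

theorem exists_mem_extTiling_of_le {k : ℤ} {x : ℕ} {y : ℤ}
    (hx : x ≤ M) : (∃ s ∈ extTiling M e k T, (x, y) ∈ s) ↔ ∃ t ∈ T, (x, y) ∈ t := by
  classical
  constructor
  · rintro ⟨s, hs, hy⟩
    rcases mem_union.1 hs with hs | hs
    · obtain ⟨t, ht, rfl⟩ := mem_image.1 hs
      exact ⟨t, ht, (mem_extTile_of_le hx).1 hy⟩
    · obtain ⟨y', -, rfl⟩ := mem_image.1 hs
      rw [mem_hook] at hy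
      omega
  · rintro ⟨t, ht, hy⟩
    exact ⟨_, mem_union_left _ (mem_image_of_mem _ ht), (mem_extTile_of_le hx).2 hy⟩

theorem Valid.extTiling_disjoint (h : Valid M l u T) {k : ℤ} :
    ∀ s ∈ extTiling M e k T, ∀ s' ∈ extTiling M e k T, ∀ z, z ∈ s → z ∈ s' → s = s' := by
  classical
  -- Column `M + 1` suffices for the new boxes, since a tile contains a box of column `M + 2`
  -- exactly if it contains the box southwest of it.
  have key : ∀ s ∈ extTiling M e k T, ∀ s' ∈ extTiling M e k T, ∀ y, (M + 1, y) ∈ s →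
      (M + 1, y) ∈ s' → s = s' := by
    intro s hs s' hs' y hy hy'
    rcases mem_union.1 hs with hs | hs <;> rcases mem_union.1 hs' with hs' | hs' <;>
    obtain ⟨t, ht, rfl⟩ := mem_image.1 hs <;> obtain ⟨t', ht', rfl⟩ := mem_image.1 hs'
    · rw [mem_extTile_succ (h.column_le ht)] at hy
      rw [mem_extTile_succ (h.column_le ht')] at hy'
      rw [h.disjoint t ht t' ht' _ hy.2 hy'.2]
    · rw [mem_extTile_succ (h.column_le ht)] at hy
      rw [mem_hook] at hy'
      obtain rfl : y = t' := by omega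
      exact absurd hy.2 ((mem_freeHeights.1 ht').2.2 t ht hy.1)
    · rw [mem_extTile_succ (h.column_le ht')] at hy'
      rw [mem_hook] at hy
      obtain rfl : y = t := by omega
      exact absurd hy'.2 ((mem_freeHeights.1 ht).2.2 t' ht' hy'.1)
    · rw [mem_hook] at hy hy'
      rw [show t = t' by omega]
  rintro s hs s' hs' ⟨x, y⟩ hz hz'
  have hx := h.column_le_extTiling hs hz
  simp only at hx
  rcases (show x ≤ M ∨ x = M + 1 ∨ x = M + 2 by omega) with hx | rfl | rfl
  · rcases mem_union.1 hs with hs | hs <;> rcases mem_union.1 hs' with hs' | hs' <;>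
    obtain ⟨t, ht, rfl⟩ := mem_image.1 hs <;> obtain ⟨t', ht', rfl⟩ := mem_image.1 hs'
    · rw [h.disjoint t ht t' ht' _ ((mem_extTile_of_le hx).1 hz) ((mem_extTile_of_le hx).1 hz')]
    · rw [mem_hook] at hz'
      omega
    · rw [mem_hook] at hz
      omega
    · rw [mem_hook] at hz
      omega
  · exact key s hs s' hs' y hz hz'
  · rw [h.mem_extTiling_add_two hs] at hz
    rw [h.mem_extTiling_add_two hs'] at hz'
    exact key s hs s' hs' _ hz hz'

theorem Valid.extTiling_cover (h : Valid M l u T) (hu : ∀ x ≤ M + 2, u x = x)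
    (he : e = 1 ∨ e = -1) (hl1 : l (M + 1) = l M + e) (hl2 : l (M + 2) = l M + e + 1)
    (z : ℕ × ℤ) : (∃ s ∈ extTiling M e (l M) T, z ∈ s) ↔
      z.1 ≤ M + 2 ∧ Odd ((z.1 : ℤ) + z.2) ∧ l z.1 < z.2 ∧ z.2 < u z.1 := by
  obtain ⟨x, y⟩ := z
  by_cases hx : x ≤ M
  · rw [exists_mem_extTiling_of_le hx, h.cover]
    simp only [Int.odd_iff]
    omega
  · by_cases hx2 : x ≤ M + 2
    · rcases (show x = M + 1 ∨ x = M + 2 by omega) with rfl | rfl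
      · rw [h.exists_mem_extTiling_succ (hu M (by omega)) he, hu _ hx2]
        simp only [hl1, Int.odd_iff]
        push_cast
        omega
      · have : (∃ s ∈ extTiling M e (l M) T, (M + 2, y) ∈ s) ↔
            ∃ s ∈ extTiling M e (l M) T, (M + 1, y - 1) ∈ s := by
          refine exists_congr fun s => and_congr_right fun hs => ?_
          exact h.mem_extTiling_add_two hs y
        rw [this, h.exists_mem_extTiling_succ (hu M (by omega)) he, hu _ hx2]
        simp only [hl2, Int.odd_iff]
        push_cast
        omega
    · constructor
      · rintro ⟨s, hs, hz⟩
        exact absurd (h.column_le_extTiling hs hz) hx2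
      · rintro ⟨h1, -⟩
        exact absurd h1 hx2

theorem Valid.extTiling_tile (h : Valid M l u T) (he : e = 1 ∨ e = -1) {k : ℤ} :
    ∀ s ∈ extTiling M e k T, ∃ a b f,
      IsRibbon s a b f ∧ (f b = f a ∨ b = M + 2 ∧ Odd (f b - f a)) := by
  classical
  intro s hs
  rcases mem_union.1 hs with hs | hs
  · obtain ⟨t, ht, rfl⟩ := mem_image.1 hs
    rcases h.ribbon_cases ht with ⟨a', b, f, h1, h2, h3, h4⟩ | ⟨a', f, h1, h2, h3⟩
    · rw [extTile_of_isLevel h4]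
      exact ⟨_, _, _, h1, Or.inl h3⟩
    · refine ⟨_, _, _, h1.ext he h3, Or.inr ⟨rfl, ?_⟩⟩
      rw [if_neg (by omega), if_pos h1.le]
      rw [Int.odd_iff] at h2 ⊢
      push_cast
      omega
  · obtain ⟨y', -, rfl⟩ := mem_image.1 hs
    refine ⟨_, _, _, isRibbon_hook M y', Or.inr ⟨rfl, ?_⟩⟩
    rw [Int.odd_iff]
    push_cast
    omega

/-- Each box in the last column belongs to a hook or to an extended tile. The number of boxes there
is even by `hmod`, and so is the number of non-level tiles of `T`. -/
theorem Valid.extTiling_even_hooks (h : Valid M l u T) (hu : ∀ x ≤ M + 2, u x = x)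
    (he : e = 1 ∨ e = -1) (hl1 : l (M + 1) = l M + e) (hl2 : l (M + 2) = l M + e + 1)
    (hle : l (M + 2) ≤ M + 2)
    (hmod : (M + 2 - l (M + 2)) % 4 = 0) : Even (#(freeHeights M e (l M) T)) := by
  classical
  have hu2 := hu (M + 2) le_rfl
  push_cast at hu2
  have h1 := two_mul_card_column (N := M + 2) (l := l) (u := u)
    (T := extTiling M e (l M) T)
    (fun s hs => by
      obtain ⟨a, b, f, h1, -⟩ := h.extTiling_tile he s hs
      exact ⟨a, b, f, h1⟩)
    h.extTiling_disjoint
    (fun y => by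
      rw [h.extTiling_cover hu he hl1 hl2]
      simp only [le_refl, true_and])
    (by push_cast; omega) (by push_cast; omega) (by omega)
  have h2 : {s ∈ extTiling M e (l M) T | ∃ y, (M + 2, y) ∈ s} =
      {t ∈ T | ¬ IsLevel t}.image (extTile M e) ∪
        (freeHeights M e (l M) T).image (hook M) := by
    ext s
    simp only [mem_filter, extTiling, mem_union, mem_image]
    constructor
    · rintro ⟨⟨t, ht, rfl⟩ | hs, y, hy⟩
      · rw [mem_extTile_add_two (h.column_le ht), mem_extTile_succ (h.column_le ht)] at hy
        exact Or.inl ⟨t, ⟨ht, hy.1⟩, rfl⟩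
      · exact Or.inr hs
    · rintro (⟨t, ⟨ht, h1⟩, rfl⟩ | ⟨y, hy, rfl⟩)
      · refine ⟨Or.inl ⟨t, ht, rfl⟩, ?_⟩
        rcases h.ribbon_cases ht with ⟨-, -, -, -, -, -, h4⟩ | ⟨a', f, h4, -, -⟩
        · exact absurd h4 h1
        · have h5 := h4.ext he h1
          exact ⟨_, h5.mem_mk h5.le le_rfl⟩
      · exact ⟨Or.inr ⟨y, hy, rfl⟩, y + 1, mem_hook.2 (Or.inr ⟨rfl, rfl⟩)⟩
  rw [h2, card_union_of_disjoint, card_image_of_injOn, card_image_of_injective _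
    (hook_injective M)] at h1
  · have h3 := h.even_card_not_isLevel
    rw [Nat.even_iff] at h3 ⊢
    push_cast at h1
    omega
  · exact h.extTile_injOn.mono (by exact_mod_cast filter_subset _ _)
  · rw [disjoint_left]
    rintro s hs hs'
    obtain ⟨t, ht, rfl⟩ := mem_image.1 hs
    obtain ⟨y, -, h4⟩ := mem_image.1 hs'
    rw [mem_filter] at ht
    have h5 := h.truncTile_extTile (e := e) ht.1
    rw [← h4, truncTile_hook] at h5
    exact (h.nonempty ht.1).ne_empty h5.symm

/-- The classes of extended tiles inherit even cardinality from `T`. The hooks form one new class,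
starting in column `M + 1` with rise `1`, and `hmod` is what makes it even. -/
theorem Valid.ext (h : Valid M l u T) (hu : ∀ x ≤ M + 2, u x = x)
    (he : e = 1 ∨ e = -1) (hl1 : l (M + 1) = l M + e) (hl2 : l (M + 2) = l M + e + 1)
    (hlM : l M % 2 = (M : ℤ) % 2) (hle : l (M + 2) ≤ M + 2)
    (hmod : (M + 2 - l (M + 2)) % 4 = 0) : Valid (M + 2) l u (extTiling M e (l M) T) where
  tile := h.extTiling_tile he
  disjoint := h.extTiling_disjoint
  cover := h.extTiling_cover hu he hl1 hl2
  incl s hs := by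
    classical
    have hu1 := hu (M + 1) (by omega)
    push_cast at hu1
    rcases mem_union.1 hs with hs' | hs'
    · obtain ⟨t, ht, rfl⟩ := mem_image.1 hs'
      rcases h.incl t ht with h1 | ⟨t', ht', h1⟩
      · left
        rintro ⟨x, y⟩ hz
        have hx := column_le_of_mem_extTile (h.column_le ht) hz
        simp only at hx ⊢
        rcases (show x ≤ M ∨ x = M + 1 ∨ x = M + 2 by omega) with hx | rfl | rfl
        · exact h1 _ ((mem_extTile_of_le hx).1 hz)
        · rw [mem_extTile_succ (h.column_le ht)] at hz
          have := h1 _ hz.2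
          simp only at this
          omega
        · rw [mem_extTile_add_two (h.column_le ht), mem_extTile_succ (h.column_le ht)] at hz
          have := h1 _ hz.2
          simp only at this
          omega
      · right
        refine ⟨_, mem_union_left _ (mem_image_of_mem _ ht'), ?_⟩
        -- The tile containing the translate must be extended as well. It also ends in column `M`,
        -- and its height there exceeds its height in the first column of `t`, hence its initial
        -- height.
        have hlev : ¬ IsLevel t → ¬ IsLevel t' := by
          intro h2
          rcases h.ribbon_cases ht with ⟨-, -, -, -, -, -, h4⟩ | ⟨a, f, h4, h5, -⟩
          · exact absurd h4 h2
          · obtain ⟨a', b', f', h6, -⟩ := h.tile t' ht'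
            have h7 := (h6.mem _).1 (h1 _ (h4.mem_mk le_rfl h4.le))
            have h8 := (h6.mem _).1 (h1 _ (h4.mem_mk h4.le le_rfl))
            have h9 := h.column_le ht' _ (h6.mem_mk h6.le le_rfl)
            simp only at h7 h8 h9
            obtain rfl : b' = M := by omega
            rw [h6.isLevel_iff]
            have h10 := h6.base a h7.1 h7.2.1
            have h11 := h4.base b' h4.le le_rfl
            have h12 := h4.isLevel_iff.not.1 h2
            omega
        rintro ⟨x, y⟩ hz
        have hx := column_le_of_mem_extTile (h.column_le ht) hz
        simp only at hx ⊢
        rcases (show x ≤ M ∨ x = M + 1 ∨ x = M + 2 by omega) with hx | rfl | rfl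
        · rw [mem_extTile_of_le hx] at hz ⊢
          exact h1 _ hz
        · rw [mem_extTile_succ (h.column_le ht)] at hz
          rw [mem_extTile_succ (h.column_le ht')]
          refine ⟨hlev hz.1, ?_⟩
          rw [show y - 2 - e = y - e - 2 by ring]
          exact h1 _ hz.2
        · rw [mem_extTile_add_two (h.column_le ht), mem_extTile_succ (h.column_le ht)] at hz
          rw [mem_extTile_add_two (h.column_le ht'), mem_extTile_succ (h.column_le ht')]
          refine ⟨hlev hz.1, ?_⟩
          rw [show y - 2 - 1 - e = y - 1 - e - 2 by ring]
          exact h1 _ hz.2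
    · obtain ⟨y, hy, rfl⟩ := mem_image.1 hs'
      rw [mem_freeHeights] at hy
      -- Either the box below the start of the hook is in the shape, and its tile, a hook or an
      -- extended tile, contains the translate; or the hook is just above the lower path.
      by_cases hlow : l M + e < y - 2
      · right
        obtain ⟨s', h1, h2⟩ := (h.exists_mem_extTiling_succ (hu M (by omega)) he (y - 2)).2
          ⟨⟨hlow, by omega⟩, by have := hy.2.1; rw [Int.odd_iff] at this ⊢; omega⟩
        refine ⟨s', h1, ?_⟩
        rintro ⟨x, y'⟩ hz
        rw [mem_hook] at hz
        rcases hz with ⟨rfl, rfl⟩ | ⟨rfl, rfl⟩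
        · exact h2
        · rw [h.mem_extTiling_add_two h1]
          convert h2 using 2
          simp only
          ring
      · left
        have h3 := hy.2.1
        rw [Int.odd_iff] at h3
        rintro ⟨x, y'⟩ hz
        rw [mem_hook] at hz
        rcases hz with ⟨rfl, rfl⟩ | ⟨rfl, rfl⟩
        · simp only
          omega
        · simp only
          omega
  even a r hr := by
    classical
    have h1 : {s ∈ extTiling M e (l M) T | HasRise (M + 2) s a r} =
        {t ∈ T | HasRise M t a (r - 1 - e)}.image (extTile M e) ∪
          (if a = M + 1 ∧ r = 1 then (freeHeights M e (l M) T).image (hook M) else ∅) := by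
      ext s
      simp only [mem_filter, extTiling, mem_union, mem_image]
      constructor
      · rintro ⟨⟨t, ht, rfl⟩ | ⟨y, hy, rfl⟩, h2⟩
        · rw [h.hasRise_extTile he ht hr] at h2
          exact Or.inl ⟨t, ⟨ht, h2⟩, rfl⟩
        · rw [hasRise_hook] at h2
          rw [if_pos h2]
          exact Or.inr (mem_image_of_mem _ hy)
      · rintro (⟨t, ⟨ht, h2⟩, rfl⟩ | h2)
        · exact ⟨Or.inl ⟨t, ht, rfl⟩, (h.hasRise_extTile he ht hr).2 h2⟩
        · split_ifs at h2 with h3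
          · obtain ⟨y, hy, rfl⟩ := mem_image.1 h2
            exact ⟨Or.inr ⟨y, hy, rfl⟩, hasRise_hook.2 h3⟩
          · simp at h2
    rw [h1, card_union_of_disjoint, card_image_of_injOn]
    · refine Even.add (h.even _ _ ?_) ?_
      · rw [Int.odd_iff] at hr ⊢
        omega
      · split_ifs
        · rw [card_image_of_injective _ (hook_injective M)]
          exact h.extTiling_even_hooks hu he hl1 hl2 hle hmod
        · simp
    · exact h.extTile_injOn.mono (by exact_mod_cast filter_subset _ _)
    · rw [disjoint_left]
      rintro s hs hs'
      obtain ⟨t, ht, rfl⟩ := mem_image.1 hs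
      rw [mem_filter] at ht
      split_ifs at hs'
      · obtain ⟨y, -, h4⟩ := mem_image.1 hs'
        have h5 := h.truncTile_extTile (e := e) ht.1
        rw [← h4, truncTile_hook] at h5
        exact (h.nonempty ht.1).ne_empty h5.symm
      · simp at hs'

end Extend

/-- Each tile of `T` reappears: level tiles are untouched, a tile starting by column `M` extends its
truncation, and a tile starting in column `M + 1` is a hook at a free height. As both families tile
the same shape, containment is equality. -/
theorem Valid.extTiling_truncTiling {M : ℕ} {e : ℤ} {l u : ℕ → ℤ}
    {T : Finset (Finset (ℕ × ℤ))} (hu : ∀ x ≤ M + 2, u x = x)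
    (hl : ∀ x ≤ M + 2, l x % 2 = (x : ℤ) % 2)
    (h : Valid (M + 2) l u T) (hT : {(M + 2, (M + 1 : ℤ))} ∉ T)
    (hle : l (M + 2) ≤ M + 2) (he : e = 1 ∨ e = -1) (hl1 : l (M + 1) = l M + e)
    (hl2 : l (M + 2) = l M + e + 1) (hmod : (M + 2 - l (M + 2)) % 4 = 0) :
    extTiling M e (l M) (truncTiling M T) = T := by
  classical
  have hlast : l (M + 2) = l (M + 1) + 1 := by rw [hl1, hl2]
  have hT' : Valid M l u (truncTiling M T) := h.trunc hu hl hT hlast (by omega)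
  have hE : Valid (M + 2) l u (extTiling M e (l M) (truncTiling M T)) :=
    hT'.ext hu he hl1 hl2 (hl M (by omega)) hle hmod
  have hlink : ∀ t ∈ T, ∀ a f, IsRibbon t a (M + 2) f → a ≤ M → f (M + 1) = f M + e := by
    intro t ht a f h1 ha
    have := h.lower_step hl (x := M) (e := f (M + 1) - f M) (f M - l M).toNat t ht
      (f M) (by omega) (h1.mem_mk ha (by omega)) (by
        rw [add_sub_cancel]
        exact h1.mem_mk (by omega) (by omega))
    omega
  have hsub : ∀ t ∈ T, t ∈ extTiling M e (l M) (truncTiling M T) := by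
    intro t ht
    obtain ⟨a, b, f, h1, h2⟩ := h.tile_cases hu hT hlast ht
    rcases h2 with h2 | ⟨rfl, h3, h4, h5⟩
    · refine mem_union_left _ (mem_image.2 ⟨t, ?_, extTile_of_isLevel ⟨a, b, f, h1, h2.2⟩⟩)
      exact mem_truncTiling.2 ⟨h.nonempty ht, t, ht, truncTile_of_le h1 h2.1⟩
    · rcases (show a ≤ M ∨ a = M + 1 by omega) with ha | rfl
      · have h6 := h1.trunc ha (show M ≤ M + 2 by omega)
        have h7 := hlink t ht a f h1 ha
        have h8 : ¬ IsLevel (truncTile M t) := by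
          rw [h6.isLevel_iff]
          rw [Int.odd_iff] at h5
          omega
        refine mem_union_left _ (mem_image.2 ⟨truncTile M t, ?_, ?_⟩)
        · exact mem_truncTiling.2 ⟨⟨_, h6.mem_mk le_rfl ha⟩, t, ht, rfl⟩
        · ext z
          rw [(h6.ext he h8).mem, h1.mem]
          refine and_congr_right fun _ => and_congr_right fun h9 => ?_
          split_ifs with h10
          · rfl
          · rcases (show z.1 = M + 1 ∨ z.1 = M + 2 by omega) with h11 | h11
            · rw [h11, h7]
              push_cast
              omega
            · rw [h11, h4, h7]
              push_cast
              omega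
      · have h6 : t = hook M (f (M + 1)) := by
          ext ⟨x, y⟩
          rw [h1.mem, mem_hook]
          simp only
          constructor
          · rintro ⟨h7, h8, h9⟩
            rcases (show x = M + 1 ∨ x = M + 2 by omega) with rfl | rfl
            · exact Or.inl ⟨rfl, h9⟩
            · exact Or.inr ⟨rfl, by omega⟩
          · rintro (⟨rfl, h9⟩ | ⟨rfl, h9⟩)
            · exact ⟨by omega, by omega, h9⟩
            · exact ⟨by omega, by omega, by omega⟩
        refine mem_union_right _ (mem_image.2 ⟨f (M + 1), ?_, h6.symm⟩)
        have h7 := (h.cover _).1 ⟨t, ht, h1.mem_mk le_rfl (by omega)⟩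
        have hu1 := hu (M + 1) (by omega)
        push_cast at hu1
        simp only at h7
        rw [mem_freeHeights]
        refine ⟨⟨by omega, by omega⟩, by have := h7.2.1; push_cast at this; exact this, ?_⟩
        intro s hs hlev hmem
        obtain ⟨-, t1, ht1, rfl⟩ := mem_truncTiling.1 hs
        obtain ⟨a', b', f', h8, h9⟩ := h.tile_cases hu hT hlast ht1
        rcases h9 with h9 | ⟨rfl, h10, h11, -⟩
        · rw [truncTile_of_le h8 h9.1] at hlev
          exact hlev ⟨_, _, _, h8, h9.2⟩
        · rw [mem_truncTile, h8.mem] at hmem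
          simp only at hmem
          have h12 := hlink t1 ht1 a' f' h8 hmem.1.1
          have h13 : (M + 1, f (M + 1)) ∈ t1 := by
            rw [h8.mem]
            simp only
            omega
          have h14 := h.disjoint t ht t1 ht1 _ (h1.mem_mk le_rfl (by omega)) h13
          subst h14
          have := (h1.unique h8).1
          omega
  ext s
  refine ⟨fun hs => ?_, hsub s⟩
  obtain ⟨z, hz⟩ := hE.nonempty hs
  obtain ⟨t, ht, hzt⟩ := (h.cover z).2 ((hE.cover z).1 ⟨s, hs, hz⟩)
  rwa [hE.disjoint s hs t (hsub t ht) z hz hzt]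

/-- The heights of a lower path in the columns `M + 1` and `M + 2`, when the number of boxes in the
last column is divisible by four. -/
def extHeight (M : ℕ) (g : ℕ → ℤ) (x : ℕ) : ℤ :=
  if x ≤ M then g x else
    g M + (if ((M : ℤ) - g M) % 4 = 0 then 1 else -1) + (x - (M + 1))

-- Truncation and extension are inverse because the last two steps of the lower path are determined
-- by its height at `M`: the last one is `U`, and the other is fixed by the evenness of the number
-- of boxes in the last column.
open Classical in
theorem sum_straight_notMem {M : ℕ} (hM : Odd M) {mu : Path (M + 2)} {nu : Path M}
    (hmu : ∀ x ≤ M + 2, height mu x = x) (hnu : ∀ x ≤ M, height nu x = x) :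
    ∑ q ∈ pairsBI mu with {(M + 2, (M + 1 : ℤ))} ∉ q.2, (X : ℤ[X]) ^ tiles q.2 =
      upperGenFun nu := by
  rw [upperGenFun_eq]
  rw [Nat.odd_iff] at hM
  have hgstep : ∀ lam : Path M, ∀ k < M + 2,
      extHeight M (height lam) (k + 1) = extHeight M (height lam) k + 1 ∨
        extHeight M (height lam) (k + 1) = extHeight M (height lam) k - 1 := by
    intro lam k hk
    unfold extHeight
    rcases lt_trichotomy k M with hx | rfl | hx
    · rw [if_pos hx.le, if_pos (show k + 1 ≤ M by omega)]
      exact height_step lam hx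
    · rw [if_pos le_rfl, if_neg (by omega)]
      push_cast
      split_ifs <;> omega
    · rw [if_neg (show ¬ k + 1 ≤ M by omega), if_neg (show ¬ k ≤ M by omega)]
      push_cast
      omega
  have hext : ∀ lam : Path M, ∀ x ≤ M + 2,
      height (ofHeights (M + 2) (extHeight M (height lam))) x = extHeight M (height lam) x := by
    intro lam x hx
    refine height_ofHeights ?_ (hgstep lam) hx
    simp [extHeight, height_zero]
  have hextle : ∀ lam : Path M, ∀ x ≤ M,
      extHeight M (height lam) x = height lam x := fun lam x hx => if_pos hx
  symm
  refine sum_nbij' (fun q => (ofHeights (M + 2) (extHeight M (height q.1)),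
      extTiling M (if ((M : ℤ) - height q.1 M) % 4 = 0 then 1 else -1) (height q.1 M) q.2))
    (fun q => (ofHeights M (height q.1), truncTiling M q.2)) ?_ ?_ ?_ ?_ ?_
  · rintro ⟨lam, T⟩ hq
    rw [mem_pairsBI] at hq
    obtain ⟨h1, h2, h3⟩ := hq
    simp only at h1 h2 h3 ⊢
    rw [mem_filter, mem_pairsBI]
    have hpar := height_emod lam (le_refl M)
    have hM0 := h1 M le_rfl
    have hMle := height_le lam (le_refl M)
    set e : ℤ := if ((M : ℤ) - height lam M) % 4 = 0 then 1 else -1 with he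
    have he1 : e = 1 ∨ e = -1 := by rw [he]; split_ifs <;> simp
    have hE1 : extHeight M (height lam) (M + 1) = height lam M + e := by
      rw [extHeight, if_neg (by omega)]; push_cast; ring
    have hE2 : extHeight M (height lam) (M + 2) = height lam M + e + 1 := by
      rw [extHeight, if_neg (by omega)]; push_cast; ring
    have hcases : ∀ x ≤ M + 2, x ≤ M ∨ x = M + 1 ∨ x = M + 2 := by omega
    -- As `M` is odd, `lam` has height at least `1` there, so a down step keeps it a ballot path.
    have hmod : ((M : ℤ) + 2 - (height lam M + e + 1)) % 4 = 0 ∧ 0 ≤ height lam M + e ∧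
        height lam M + e ≤ M + 1 := by
      rw [he]; split_ifs <;> omega
    refine ⟨⟨?_, ?_, ?_⟩, h3.singleton_notMem_extTiling _ _⟩
    · intro k hk
      simp only
      rw [hext _ _ hk]
      rcases hcases k hk with hx | rfl | rfl
      · rw [hextle _ _ hx]; exact h1 k hx
      · rw [hE1]; exact hmod.2.1
      · rw [hE2]; omega
    · intro k hk
      simp only
      rw [hext _ _ hk, hmu _ hk]
      rcases hcases k hk with hx | rfl | rfl
      · rw [hextle _ _ hx]; exact height_le lam hx
      · rw [hE1]; push_cast; omega
      · rw [hE2]; push_cast; omega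
    · have h4 : Valid M (extHeight M (height lam)) (height mu) T :=
        h3.congr (fun x hx => (hextle lam x hx).symm) fun x hx => by
          rw [hnu x hx, hmu x (by omega)]
      have h5 := h4.ext (e := e) hmu he1 (by rw [hE1, hextle _ _ le_rfl])
        (by rw [hE2, hextle _ _ le_rfl]) (by rw [hextle _ _ le_rfl, hpar])
        (by rw [hE2]; omega) (by rw [hE2]; exact hmod.1)
      rw [hextle _ _ le_rfl] at h5
      exact h5.congr (fun x hx => (hext lam x hx).symm) fun x _ => rfl
  · rintro ⟨lam, T⟩ hq
    rw [mem_filter, mem_pairsBI] at hq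
    obtain ⟨⟨h1, h2, h3⟩, h4⟩ := hq
    simp only at h1 h2 h3 h4 ⊢
    rw [mem_pairsBI]
    have hg : ∀ x ≤ M, height (ofHeights M (height lam)) x = height lam x := fun x hx =>
      height_ofHeights (height_zero lam) (fun k hk => height_step lam (by omega)) hx
    refine ⟨?_, ?_, ?_⟩
    · intro k hk
      simp only
      rw [hg k hk]
      exact h1 k (by omega)
    · intro k hk
      simp only
      rw [hg k hk, hnu k hk]
      exact height_le lam (by omega)
    · have hlast := h3.lower_last hmu h4 (height_emod lam le_rfl) h2
        (height_step lam (by omega))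
      have h5 := h3.trunc hmu (fun x hx => height_emod lam hx) h4 hlast
        (height_step lam (by omega))
      exact h5.congr (fun x hx => (hg x hx).symm) fun x hx => by
        rw [hnu x hx, hmu x (by omega)]
  · rintro ⟨lam, T⟩ hq
    rw [mem_pairsBI] at hq
    obtain ⟨h1, h2, h3⟩ := hq
    simp only at h1 h2 h3 ⊢
    rw [h3.truncTiling_extTiling]
    congr 1
    refine path_ext fun k hk => ?_
    rw [height_ofHeights (height_zero _) (fun k hk => height_step _ (by omega)) hk,
      hext _ _ (by omega), hextle _ _ hk]
  · rintro ⟨lam, T⟩ hq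
    rw [mem_filter, mem_pairsBI] at hq
    obtain ⟨⟨h1, h2, h3⟩, h4⟩ := hq
    simp only at h1 h2 h3 h4 ⊢
    have hg : ∀ x ≤ M, height (ofHeights M (height lam)) x = height lam x := fun x hx =>
      height_ofHeights (height_zero lam) (fun k hk => height_step lam (by omega)) hx
    have hlast := h3.lower_last hmu h4 (height_emod lam le_rfl) h2
      (height_step lam (by omega))
    have hu2 := hmu (M + 2) le_rfl
    -- Since the top anchor box is not a tile by itself, the tiles meeting the last column are
    -- exactly the non-level ones, an even number.
    have hmod : ((M : ℤ) + 2 - height lam (M + 2)) % 4 = 0 := by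
      have h5 := two_mul_card_column (N := M + 2) (l := height lam) (u := height mu) (T := T)
        (fun s hs => by
          obtain ⟨a, b, f, h1, -⟩ := h3.tile s hs
          exact ⟨a, b, f, h1⟩)
        h3.disjoint
        (fun y => by
          rw [h3.cover]
          simp only [le_refl, true_and])
        (height_emod lam le_rfl) (height_emod mu le_rfl) (h2 _ le_rfl)
      have h6 : {t ∈ T | ∃ y, (M + 2, y) ∈ t} = {t ∈ T | ¬ IsLevel t} := by
        refine filter_congr fun t ht => ?_
        obtain ⟨a, b, f, h7, h8⟩ := h3.tile_cases hmu h4 hlast ht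
        rw [h7.isLevel_iff]
        constructor
        · rintro ⟨y, hy⟩ h9
          rw [h7.mem] at hy
          rcases h8 with h8 | ⟨-, -, -, h8⟩
          · simp only at hy
            omega
          · rw [h9, sub_self] at h8
            simp at h8
        · intro h9
          rcases h8 with h8 | ⟨rfl, -, -, -⟩
          · exact absurd h8.2 h9
          · exact ⟨_, h7.mem_mk h7.le le_rfl⟩
      have h7 := h3.even_card_not_isLevel
      rw [← h6, Nat.even_iff] at h7
      push_cast at hu2
      omega
    have hstep := height_step lam (show M < M + 2 by omega)
    rw [hg M le_rfl]
    set e : ℤ := if ((M : ℤ) - height lam M) % 4 = 0 then 1 else -1 with he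
    have he1 : e = 1 ∨ e = -1 := by rw [he]; split_ifs <;> simp
    have hl1 : height lam (M + 1) = height lam M + e := by
      rw [he]; split_ifs <;> omega
    have hl2 : height lam (M + 2) = height lam M + e + 1 := by
      rw [hlast, hl1]
    have h8 := height_le lam (le_refl (M + 2))
    push_cast at h8
    rw [h3.extTiling_truncTiling hmu (fun x hx => height_emod lam hx) h4 h8 he1 hl1 hl2 hmod]
    congr 1
    refine path_ext fun k hk => ?_
    rw [hext _ _ hk]
    rcases (show k ≤ M ∨ k = M + 1 ∨ k = M + 2 by omega) with hx | rfl | rfl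
    · rw [hextle _ _ hx, hg k hx]
    · rw [extHeight, if_neg (by omega), hg M le_rfl, hl1]
      push_cast
      rw [he]; ring
    · rw [extHeight, if_neg (by omega), hg M le_rfl, hl2]
      push_cast
      rw [he]; ring
  · rintro ⟨lam, T⟩ hq
    rw [mem_pairsBI] at hq
    simp only
    rw [hq.2.2.tiles_extTiling (by split_ifs <;> simp)]

/-! ### The recursion for the generating function -/

theorem qInt_succ (k : ℕ) : qInt (k + 1) = 1 + X * qInt k := by
  unfold qInt
  rw [sum_range_succ', mul_sum, add_comm]
  simp [pow_succ']

/-- The height function `g` without the first peak, if this peak is at the height `k`. -/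
def dropPeak (k : ℕ) (g : ℕ → ℤ) (x : ℕ) : ℤ := if x + 1 < k then x else g (x + 2)

/-- Induction on the first peak, which has height `k + 1`. Flipping it leaves a first peak of height
`k` and the same path `nu` after its removal. For `k = 0` the box below the peak is not in the
shape, because a ballot path starts with `U`. -/
theorem upperGenFun_of_peak {N : ℕ} {nu : Path N} (k : ℕ) (hkN : k ≤ N) :
    ∀ mu : Path (N + 2), (∀ x ≤ k + 1, height mu x = x) → height mu (k + 2) = k →
      (∀ x ≤ N, height nu x = dropPeak (k + 1) (height mu) x) →
      upperGenFun mu = qInt (k + 1) * upperGenFun nu := by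
  classical
  induction k with
  | zero =>
    intro mu hmu1 hmu2 hnu
    have hlift : ∀ x ≤ N + 2, height mu x = lift 0 (height nu) x := by
      intro x hx
      rcases column_cases 0 x with h | rfl | ⟨x', rfl, h⟩
      · obtain rfl : x = 0 := by omega
        rw [height_zero, lift_of_le le_rfl, height_zero]
      · rw [lift_succ, height_zero, hmu1 _ (by omega)]; simp
      · rw [lift_add_two h, hnu _ (by omega), dropPeak, if_neg (by omega)]
    have h1 := sum_singleton_notMem (Nat.zero_le N) hlift
    rw [← h1, upperGenFun_eq, filter_true_of_mem]
    · simp [qInt]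
    · rintro ⟨lam, T⟩ hq hT
      rw [mem_pairsBI] at hq
      obtain ⟨h1, -, h3⟩ := hq
      have h2 := (h3.cover _).1 ⟨_, hT, mem_singleton_self _⟩
      have h4 := h1 1 (by omega)
      have h5 := height_step lam (show 0 < N + 2 by omega)
      have h6 := hmu1 1 (by omega)
      rw [height_zero] at h5
      simp only [zero_add] at h2 h5 h4
      push_cast at h6
      omega
  | succ k ih =>
    intro mu hmu1 hmu2 hnu
    have hlift : ∀ x ≤ N + 2, height mu x = lift (k + 1) (height nu) x := by
      intro x hx
      rcases column_cases (k + 1) x with h | rfl | ⟨x', rfl, h⟩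
      · rw [lift_of_le h, hnu _ (by omega), dropPeak, hmu1 _ (by omega)]
        split_ifs with h1
        · rfl
        · obtain rfl : x = k + 1 := by omega
          exact hmu2.symm
      · rw [lift_succ, hnu _ (by omega), dropPeak, if_neg (by omega), hmu1 _ le_rfl]
        rw [show k + 1 + 2 = k + 1 + 2 by rfl, hmu2]
        push_cast
        ring
      · rw [lift_add_two h, hnu _ (by omega), dropPeak, if_neg (by omega)]
    have h1 := sum_singleton_notMem (by omega : k + 1 ≤ N) hlift
    set g : ℕ → ℤ := fun x => if x = k + 2 then height mu x - 2 else height mu x with hg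
    have hgs : ∀ x ≤ N + 2, height (ofHeights (N + 2) g) x = g x := by
      intro x hx
      refine height_ofHeights ?_ ?_ hx
      · simp [hg, height_zero]
      · intro j hj
        have h3 := hmu1 (k + 1) (by omega)
        have h4 := hmu1 (k + 2) (by omega)
        push_cast at h3 h4
        push_cast at hmu2
        simp only [hg]
        by_cases hj1 : j = k + 1
        · subst hj1
          rw [if_pos rfl, if_neg (by omega)]
          rw [show k + 1 + 1 = k + 2 by rfl]
          omega
        · by_cases hj2 : j = k + 2
          · subst hj2
            rw [if_pos rfl, if_neg (by omega)]
            rw [show k + 2 + 1 = k + 1 + 2 by rfl]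
            omega
          · rw [if_neg hj2, if_neg (by omega)]
            exact height_step mu hj
    have h2 := sum_singleton_mem (N := N + 2) (p := k + 2) (mu := mu)
      (nu := ofHeights (N + 2) g) (by omega)
      (fun x hx hne => by rw [hgs x hx]; simp only [hg, if_neg hne])
      (by rw [hgs _ (by omega)]; simp only [hg, if_pos rfl])
    have h3 := ih (by omega) (ofHeights (N + 2) g)
      (fun x hx => by
        rw [hgs x (by omega)]
        simp only [hg]
        rw [if_neg (by omega), hmu1 _ (by omega)])
      (by
        rw [hgs _ (by omega)]
        simp only [hg, if_pos rfl]
        rw [hmu1 _ (by omega)]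
        push_cast
        ring)
      (fun x hx => by
        rw [hnu x hx, dropPeak, dropPeak]
        rw [hgs _ (by omega)]
        simp only [hg]
        rcases lt_trichotomy x k with h4 | rfl | h4
        · rw [if_pos (by omega), if_pos (by omega)]
        · rw [if_pos (by omega), if_neg (by omega), if_pos rfl, hmu1 _ (by omega)]
          push_cast
          ring
        · rw [if_neg (by omega), if_neg (by omega), if_neg (by omega)])
    rw [h3] at h2
    rw [upperGenFun_eq mu, ← sum_filter_add_sum_filter_not _
      (fun q => {(k + 2, height mu (k + 2) - 1)} ∈ q.2), h2, h1, qInt_succ (k + 1)]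
    ring

/-- If the top anchor box is a tile, flipping the last step gives a path with first peak of height
`M + 1`, hence the factor `[M + 1]`. The other tilings contribute `upperGenFun nu`, and `[M + 2] = 1
+ q [M + 1]`. -/
theorem upperGenFun_straight {M : ℕ} (hM : Odd M) {mu : Path (M + 2)} {nu : Path M}
    (hmu : ∀ x ≤ M + 2, height mu x = x) (hnu : ∀ x ≤ M, height nu x = x) :
    upperGenFun mu = qInt (M + 2) * upperGenFun nu := by
  classical
  set g : ℕ → ℤ := fun x => if x = M + 2 then height mu x - 2 else height mu x with hg
  have hgs : ∀ x ≤ M + 2, height (ofHeights (M + 2) g) x = g x := by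
    intro x hx
    refine height_ofHeights ?_ ?_ hx
    · simp [hg, height_zero]
    · intro j hj
      have h3 := hmu (M + 1) (by omega)
      have h4 := hmu (M + 2) (by omega)
      push_cast at h3 h4
      simp only [hg]
      by_cases hj1 : j = M + 1
      · subst hj1
        rw [if_pos rfl, if_neg (by omega)]
        change height mu (M + 2) - 2 = height mu (M + 1) + 1 ∨
          height mu (M + 2) - 2 = height mu (M + 1) - 1
        omega
      · rw [if_neg (by omega), if_neg (by omega)]
        exact height_step mu hj
  have hlast := hmu (M + 2) le_rfl
  push_cast at hlast
  have h2 := sum_singleton_mem (N := M + 2) (p := M + 2) (mu := mu)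
    (nu := ofHeights (M + 2) g) le_rfl
    (fun x hx hne => by rw [hgs x hx]; simp only [hg, if_neg hne])
    (by rw [hgs _ (by omega)]; simp only [hg, if_pos rfl])
  have h3 := upperGenFun_of_peak M le_rfl (nu := nu) (ofHeights (M + 2) g)
    (fun x hx => by
      rw [hgs x (by omega)]
      simp only [hg]
      rw [if_neg (by omega), hmu _ (by omega)])
    (by
      rw [hgs _ (by omega)]
      simp only [hg, if_pos rfl]
      omega)
    (fun x hx => by
      rw [hnu x hx, dropPeak, hgs _ (by omega)]
      simp only [hg]
      split_ifs with h4 h5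
      · rfl
      · rw [h5]
        omega
      · omega)
  have h1 := sum_straight_notMem hM hmu hnu
  have h4 : ((M : ℤ) + 1) = height mu (M + 2) - 1 := by omega
  rw [h4] at h1
  rw [h3] at h2
  rw [upperGenFun_eq mu, ← sum_filter_add_sum_filter_not _
    (fun q => {(M + 2, height mu (M + 2) - 1)} ∈ q.2), h2, h1, qInt_succ (M + 1)]
  ring

theorem upperGenFun_one {mu : Path 1} (hmu : IsBallot mu) : upperGenFun mu = 1 := by
  have key : ∀ lam : Path 1, IsBallot lam → ∀ x ≤ 1, height lam x = x := by
    intro lam hlam x hx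
    have h1 := height_step lam (show 0 < 1 by omega)
    have h2 := hlam 1 le_rfl
    rw [height_zero] at h1
    simp only [zero_add] at h1
    rcases (show x = 0 ∨ x = 1 by omega) with rfl | rfl
    · simp [height_zero]
    · push_cast
      omega
  have hpairs : pairsBI mu = {(mu, ∅)} := by
    ext ⟨lam, T⟩
    rw [mem_pairsBI, mem_singleton, Prod.mk.injEq]
    constructor
    · rintro ⟨h1, h2, h3⟩
      simp only at h1 h2 h3
      refine ⟨path_ext fun x hx => by rw [key lam h1 x hx, key mu hmu x hx], ?_⟩
      refine eq_empty_of_forall_notMem fun t ht => ?_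
      obtain ⟨z, hz⟩ := h3.nonempty ht
      have h4 := (h3.cover z).1 ⟨t, ht, hz⟩
      rw [key lam h1 _ h4.1, key mu hmu _ h4.1] at h4
      omega
    · rintro ⟨rfl, rfl⟩
      refine ⟨hmu, fun _ _ => le_rfl, ⟨by simp, by simp, fun z => ?_, by simp, by simp⟩⟩
      simp only [notMem_empty, false_and, exists_false, false_iff]
      intro h4
      omega
  rw [upperGenFun_eq, hpairs, sum_singleton]
  simp [tiles_eq]

/-! ### The product side -/

theorem height_zigzag {N : ℕ} {k : ℕ} (hk : k ≤ N) :
    height (zigzag N) k = (k : ℤ) % 2 := by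
  induction k with
  | zero => simp [height_zero]
  | succ k ih =>
    rw [height_succ _ (by omega : k < N), ih (by omega)]
    unfold zigzag
    by_cases h : Even k
    · rw [if_pos h]
      rw [Nat.even_iff] at h
      simp only [Step.rise]
      push_cast
      omega
    · rw [if_neg h]
      rw [Nat.even_iff] at h
      simp only [Step.rise]
      push_cast
      omega

theorem zigzag_eq_D {N : ℕ} (d : Fin N) : zigzag N d = .D ↔ Odd d.val := by
  unfold zigzag
  rw [← Nat.not_even_iff_odd]
  split_ifs with h <;> simp [h]

/-- The statistic `ht` of the down step with the index `2 * i + 1` of the zigzag path. -/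
noncomputable def htSeq {N : ℕ} (mu : Path N) (i : ℕ) : ℕ :=
  1 + #{k ∈ range N | 2 * i + 2 + k ≤ N ∧ 1 + (k : ℤ) < height mu (2 * i + 2 + k)}

/-- On the diagonal of a down step, the parity condition and the position above the zigzag path are
automatic. -/
theorem ht_eq_htSeq {N : ℕ} (mu : Path N) {d : Fin N} (hd : Odd d.val) :
    ht mu d = htSeq mu (d.val / 2) := by
  unfold ht htSeq
  congr 1
  symm
  rw [Nat.odd_iff] at hd
  have hd' : 2 * (d.val / 2) + 2 = d.val + 1 := by omega
  have hz : height (zigzag N) d.val = 1 := by rw [height_zigzag d.2.le]; omega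
  rw [hd', hz]
  refine card_bij (fun k _ => (d.val + 1 + k, (1 : ℤ) + k)) ?_ ?_ ?_
  · intro k hk
    obtain ⟨h1, h2, h3⟩ := mem_filter.1 hk
    rw [mem_filter, mem_skewShape]
    refine ⟨⟨h2, ?_, ?_, h3⟩, k, h1, rfl⟩
    · rw [Int.odd_iff]
      push_cast
      omega
    · simp only
      rw [height_zigzag h2]
      push_cast
      omega
  · intro k _ k' _ h
    simp only [Prod.mk.injEq] at h
    omega
  · intro b hb
    rw [mem_filter, mem_skewShape] at hb
    obtain ⟨⟨h1, -, -, h2⟩, k, hk, rfl⟩ := hb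
    exact ⟨k, mem_filter.2 ⟨hk, h1, h2⟩, rfl⟩

theorem range_filter_odd (m : ℕ) :
    (List.range (2 * m + 1)).filter (fun n => Odd n) = (List.range m).map fun i => 2 * i + 1 := by
  induction m with
  | zero => rfl
  | succ m ih =>
    rw [show 2 * (m + 1) + 1 = 2 * m + 1 + 1 + 1 by ring, List.range_succ, List.range_succ,
      List.filter_append, List.filter_append, ih, List.range_succ, List.map_append]
    have h1 : Odd (2 * m + 1) := ⟨m, rfl⟩
    have h2 : ¬ Odd (2 * m + 1 + 1) := by rw [Nat.odd_iff]; omega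
    simp [h1, h2]

theorem map_ht_eq {m : ℕ} (mu : Path (2 * m + 1)) {α : Type*} (F : ℕ → α) :
    ((List.finRange (2 * m + 1)).filter fun d => zigzag (2 * m + 1) d = .D).map
      (fun d => F (ht mu d)) = (List.range m).map fun i => F (htSeq mu i) := by
  have h1 : ((List.finRange (2 * m + 1)).filter fun d => zigzag (2 * m + 1) d = .D).map
      (fun d => F (ht mu d)) = (((List.finRange (2 * m + 1)).filter fun d => Odd d.val).map
        Fin.val).map fun n => F (htSeq mu (n / 2)) := by
    rw [List.map_map]
    simp_rw [zigzag_eq_D]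
    refine List.map_congr_left fun d hd => ?_
    have hd' : Odd d.val := by simpa using List.of_mem_filter hd
    rw [ht_eq_htSeq mu hd']
    rfl
  have h2 : ((List.finRange (2 * m + 1)).filter fun d => Odd d.val).map Fin.val =
      (List.range (2 * m + 1)).filter fun n => Odd n := by
    rw [← List.map_coe_finRange_eq_range, List.filter_map]
    rfl
  rw [h1, h2, range_filter_odd, List.map_map]
  refine List.map_congr_left fun i _ => ?_
  simp only [Function.comp]
  rw [show (2 * i + 1) / 2 = i by omega]

theorem prod_qInt_ht {m : ℕ} (mu : Path (2 * m + 1)) :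
    ∏ d : Fin (2 * m + 1) with zigzag (2 * m + 1) d = Step.D, qInt (ht mu d) =
      ((List.range m).map fun i => qInt (htSeq mu i)).prod := by
  rw [← map_ht_eq mu qInt]
  rw [prod_filter, Fin.prod_univ_def]
  induction List.finRange (2 * m + 1) with
  | nil => simp
  | cons d l ih =>
    rw [List.map_cons, List.prod_cons, ih, List.filter_cons]
    by_cases h : zigzag (2 * m + 1) d = .D <;> simp [h]

/-- Removing the first peak shifts the part of the path after it by two columns and carries each
diagonal to the previous one. On the initial straight part the diagonals lie below both paths. -/
theorem htSeq_succ {N k : ℕ} {mu : Path (N + 2)} {nu : Path N} (hk : k ≤ N + 1)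
    (hmu : ∀ x ≤ k + 1, height mu x = x)
    (hnu : ∀ x ≤ N, height nu x = dropPeak (k + 1) (height mu) x) (i : ℕ) :
    htSeq mu (i + 1) = htSeq nu i := by
  unfold htSeq
  congr 2
  ext j
  rw [mem_filter, mem_filter, mem_range, mem_range]
  by_cases hj : 2 * i + 2 + j ≤ N
  · rw [hnu _ hj, dropPeak]
    rw [show 2 * (i + 1) + 2 + j = 2 * i + 2 + j + 2 by ring]
    split_ifs with h
    · have h1 : ((2 * i + 2 + j : ℕ) : ℤ) ≤ height mu (2 * i + 2 + j + 2) := by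
        rcases (show 2 * i + 2 + j + 2 ≤ k + 1 ∨ 2 * i + 2 + j + 1 = k by omega) with h1 | h1
        · rw [hmu _ h1]; push_cast; omega
        · have h2 := height_step mu (k := 2 * i + 2 + j + 1) (by omega)
          rw [hmu (2 * i + 2 + j + 1) (by omega)] at h2
          change _ ≤ height mu (2 * i + 2 + j + 1 + 1)
          push_cast at h2 ⊢
          omega
      push_cast at h1 ⊢
      constructor <;> intro _ <;> refine ⟨by omega, by omega, by omega⟩
    · constructor <;> rintro ⟨h1, h2, h3⟩ <;> exact ⟨by omega, by omega, h3⟩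
  · omega

theorem height_lipschitz {N : ℕ} (p : Path N) {x : ℕ} (j : ℕ) (hx : x + j ≤ N) :
    height p (x + j) ≤ height p x + j := by
  induction j with
  | zero => simp
  | succ j ih =>
    have h1 := ih (by omega)
    have h2 := height_step p (k := x + j) (by omega)
    rw [← add_assoc]
    push_cast
    omega

/-- The first diagonal is one unit or more below `mu` up to the first peak. From column `k + 2` on
`mu` is below it, since a path climbs no faster than a diagonal. -/
theorem htSeq_zero {N k : ℕ} {mu : Path (N + 2)} (hk : k ≤ N + 1)
    (hmu : ∀ x ≤ k + 1, height mu x = x) (hmu2 : k ≤ N → height mu (k + 2) = k) :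
    htSeq mu 0 = k + 1 := by
  unfold htSeq
  rw [add_comm]
  congr 1
  convert card_range k using 2
  ext j
  rw [mem_filter, mem_range, mem_range, mul_zero, zero_add]
  constructor
  · rintro ⟨h1, h2, h3⟩
    by_contra hjk
    have h4 := height_lipschitz mu (x := k + 2) (j - k) (by omega)
    rw [hmu2 (by omega), show k + 2 + (j - k) = 2 + j by omega] at h4
    omega
  · intro h
    refine ⟨by omega, by omega, ?_⟩
    rw [hmu _ (by omega)]
    push_cast
    omega

/-- The value `k = N + 1` stands for the path without down steps. -/
theorem exists_first_peak {N : ℕ} {mu : Path (N + 2)} (hmu : IsBallot mu) :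
    ∃ k ≤ N + 1, (∀ x ≤ k + 1, height mu x = x) ∧ (k ≤ N → height mu (k + 2) = k) := by
  classical
  by_cases h : ∃ j, j ≤ N + 2 ∧ height mu j ≠ j
  · have h1 := Nat.find_spec h
    have h2 : ∀ x < Nat.find h, height mu x = x := fun x hx => by
      by_contra hne
      exact Nat.find_min h hx ⟨by omega, hne⟩
    set j := Nat.find h
    have hj0 : j ≠ 0 := by
      intro h0
      rw [h0, height_zero] at h1
      simp at h1
    obtain ⟨i, hi⟩ : ∃ i, j = i + 1 := ⟨j - 1, by omega⟩
    rw [hi] at h1 h2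
    have h3 := height_step mu (k := i) (by omega)
    have h4 := h2 i (by omega)
    have h5 := hmu (i + 1) (by omega)
    have h6 := h1.2
    push_cast at h6
    obtain ⟨k, rfl⟩ : ∃ k, i = k + 1 := ⟨i - 1, by omega⟩
    refine ⟨k, by omega, fun x hx => h2 x (by omega), fun _ => ?_⟩
    change height mu (k + 1 + 1) = k
    push_cast at h4 h6
    omega
  · push Not at h
    exact ⟨N + 1, le_rfl, fun x hx => h x (by omega), fun h => by omega⟩

theorem upperGenFun_eq_prod (m : ℕ) : ∀ N, N = 2 * m + 1 → ∀ mu : Path N, IsBallot mu →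
    upperGenFun mu = ((List.range m).map fun i => qInt (htSeq mu i)).prod := by
  induction m with
  | zero =>
    rintro N rfl mu hmu
    rw [upperGenFun_one hmu]
    simp
  | succ m ih =>
    intro N hN mu hmu
    obtain rfl : N = 2 * m + 1 + 2 := by omega
    obtain ⟨k, hk, h1, h2⟩ := exists_first_peak (N := 2 * m + 1) hmu
    have hg : ∀ x ≤ 2 * m + 1, height (ofHeights (2 * m + 1) (dropPeak (k + 1) (height mu))) x =
        dropPeak (k + 1) (height mu) x := by
      intro x hx
      refine height_ofHeights ?_ ?_ hx
      · unfold dropPeak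
        split_ifs with h3
        · rfl
        · obtain rfl : k = 0 := by omega
          simpa using h2 (by omega)
      · intro j hj
        unfold dropPeak
        rcases lt_trichotomy (j + 1) k with h3 | h3 | h3
        · rw [if_pos (by omega), if_pos (by omega)]
          push_cast
          omega
        · rw [if_neg (by omega), if_pos (by omega), show j + 1 + 2 = k + 2 by omega,
            h2 (by omega)]
          omega
        · rw [if_neg (by omega), if_neg (by omega)]
          exact height_step mu (k := j + 2) (by omega)
    set nu : Path (2 * m + 1) := ofHeights (2 * m + 1) (dropPeak (k + 1) (height mu))
    have hnu : IsBallot nu := by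
      intro x hx
      rw [hg x hx]
      unfold dropPeak
      split_ifs
      · omega
      · exact hmu _ (by omega)
    have hF : upperGenFun mu = qInt (k + 1) * upperGenFun nu := by
      rcases (show k ≤ 2 * m + 1 ∨ k = 2 * m + 2 by omega) with h3 | rfl
      · exact upperGenFun_of_peak k h3 mu h1 (h2 h3) hg
      · refine upperGenFun_straight ⟨m, rfl⟩ h1 fun x hx => ?_
        rw [hg x hx, dropPeak, if_pos (by omega)]
    have h4 : (List.range (m + 1)).map (fun i => qInt (htSeq mu i)) =
        qInt (k + 1) :: (List.range m).map fun i => qInt (htSeq nu i) := by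
      rw [List.range_succ_eq_map, List.map_cons, List.map_map]
      congr 1
      · rw [htSeq_zero hk h1 h2]
      · refine List.map_congr_left fun i _ => ?_
        simp only [Function.comp]
        rw [Nat.succ_eq_add_one, htSeq_succ hk h1 hg]
    rw [hF, ih _ rfl nu hnu, h4, List.prod_cons]

/-! ### Inequalities between the heights of the down steps -/

theorem one_le_htSeq {N : ℕ} (mu : Path N) (i : ℕ) : 1 ≤ htSeq mu i := by
  unfold htSeq
  omega

theorem htSeq_le {N : ℕ} (mu : Path N) {i : ℕ} (hi : 2 * i + 1 ≤ N) : htSeq mu i ≤ N - 2 * i := by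
  unfold htSeq
  have : #{k ∈ range N | 2 * i + 2 + k ≤ N ∧ 1 + (k : ℤ) < height mu (2 * i + 2 + k)} ≤
      #(range (N - 2 * i - 1)) := by
    refine card_le_card fun k hk => ?_
    rw [mem_filter] at hk
    rw [mem_range]
    omega
  rw [card_range] at this
  omega

/-- If the diagonal of the down step `i` leaves the shape before column `N`, then `mu` has dropped
to it in some column. The diagonals of earlier down steps are higher, so they have left the shape by
that column too. -/
theorem htSeq_cases {N : ℕ} (mu : Path N) {i : ℕ} (hi : 2 * i + 1 ≤ N) :
    htSeq mu i = N - 2 * i ∨ ∀ j ≤ i, htSeq mu j + 2 * j ≤ htSeq mu i + 2 * i := by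
  have key : ∀ j n, 2 * j + 2 + n ≤ N → height mu (2 * j + 2 + n) ≤ 1 + n → htSeq mu j ≤ n + 1 := by
    intro j n hn h
    unfold htSeq
    have : #{k ∈ range N | 2 * j + 2 + k ≤ N ∧ 1 + (k : ℤ) < height mu (2 * j + 2 + k)} ≤
        #(range n) := by
      refine card_le_card fun k hk => ?_
      rw [mem_filter] at hk
      rw [mem_range]
      by_contra hkn
      have h1 := height_lipschitz mu (x := 2 * j + 2 + n) (k - n) (by omega)
      rw [show 2 * j + 2 + n + (k - n) = 2 * j + 2 + k by omega] at h1
      omega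
    rw [card_range] at this
    omega
  by_cases hmax : htSeq mu i = N - 2 * i
  · exact Or.inl hmax
  · right
    intro j hj
    have h1 := htSeq_le mu hi
    have h2 := one_le_htSeq mu i
    obtain ⟨n, hn⟩ : ∃ n, htSeq mu i = n + 1 := ⟨htSeq mu i - 1, by omega⟩
    have hfail : height mu (2 * i + 2 + n) ≤ 1 + n := by
      by_contra hlt
      have h3 : #(range (n + 1)) ≤
          #{k ∈ range N | 2 * i + 2 + k ≤ N ∧ 1 + (k : ℤ) < height mu (2 * i + 2 + k)} := by
        refine card_le_card fun k hk => ?_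
        rw [mem_range] at hk
        rw [mem_filter, mem_range]
        refine ⟨by omega, by omega, ?_⟩
        have h4 := height_lipschitz mu (x := 2 * i + 2 + k) (n - k) (by omega)
        rw [show 2 * i + 2 + k + (n - k) = 2 * i + 2 + n by omega] at h4
        omega
      rw [card_range] at h3
      unfold htSeq at hn
      omega
    have h5 := key j (n + 2 * (i - j)) (by omega) (by
      rw [show 2 * j + 2 + (n + 2 * (i - j)) = 2 * i + 2 + n by omega]
      push_cast
      omega)
    omega

/-! ### Inversions of words -/

section Words

variable {α : Type*}

/-- The number of inversions of a word. -/
def wordInv [LinearOrder α] : List α → ℕ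
  | [] => 0
  | a :: l => l.countP (· < a) + wordInv l

theorem countP_ofFn {n : ℕ} (v : Fin n → α) (p : α → Prop) [DecidablePred p] :
    (List.ofFn v).countP (fun a => decide (p a)) = ∑ j, if p (v j) then 1 else 0 := by
  induction n with
  | zero => simp
  | succ n ih =>
    rw [List.ofFn_succ, List.countP_cons, ih, Fin.sum_univ_succ, add_comm]
    simp

theorem card_inversions_eq_wordInv [LinearOrder α] (n : ℕ) : ∀ w : Fin n → α,
    #{p : Fin n × Fin n | p.1 < p.2 ∧ w p.2 < w p.1} = wordInv (List.ofFn w) := by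
  induction n with
  | zero => intro w; simp [wordInv]
  | succ n ih =>
    intro w
    rw [List.ofFn_succ, wordInv, ← ih]
    have h1 : ∀ (m : ℕ) (v : Fin m → α), #{p : Fin m × Fin m | p.1 < p.2 ∧ v p.2 < v p.1} =
        ∑ i, ∑ j, if i < j ∧ v j < v i then 1 else 0 := by
      intro m v
      rw [card_filter, ← univ_product_univ, sum_product]
    rw [h1, h1 n fun i => w i.succ, countP_ofFn, Fin.sum_univ_succ]
    congr 1
    · rw [Fin.sum_univ_succ]
      simp
    · refine sum_congr rfl fun i _ => ?_
      rw [Fin.sum_univ_succ]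
      simp

theorem inversions_eq_wordInv {n : ℕ} (w : Equiv.Perm (Fin n)) :
    inversions w = wordInv (List.ofFn w) :=
  card_inversions_eq_wordInv n w

/-! ### Words built by `pickWord` -/

/-- The bounds on the entries of a list that make `pickWord` well-behaved, for a list of letters
with two more letters than are removed. -/
def Fits : List ℕ → Prop
  | [] => True
  | h :: hs => (1 ≤ h ∧ h ≤ 2 * hs.length + 3) ∧ Fits hs

theorem pickWord_succ_cons {h : ℕ} {hs : List ℕ} {b : α} {S : List α} (hh : h < S.length) :
    pickWord ((h + 1) :: hs) (b :: S) = S[h] :: b :: pickWord hs (S.eraseIdx h) := by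
  simp [pickWord, List.getElem?_eq_getElem hh]

theorem Fits.exists_cons {h : ℕ} {hs : List ℕ} {S : List α} (hf : Fits (h :: hs))
    (hS : S.length = 2 * (h :: hs).length + 2) :
    ∃ h' b S', h = h' + 1 ∧ S = b :: S' ∧ h' < S'.length ∧ Fits hs ∧
      (S'.eraseIdx h').length = 2 * hs.length + 2 := by
  obtain ⟨⟨h1, h2⟩, h3⟩ := hf
  rw [List.length_cons] at hS
  obtain ⟨b, S', rfl⟩ : ∃ b S', S = b :: S' := by
    cases S with
    | nil => simp at hS
    | cons b S' => exact ⟨b, S', rfl⟩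
  rw [List.length_cons] at hS
  have h4 : h - 1 < S'.length := by omega
  refine ⟨h - 1, b, S', by omega, rfl, h4, h3, ?_⟩
  rw [List.length_eraseIdx_of_lt h4]
  omega

theorem pairwise_eraseIdx {r : α → α → Prop} {S : List α} (h : S.Pairwise r) (k : ℕ) :
    (S.eraseIdx k).Pairwise r :=
  h.sublist (List.eraseIdx_sublist S k)

theorem countP_lt_eraseIdx [LinearOrder α] {S : List α} (hS : S.Pairwise (· < ·)) {k : ℕ}
    (hk : k < S.length) : (S.eraseIdx k).countP (· < S[k]) = k := by
  have h0 : S = S.take k ++ S[k] :: S.drop (k + 1) := by simp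
  have h1 : (S.take k ++ S[k] :: S.drop (k + 1)).Pairwise (· < ·) := h0 ▸ hS
  rw [List.pairwise_append, List.pairwise_cons] at h1
  rw [List.eraseIdx_eq_take_drop_succ, List.countP_append, List.countP_eq_length.2,
    List.countP_eq_zero.2]
  · rw [List.length_take]
    omega
  · intro x hx
    simpa using (h1.2.1.1 x hx).le
  · intro x hx
    exact decide_eq_true (h1.2.2 x hx S[k] List.mem_cons_self)

/-- The letter chosen by `h` has exactly `h` smaller letters to its right, the minimum that follows
has none, and the final decreasing pair contributes the summand `1`. -/
theorem wordInv_pickWord [LinearOrder α] (hs : List ℕ) : ∀ S : List α, S.Pairwise (· < ·) →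
    S.length = 2 * hs.length + 2 → Fits hs → wordInv (pickWord hs S) = hs.sum + 1 := by
  induction hs with
  | nil =>
    intro S hS hl _
    match S, hl with
    | [x, y], _ =>
      have hxy : x < y := by simpa using hS
      simp [pickWord, wordInv, hxy]
  | cons h hs ih =>
    intro S hS hl hf
    obtain ⟨h', b, S', rfl, rfl, h1, h2, h3⟩ := hf.exists_cons hl
    rw [List.pairwise_cons] at hS
    rw [pickWord_succ_cons h1, wordInv, wordInv, ih _ (pairwise_eraseIdx hS.2 h') h3 h2,
      List.countP_cons, (pickWord_perm hs (S'.eraseIdx h')).countP_eq,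
      (pickWord_perm hs (S'.eraseIdx h')).countP_eq, countP_lt_eraseIdx hS.2 h1,
      List.countP_eq_zero.2, List.sum_cons]
    · simp only [hS.1 _ (List.getElem_mem h1), decide_true, if_true]
      ring
    · intro x hx
      simpa using (hS.1 x (List.mem_of_mem_eraseIdx hx)).le

/-- Every letter in an even position is smaller than its left neighbour and all letters to its
right. -/
def MinSecond [LinearOrder α] : List α → Prop
  | a :: b :: l => b < a ∧ (∀ c ∈ l, b < c) ∧ MinSecond l
  | _ => True

theorem minSecond_iff [LinearOrder α] (l : List α) : MinSecond l ↔
    ∀ i j x y, l[2 * i + 1]? = some x → l[j]? = some y → 2 * i ≤ j → j ≠ 2 * i + 1 → x < y := by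
  induction l using MinSecond.induct with
  | case1 a b l ih =>
    rw [MinSecond, ih]
    constructor
    · rintro ⟨h1, h2, h3⟩ i j x y hx hy hij hne
      rcases i with _ | i
      · obtain rfl : b = x := by simpa using hx
        rcases j with _ | _ | j
        · obtain rfl : a = y := by simpa using hy
          exact h1
        · exact absurd rfl hne
        · exact h2 y (List.mem_of_getElem? (i := j) (by simpa using hy))
      · obtain ⟨j, rfl⟩ : ∃ k, j = k + 2 := ⟨j - 2, by omega⟩
        refine h3 i j x y ?_ (by simpa using hy) (by omega) (by omega)
        rw [show 2 * (i + 1) + 1 = 2 * i + 1 + 1 + 1 by ring] at hx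
        simpa using hx
    · intro h
      refine ⟨h 0 0 b a (by simp) (by simp) (by omega) (by omega), ?_, ?_⟩
      · intro c hc
        obtain ⟨j, hj⟩ := List.mem_iff_getElem?.1 hc
        exact h 0 (j + 2) b c (by simp) (by simpa using hj) (by omega) (by omega)
      · intro i j x y hx hy hij hne
        refine h (i + 1) (j + 2) x y ?_ (by simpa using hy) (by omega) (by omega)
        rw [show 2 * (i + 1) + 1 = 2 * i + 1 + 1 + 1 by ring]
        simpa using hx
  | case2 l hl =>
    have h1 : l.length < 2 := by
      match l, hl with
      | [], _ => simp
      | [_], _ => simp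
      | a :: b :: l, hl => exact absurd rfl (hl a b l)
    have h2 : MinSecond l := by
      match l, hl with
      | [], _ => trivial
      | [_], _ => trivial
      | a :: b :: l, hl => exact absurd rfl (hl a b l)
    simp only [h2, true_iff]
    intro i j x y hx hy hij hne
    have h3 := (List.getElem?_eq_some_iff.1 hx).1
    have h4 := (List.getElem?_eq_some_iff.1 hy).1
    omega

theorem minSecond_pickWord [LinearOrder α] (hs : List ℕ) : ∀ S : List α, S.Pairwise (· < ·) →
    S.length = 2 * hs.length + 2 → Fits hs → MinSecond (pickWord hs S) := by
  induction hs with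
  | nil =>
    intro S hS hl _
    match S, hl with
    | [x, y], _ =>
      have hxy : x < y := by simpa using hS
      simp [pickWord, MinSecond, hxy]
  | cons h hs ih =>
    intro S hS hl hf
    obtain ⟨h', b, S', rfl, rfl, h1, h2, h3⟩ := hf.exists_cons hl
    rw [List.pairwise_cons] at hS
    rw [pickWord_succ_cons h1, MinSecond]
    refine ⟨hS.1 _ (List.getElem_mem h1), ?_, ih _ (pairwise_eraseIdx hS.2 h') h3 h2⟩
    intro c hc
    rw [(pickWord_perm hs (S'.eraseIdx h')).mem_iff] at hc
    exact hS.1 c (List.mem_of_mem_eraseIdx hc)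

/-- The second letter must be the minimum of `S`, and the entry `h` is the rank of the first letter,
counted from `0`; the rest is a word of the same kind in the remaining letters. -/
theorem exists_pickWord_eq [LinearOrder α] (m : ℕ) : ∀ l S : List α, S.Pairwise (· < ·) →
    l.Perm S → l.length = 2 * m + 2 → MinSecond l →
      ∃ hs, hs.length = m ∧ Fits hs ∧ pickWord hs S = l := by
  induction m with
  | zero =>
    intro l S hS hp hl hm
    match l, hl with
    | [a, b], _ =>
      have hba : b < a := hm.1
      refine ⟨[], rfl, trivial, ?_⟩
      have h1 : S = [b, a] := by
        refine List.Perm.eq_of_pairwise (le := (· < ·)) ?_ hS (by simpa using hba)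
          (hp.symm.trans (List.Perm.swap b a []))
        intro x y _ _ h1 h2
        exact absurd h1 h2.asymm
      simp [pickWord, h1]
  | succ m ih =>
    intro l S hS hp hl hm
    match l, hl, hm with
    | a :: b :: r, hl, hm =>
      obtain ⟨hba, hbr, hr⟩ := hm
      have hbS : b ∈ S := hp.subset (by simp)
      have hmin : ∀ x ∈ S, b ≤ x := by
        intro x hx
        have := hp.symm.subset hx
        simp only [List.mem_cons] at this
        rcases this with rfl | rfl | h1
        · exact hba.le
        · exact le_rfl
        · exact (hbr x h1).le
      obtain ⟨S', rfl⟩ : ∃ S', S = b :: S' := by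
        cases S with
        | nil => simp at hbS
        | cons c S' =>
          rw [List.pairwise_cons] at hS
          rcases List.mem_cons.1 hbS with rfl | h1
          · exact ⟨S', rfl⟩
          · exact absurd (hS.1 b h1) (hmin c (by simp)).not_gt
      rw [List.pairwise_cons] at hS
      have hp' : (a :: r).Perm S' := ((List.Perm.swap a b r).trans hp).cons_inv
      have haS : a ∈ S' := hp'.subset (by simp)
      obtain ⟨k, hk, hka⟩ := List.getElem_of_mem haS
      have hp2 : r.Perm (S'.eraseIdx k) := by
        have := (List.getElem_cons_eraseIdx_perm hk).symm
        rw [hka] at this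
        exact (hp'.trans this).cons_inv
      obtain ⟨hs, h1, h2, h3⟩ := ih r (S'.eraseIdx k) (pairwise_eraseIdx hS.2 k) hp2
        (by simp only [List.length_cons] at hl; omega) hr
      have hlen := hp.length_eq
      simp only [List.length_cons] at hl hlen
      refine ⟨(k + 1) :: hs, by simp [h1], ⟨⟨by omega, by omega⟩, h2⟩, ?_⟩
      rw [pickWord_succ_cons hk, hka, h3]

theorem pickWord_injective [LinearOrder α] (hs : List ℕ) : ∀ (hs' : List ℕ) (S : List α),
    S.Pairwise (· < ·) → S.length = 2 * hs.length + 2 → Fits hs → Fits hs' →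
      hs.length = hs'.length → pickWord hs S = pickWord hs' S → hs = hs' := by
  induction hs with
  | nil =>
    intro hs' S _ _ _ _ h _
    exact (List.length_eq_zero_iff.1 h.symm).symm
  | cons h hs ih =>
    intro hs' S hS hl hf hf' hlen heq
    match hs', hlen with
    | k :: hs', hlen =>
      obtain ⟨h', b, S', rfl, rfl, h1, h2, h3⟩ := hf.exists_cons hl
      rw [hlen] at hl
      obtain ⟨k', b', S'', rfl, hS'', h4, h5, h6⟩ := hf'.exists_cons hl
      obtain ⟨rfl, rfl⟩ := List.cons.inj hS''
      rw [List.pairwise_cons] at hS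
      rw [pickWord_succ_cons h1, pickWord_succ_cons h4] at heq
      obtain ⟨h7, h8⟩ := List.cons.inj heq
      have hnd : S'.Nodup := hS.2.imp fun h => h.ne
      obtain rfl : h' = k' := (hnd.getElem_inj_iff).1 h7
      rw [ih hs' _ (pairwise_eraseIdx hS.2 h') h3 h2 h5 (by simpa using hlen)
        (List.cons.inj h8).2]

/-! ### Words and the Bruhat order -/

theorem Fits.of_le {h H : ℕ} {t : List ℕ} (h1 : 1 ≤ h) (h2 : h ≤ H) :
    ∀ {g : List ℕ}, Fits (g ++ H :: t) → Fits (g ++ h :: t)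
  | [], hf => ⟨⟨h1, h2.trans hf.1.2⟩, hf.2⟩
  | g0 :: g, hf => by
    obtain ⟨hf1, hf2⟩ := hf
    refine ⟨?_, Fits.of_le h1 h2 hf2⟩
    simpa using hf1

/-- The construction only uses positions in the list, so it commutes with relabelling. This lets a
transposition of letters pass through the tail of a word. -/
theorem pickWord_map {β : Type*} (f : α → β) (hs : List ℕ) : ∀ S : List α,
    pickWord hs (S.map f) = (pickWord hs S).map f := by
  induction hs with
  | nil => intro S; simp [pickWord]
  | cons h hs ih =>
    intro S
    rw [pickWord, pickWord, List.map_append, List.map_append, ← ih, List.eraseIdx_map,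
      List.map_drop, List.map_take, List.getElem?_map]
    congr 1
    cases S[h]? <;> simp

/-- Increasing one entry by one amounts to exchanging two letters of the word. -/
theorem exists_swap_pickWord [LinearOrder α] {h : ℕ} {t : List ℕ} (h1 : 1 ≤ h) :
    ∀ (g : List ℕ) (S : List α), S.Pairwise (· < ·) →
      S.length = 2 * (g ++ (h + 1) :: t).length + 2 → Fits (g ++ (h + 1) :: t) →
      ∃ x ∈ S, ∃ y ∈ S, x ≠ y ∧
        pickWord (g ++ (h + 1) :: t) S = (pickWord (g ++ h :: t) S).map (Equiv.swap x y) := by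
  intro g
  induction g with
  | nil =>
    intro S hS hl hf
    obtain ⟨k, b, S', hk, rfl, h2, h3, h4⟩ := hf.exists_cons hl
    obtain ⟨k, rfl⟩ : ∃ j, k = j + 1 := ⟨k - 1, by omega⟩
    obtain rfl : h = k + 1 := by omega
    rw [List.pairwise_cons] at hS
    have hnd : S'.Nodup := hS.2.imp fun h => h.ne
    have hk1 : k < S'.length := by omega
    have hne : S'[k] ≠ S'[k + 1] := fun heq => by
      have := (hnd.getElem_inj_iff).1 heq
      omega
    refine ⟨S'[k], List.mem_cons_of_mem _ (List.getElem_mem hk1), S'[k + 1],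
      List.mem_cons_of_mem _ (List.getElem_mem h2), hne, ?_⟩
    rw [List.nil_append, List.nil_append, pickWord_succ_cons h2, pickWord_succ_cons hk1,
      List.map_cons, List.map_cons, Equiv.swap_apply_left, Equiv.swap_apply_of_ne_of_ne
      (hS.1 _ (List.getElem_mem hk1)).ne (hS.1 _ (List.getElem_mem h2)).ne, ← pickWord_map]
    -- Deleting `S'[k]` or `S'[k + 1]` leaves two lists that differ only by exchanging these
    -- letters, at the same position.
    congr 3
    have h0 : S' = S'.take k ++ S'[k] :: S'[k + 1] :: S'.drop (k + 2) := by
      rw [List.getElem_cons_drop, List.getElem_cons_drop, List.take_append_drop]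
    have hfix : ∀ l : List α, (∀ z ∈ l, z ≠ S'[k] ∧ z ≠ S'[k + 1]) →
        l.map (Equiv.swap S'[k] S'[k + 1]) = l := by
      intro l hl
      conv_rhs => rw [← List.map_id l]
      refine List.map_congr_left fun z hz => ?_
      rw [Equiv.swap_apply_of_ne_of_ne (hl z hz).1 (hl z hz).2, id]
    have hnd' := hnd
    rw [h0, List.nodup_append, List.nodup_cons, List.nodup_cons] at hnd'
    rw [List.eraseIdx_eq_take_drop_succ, List.eraseIdx_eq_take_drop_succ,
      ← List.take_concat_get' _ _ hk1, List.drop_eq_getElem_cons h2, List.map_append,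
      List.map_cons, Equiv.swap_apply_right, hfix, hfix]
    · rw [List.append_assoc]
      rfl
    · intro z hz
      refine ⟨?_, ?_⟩
      · rintro rfl
        exact hnd'.2.1.1 (List.mem_cons_of_mem _ hz)
      · rintro rfl
        exact hnd'.2.1.2.1 hz
    · intro z hz
      exact ⟨hnd'.2.2 z hz _ List.mem_cons_self,
        hnd'.2.2 z hz _ (List.mem_cons_of_mem _ List.mem_cons_self)⟩
  | cons g0 g ih =>
    intro S hS hl hf
    rw [List.cons_append] at hf hl
    obtain ⟨k, b, S', rfl, rfl, h2, h3, h4⟩ := hf.exists_cons hl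
    rw [List.pairwise_cons] at hS
    obtain ⟨x, hx, y, hy, hne, heq⟩ := ih _ (pairwise_eraseIdx hS.2 k) h4 h3
    have hnd : (S'[k] :: S'.eraseIdx k).Nodup :=
      (List.getElem_cons_eraseIdx_perm h2).nodup_iff.2 (hS.2.imp fun h => h.ne)
    rw [List.nodup_cons] at hnd
    have hx' := List.mem_of_mem_eraseIdx hx
    have hy' := List.mem_of_mem_eraseIdx hy
    refine ⟨x, List.mem_cons_of_mem _ hx', y, List.mem_cons_of_mem _ hy', hne, ?_⟩
    rw [List.cons_append, List.cons_append, pickWord_succ_cons h2, pickWord_succ_cons h2,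
      List.map_cons, List.map_cons, heq,
      Equiv.swap_apply_of_ne_of_ne (hS.1 x hx').ne (hS.1 y hy').ne,
      Equiv.swap_apply_of_ne_of_ne]
    · rintro rfl
      exact hnd.1 hx
    · rintro rfl
      exact hnd.1 hy

end Words

/-! ### Permutations given by words -/

/-- The permutation with the one-line notation `l`. -/
noncomputable def wordPerm {n : ℕ} (l : List (Fin n)) (hl : l.Perm (List.finRange n)) :
    Equiv.Perm (Fin n) :=
  (finCongr (by rw [hl.length_eq, List.length_finRange])).trans
    (List.Nodup.getEquivOfForallMemList l (hl.nodup_iff.mpr (List.nodup_finRange _))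
      fun a => hl.mem_iff.mpr (List.mem_finRange a))

theorem ofFn_wordPerm {n : ℕ} (l : List (Fin n)) (hl : l.Perm (List.finRange n)) :
    List.ofFn (wordPerm l hl) = l := by
  have hlen : l.length = n := by rw [hl.length_eq, List.length_finRange]
  refine List.ext_getElem (by rw [List.length_ofFn, hlen]) fun i h1 h2 => ?_
  rw [List.getElem_ofFn]
  rfl

theorem sigma_eq_wordPerm {N : ℕ} (mu : Path N) :
    sigma mu = wordPerm (sigmaWord mu) (sigmaWord_perm mu) := rfl

theorem perm_ext_ofFn {n : ℕ} {v w : Equiv.Perm (Fin n)} (h : List.ofFn v = List.ofFn w) :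
    v = w :=
  DFunLike.coe_injective (List.ofFn_injective h)

theorem ofFn_perm {n : ℕ} (w : Equiv.Perm (Fin n)) :
    (List.ofFn w).Perm (List.finRange n) := by
  rw [List.ofFn_eq_map]
  refine (List.perm_ext_iff_of_nodup ?_ (List.nodup_finRange n)).2 ?_
  · exact (List.nodup_finRange n).map w.injective
  · intro a
    simp only [List.mem_map, List.mem_finRange, true_and, iff_true]
    exact w.surjective a

/-- The permutation with the one-line notation `pickWord hs [1, …, n]`. -/
noncomputable def pickPerm (n : ℕ) (hs : List ℕ) : Equiv.Perm (Fin n) :=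
  wordPerm (pickWord hs (List.finRange n)) (pickWord_perm _ _)

theorem ofFn_pickPerm (n : ℕ) (hs : List ℕ) :
    List.ofFn (pickPerm n hs) = pickWord hs (List.finRange n) := ofFn_wordPerm _ _

theorem inversions_pickPerm {n : ℕ} {hs : List ℕ} (hn : n = 2 * hs.length + 2) (hf : Fits hs) :
    inversions (pickPerm n hs) = hs.sum + 1 := by
  rw [inversions_eq_wordInv, ofFn_pickPerm]
  exact wordInv_pickWord hs _ (List.pairwise_lt_finRange n) (by simpa using hn) hf

/-- The letters in even positions increase, and each letter in an odd position exceeds the one after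
it; chaining these, a letter in an even position is below everything to its right. -/
theorem isIncreasingDownUp_iff {m : ℕ} (w : Equiv.Perm (Fin (2 * m + 2))) :
    IsIncreasingDownUp w ↔ MinSecond (List.ofFn w) := by
  rw [minSecond_iff]
  have hget : ∀ (k : ℕ) (hk : k < 2 * m + 2), (List.ofFn w)[k]? = some (w ⟨k, hk⟩) := by
    intro k hk
    rw [List.getElem?_ofFn, dif_pos hk]
  constructor
  · intro hw i j x y hx hy hij hne
    have hi : 2 * i + 1 < 2 * m + 2 :=
      (List.getElem?_eq_some_iff.1 hx).1.trans_eq List.length_ofFn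
    have hj : j < 2 * m + 2 :=
      (List.getElem?_eq_some_iff.1 hy).1.trans_eq List.length_ofFn
    rw [hget _ hi, Option.some_inj] at hx
    rw [hget _ hj, Option.some_inj] at hy
    subst hx hy
    have hodd : ∀ k (hk : 2 * (i + k) + 1 < 2 * m + 2),
        w ⟨2 * i + 1, hi⟩ ≤ w ⟨2 * (i + k) + 1, hk⟩ := by
      intro k
      induction k with
      | zero => intro hk; exact le_rfl
      | succ k ih =>
        intro hk
        refine (ih (by omega)).trans (hw.increasing _ _ ?_ ⟨i + k, rfl⟩).le
        simp only
        omega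
    rcases Nat.even_or_odd' j with ⟨c, rfl | rfl⟩
    · have h1 := hodd (c - i) (by omega)
      have h2 := hw.descent ⟨2 * c, hj⟩ ⟨2 * c + 1, by omega⟩ rfl ⟨c, rfl⟩
      simp only [show i + (c - i) = c by omega] at h1
      exact h1.trans_lt h2
    · have h1 := hodd (c - 1 - i) (by omega)
      refine h1.trans_lt (hw.increasing _ _ ?_ ⟨_, rfl⟩)
      simp only
      omega
  · intro h
    refine ⟨?_, ?_, ?_⟩
    · rintro ⟨i, hi⟩ ⟨j, hj⟩ hij ⟨c, hc⟩
      simp only at hij hc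
      subst hc
      obtain rfl : i = 2 * c := by omega
      exact h c (2 * c) _ _ (hget _ hj) (hget _ hi) le_rfl (by omega)
    · rintro ⟨i, hi⟩ ⟨j, hj⟩ hij ⟨c, hc⟩
      simp only at hij hc
      subst hc
      exact h c j _ _ (hget _ hi) (hget _ hj) (by omega) (by omega)
    · rintro ⟨i, hi⟩ ⟨j, hj⟩ hij ⟨c, hc⟩
      simp only at hij hc
      subst hc
      exact h c j _ _ (hget _ hi) (hget _ hj) (by omega) (by omega)

theorem bruhatLE_pickPerm_succ {n h : ℕ} {g t : List ℕ} (h1 : 1 ≤ h)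
    (hn : n = 2 * (g ++ (h + 1) :: t).length + 2) (hf : Fits (g ++ (h + 1) :: t)) :
    BruhatLE (pickPerm n (g ++ h :: t)) (pickPerm n (g ++ (h + 1) :: t)) := by
  obtain ⟨x, -, y, -, hne, heq⟩ := exists_swap_pickWord h1 g (List.finRange n)
    (List.pairwise_lt_finRange n) (by simpa using hn) hf
  have h2 : pickPerm n (g ++ (h + 1) :: t) = Equiv.swap x y * pickPerm n (g ++ h :: t) := by
    refine perm_ext_ofFn ?_
    rw [ofFn_pickPerm, heq, ← ofFn_pickPerm, List.map_ofFn]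
    rfl
  refine Relation.ReflTransGen.single
    ⟨(pickPerm n (g ++ h :: t)).symm x, (pickPerm n (g ++ h :: t)).symm y, ?_, ?_, ?_⟩
  · simpa using hne
  · rw [h2, Equiv.swap_mul_eq_mul_swap]
    rfl
  · rw [inversions_pickPerm hn hf, inversions_pickPerm (by simpa using hn)
      (hf.of_le h1 (Nat.le_succ h))]
    simp only [List.sum_append, List.sum_cons]
    omega

/-- Entries are raised one unit at a time, starting from the right; the prefix `g` carries those
still unchanged. -/
theorem bruhatLE_pickPerm {n : ℕ} {hs Hs : List ℕ}
    (h : List.Forall₂ (fun h H => 1 ≤ h ∧ h ≤ H) hs Hs) :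
    ∀ g : List ℕ, n = 2 * (g ++ Hs).length + 2 → Fits (g ++ Hs) →
      BruhatLE (pickPerm n (g ++ hs)) (pickPerm n (g ++ Hs)) := by
  induction h with
  | nil => intro g _ _; exact Relation.ReflTransGen.refl
  | @cons h H hs Hs h1 h2 ih =>
    intro g hn hf
    have h3 := ih (g ++ [h]) (by simpa using hn)
      (by rw [List.append_assoc]; exact hf.of_le h1.1 h1.2)
    rw [List.append_assoc, List.append_assoc] at h3
    refine Relation.ReflTransGen.trans h3 ?_
    change BruhatLE (pickPerm n (g ++ h :: Hs)) (pickPerm n (g ++ H :: Hs))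
    clear h3 ih h2
    obtain ⟨h1, hle⟩ := h1
    induction H, hle using Nat.le_induction with
    | base => exact Relation.ReflTransGen.refl
    | succ k hk ih =>
      exact Relation.ReflTransGen.trans
        (ih (by simpa using hn) (hf.of_le (h1.trans hk) (Nat.le_succ k)))
        (bruhatLE_pickPerm_succ (h1.trans hk) hn hf)

/-! ### Upper bounds for the first letters -/

/-- Used in contraposition: a transposition that adds inversions must move the larger value to the
left. -/
theorem inversions_mul_swap_le {n : ℕ} (a : Equiv.Perm (Fin n)) {i j : Fin n} (hij : i < j)
    (h : a j < a i) : inversions (a * Equiv.swap i j) ≤ inversions a := by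
  unfold inversions
  set s := Equiv.swap i j with hs
  have hss : ∀ p, s (s p) = p := fun p => Equiv.swap_apply_self i j p
  have hsi : s i = j := Equiv.swap_apply_left i j
  have hsj : s j = i := Equiv.swap_apply_right i j
  have hsne : ∀ p, p ≠ i → p ≠ j → s p = p := fun p h1 h2 => Equiv.swap_apply_of_ne_of_ne h1 h2
  -- Injection of inversions: transport a pair by `s` if this keeps its order, and otherwise leave
  -- it in place.
  refine card_le_card_of_injOn
    (fun p => if s p.1 < s p.2 then (s p.1, s p.2) else p) ?_ ?_
  · rintro ⟨p, q⟩ hp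
    obtain ⟨hpq, hinv⟩ : p < q ∧ a (s q) < a (s p) := (mem_filter.1 (mem_coe.1 hp)).2
    refine mem_coe.2 (mem_filter.2 ⟨mem_univ _, ?_⟩)
    simp only
    split_ifs with hlt
    · exact ⟨hlt, hinv⟩
    · refine ⟨hpq, ?_⟩
      simp only
      by_cases hpi : p = i
      · subst hpi
        by_cases hqj : q = j
        · subst hqj
          exact h
        · rw [hsi, hsne q hpq.ne' hqj] at hinv
          exact hinv.trans h
      · by_cases hqj : q = j
        · subst hqj
          rw [hsj, hsne p hpi hpq.ne] at hinv
          exact h.trans hinv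
        · by_cases hpj : p = j
          · subst hpj
            rw [hsj, hsne q (by rintro rfl; exact absurd hij hpq.not_gt) hqj] at hlt
            exact absurd (hij.trans hpq) hlt
          · by_cases hqi : q = i
            · subst hqi
              rw [hsi, hsne p hpi hpj] at hlt
              exact absurd (hpq.trans hij) hlt
            · rw [hsne p hpi hpj, hsne q hqi hqj] at hinv
              exact hinv
  · rintro ⟨p, q⟩ hp ⟨p', q'⟩ hp' heq
    replace hp : p < q ∧ _ := (mem_filter.1 (mem_coe.1 hp)).2
    replace hp' : p' < q' ∧ _ := (mem_filter.1 (mem_coe.1 hp')).2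
    simp only at heq
    split_ifs at heq with h1 h2 h2
    · simp only [Prod.mk.injEq] at heq
      exact Prod.ext (s.injective heq.1) (s.injective heq.2)
    · simp only [Prod.mk.injEq] at heq
      rw [← heq.1, ← heq.2, hss, hss] at h2
      exact absurd hp.1 h2
    · simp only [Prod.mk.injEq] at heq
      rw [heq.1, heq.2, hss, hss] at h1
      exact absurd hp'.1 h1
    · exact heq

/-- Going down a Bruhat step puts the smaller of two values in the earlier position, so an upper
bound on the first `p + 1` letters persists. -/
theorem BruhatLE.forall_le {n : ℕ} {u v : Equiv.Perm (Fin n)} (h : BruhatLE u v) {p V : ℕ}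
    (hv : ∀ k : Fin n, k.val ≤ p → (v k).val ≤ V) : ∀ k : Fin n, k.val ≤ p → (u k).val ≤ V := by
  have key : ∀ (a : Equiv.Perm (Fin n)) (i j : Fin n), i < j →
      inversions a < inversions (a * Equiv.swap i j) →
      (∀ k : Fin n, k.val ≤ p → ((a * Equiv.swap i j) k).val ≤ V) →
      ∀ k : Fin n, k.val ≤ p → (a k).val ≤ V := by
    intro a i j hij hinv hb k hk
    have h1 : a i < a j := by
      rcases lt_trichotomy (a i) (a j) with h2 | h2 | h2
      · exact h2
      · exact absurd (a.injective h2) hij.ne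
      · exact absurd (inversions_mul_swap_le a hij h2) hinv.not_ge
    by_cases hki : k = i
    · subst hki
      have := hb k hk
      rw [Equiv.Perm.mul_apply, Equiv.swap_apply_left] at this
      exact (Fin.lt_def.1 h1).le.trans this
    · by_cases hkj : k = j
      · subst hkj
        have := hb i ((Fin.lt_def.1 hij).le.trans hk)
        rwa [Equiv.Perm.mul_apply, Equiv.swap_apply_left] at this
      · have := hb k hk
        rwa [Equiv.Perm.mul_apply, Equiv.swap_apply_of_ne_of_ne hki hkj] at this
  induction h using Relation.ReflTransGen.head_induction_on with
  | refl => exact hv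
  | head h1 _ ih =>
    obtain ⟨i, j, hne, rfl, hinv⟩ := h1
    rcases lt_or_gt_of_ne hne with hij | hij
    · exact key _ i j hij hinv ih
    · rw [Equiv.swap_comm] at hinv ih
      exact key _ j i hij hinv ih

/-- The offset `o` counts the letters already removed, two per round. The letter chosen in round `j`
has index `H` in the remaining list, hence value at most `H + 2 * j + o`. -/
theorem getElem?_pickWord_le {n : ℕ} (Hs : List ℕ) : ∀ (S : List (Fin n)) (o i V : ℕ),
    S.length = 2 * Hs.length + 2 → Fits Hs →
    (∀ (k : ℕ) (x : Fin n), S[k]? = some x → x.val ≤ k + o) → i < Hs.length →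
    (∀ j ≤ i, ∀ H, Hs[j]? = some H → H + 2 * j + o ≤ V) →
    ∀ (p : ℕ) (x : Fin n), p ≤ 2 * i → (pickWord Hs S)[p]? = some x → x.val ≤ V := by
  induction Hs with
  | nil => intro S o i V _ _ _ hi; simp at hi
  | cons H Hs ih =>
    intro S o i V hl hf hS hi hV p x hp hx
    obtain ⟨k, b, S', rfl, rfl, h1, h2, h3⟩ := hf.exists_cons hl
    rw [pickWord_succ_cons h1] at hx
    have hV0 := hV 0 (by omega) (k + 1) (by simp)
    rcases p with _ | _ | p
    · obtain rfl : S'[k] = x := by simpa using hx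
      have := hS (k + 1) S'[k] (by simp)
      omega
    · obtain rfl : b = x := by simpa using hx
      have := hS 0 b (by simp)
      omega
    · refine ih (S'.eraseIdx k) (o + 2) (i - 1) V h3 h2 ?_ ?_ ?_ p x (by omega)
        (by simpa using hx)
      · intro j y hy
        rw [List.getElem?_eraseIdx] at hy
        split_ifs at hy with hj
        · have := hS (j + 1) y (by simpa using hy)
          omega
        · have := hS (j + 2) y (by simpa using hy)
          omega
      · simp only [List.length_cons] at hi
        omega
      · intro j hj H hH
        have := hV (j + 1) (by omega) H (by simpa using hH)
        omega

/-- The letters bounded by `V` include two from each of the first `i` rounds, then the letter chosen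
by `h` and the `h` remaining letters below it. -/
theorem add_le_countP {n : ℕ} (hs : List ℕ) : ∀ (S : List (Fin n)) (i h V : ℕ),
    S.Pairwise (· < ·) → S.length = 2 * hs.length + 2 → Fits hs → hs[i]? = some h →
    (∀ (p : ℕ) (x : Fin n), p ≤ 2 * i → (pickWord hs S)[p]? = some x → x.val ≤ V) →
    h + 2 * i + 1 ≤ S.countP (fun x => x.val ≤ V) := by
  induction hs with
  | nil => intro S i h V _ _ _ hi; simp at hi
  | cons h0 hs ih =>
    intro S i h V hS hl hf hi hV
    obtain ⟨k, b, S', rfl, rfl, h1, h2, h3⟩ := hf.exists_cons hl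
    rw [List.pairwise_cons] at hS
    rw [pickWord_succ_cons h1] at hV
    have hk := hV 0 S'[k] (by omega) (by simp)
    have hb : b.val ≤ V := (Fin.lt_def.1 (hS.1 _ (List.getElem_mem h1))).le.trans hk
    rw [List.countP_cons_of_pos (by simpa using hb),
      ← (List.getElem_cons_eraseIdx_perm h1).countP_eq, List.countP_cons_of_pos (by simpa using hk)]
    rcases i with _ | i
    · obtain rfl : k + 1 = h := by simpa using hi
      have h4 : k ≤ (S'.eraseIdx k).countP fun x => x.val ≤ V := by
        refine (countP_lt_eraseIdx hS.2 h1).symm.le.trans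
          (List.countP_mono_left fun x _ hx => ?_)
        simp only [decide_eq_true_eq] at hx ⊢
        exact (Fin.lt_def.1 hx).le.trans hk
      omega
    · have := ih (S'.eraseIdx k) i h V (pairwise_eraseIdx hS.2 k) h3 h2 (by simpa using hi)
        fun p x hp hx => hV (p + 2) x (by omega) (by simpa using hx)
      omega

theorem countP_finRange_le (n V : ℕ) :
    (List.finRange n).countP (fun x => x.val ≤ V) ≤ V + 1 := by
  have h1 : (List.finRange n).countP (fun x => x.val ≤ V) =
      (List.range n).countP (fun k => k ≤ V) := by
    rw [← List.map_coe_finRange_eq_range, List.countP_map]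
    rfl
  rw [h1, List.countP_eq_length_filter]
  have h2 : ((List.range n).filter fun k => k ≤ V).Subperm (List.range (V + 1)) := by
    refine (List.nodup_range.filter _).subperm fun k hk => ?_
    rw [List.mem_range]
    have : k ≤ V := by simpa using List.of_mem_filter hk
    omega
  simpa using h2.length_le

/-! ### The sum over permutations -/

/-- The lists of positive numbers that are bounded by the entries of a given list. -/
def boxes : List ℕ → Finset (List ℕ)
  | [] => {[]}
  | H :: Hs => (Icc 1 H ×ˢ boxes Hs).image fun p => p.1 :: p.2

theorem mem_boxes {Hs : List ℕ} : ∀ {hs : List ℕ},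
    hs ∈ boxes Hs ↔ List.Forall₂ (fun h H => 1 ≤ h ∧ h ≤ H) hs Hs := by
  induction Hs with
  | nil => intro hs; simp [boxes]
  | cons H Hs ih =>
    intro hs
    rw [List.forall₂_cons_right_iff]
    simp only [boxes, mem_image, mem_product, mem_Icc, Prod.exists, ih]
    constructor
    · rintro ⟨h, t, ⟨h1, h2⟩, rfl⟩
      exact ⟨h, t, h1, h2, rfl⟩
    · rintro ⟨h, t, h1, h2, rfl⟩
      exact ⟨h, t, ⟨h1, h2⟩, rfl⟩

theorem toLaurent_qInt (H : ℕ) : Polynomial.toLaurent (qInt H) =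
    ∑ h ∈ Icc 1 H, (LaurentPolynomial.T ((H : ℤ) - h) : LaurentPolynomial ℤ) := by
  rw [qInt, map_sum]
  refine sum_nbij' (fun i => H - i) (fun h => H - h) ?_ ?_ ?_ ?_ ?_
  · intro i hi
    rw [mem_range] at hi
    rw [mem_Icc]
    omega
  · intro h hh
    rw [mem_Icc] at hh
    rw [mem_range]
    omega
  · intro i hi
    rw [mem_range] at hi
    omega
  · intro h hh
    rw [mem_Icc] at hh
    omega
  · intro i hi
    rw [mem_range] at hi
    rw [Polynomial.toLaurent_X_pow]
    congr 1
    omega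

theorem sum_boxes (Hs : List ℕ) :
    ∑ hs ∈ boxes Hs,
      (LaurentPolynomial.T ((Hs.sum : ℤ) - (hs.sum : ℤ)) : LaurentPolynomial ℤ) =
        (Hs.map fun H => Polynomial.toLaurent (qInt H)).prod := by
  induction Hs with
  | nil => simp [boxes]
  | cons H Hs ih =>
    rw [boxes, sum_image, sum_product, List.map_cons, List.prod_cons, ← ih, toLaurent_qInt,
      sum_mul_sum]
    · refine sum_congr rfl fun h _ => sum_congr rfl fun hs _ => ?_
      rw [← LaurentPolynomial.T_add]
      congr 1
      simp only [List.sum_cons]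
      push_cast
      ring
    · rintro ⟨h, t⟩ _ ⟨h', t'⟩ _ heq
      obtain ⟨h1, h2⟩ := List.cons.inj heq
      exact Prod.ext h1 h2

theorem fits_of_forall₂ {hs Hs : List ℕ} (h : List.Forall₂ (fun h H => 1 ≤ h ∧ h ≤ H) hs Hs)
    (hf : Fits Hs) : Fits hs := by
  induction h with
  | nil => trivial
  | cons h1 h2 ih => exact ⟨⟨h1.1, h2.length_eq ▸ h1.2.trans hf.1.2⟩, ih hf.2⟩

theorem fits_iff (hs : List ℕ) : Fits hs ↔
    ∀ i h, hs[i]? = some h → 1 ≤ h ∧ h + 2 * i ≤ 2 * hs.length + 1 := by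
  induction hs with
  | nil => simp [Fits]
  | cons a hs ih =>
    rw [Fits, ih]
    constructor
    · rintro ⟨h1, h2⟩ i h hi
      rcases i with _ | i
      · obtain rfl : a = h := by simpa using hi
        simp only [List.length_cons]
        omega
      · have := h2 i h (by simpa using hi)
        simp only [List.length_cons]
        omega
    · intro h1
      refine ⟨?_, fun i h hi => ?_⟩
      · have := h1 0 a (by simp)
        simp only [List.length_cons] at this
        omega
      · have := h1 (i + 1) h (by simpa using hi)
        simp only [List.length_cons] at this
        omega

-- The lists below `Hs` entrywise correspond to the permutations in the Bruhat interval. The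
-- hypothesis `hH` is needed only to recover `h ≤ H` from the Bruhat order: it says that an entry is
-- either maximal or bounds all earlier letters.
open Classical in
theorem sum_bruhatLE_pickPerm {m : ℕ} {Hs : List ℕ} (hlen : Hs.length = m) (hf : Fits Hs)
    (hH : ∀ i H, Hs[i]? = some H → H + 2 * i = 2 * m + 1 ∨
      ∀ j ≤ i, ∀ H', Hs[j]? = some H' → H' + 2 * j ≤ H + 2 * i) :
    ∑ w : Equiv.Perm (Fin (2 * m + 2)) with
        IsIncreasingDownUp w ∧ BruhatLE w (pickPerm (2 * m + 2) Hs),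
      (LaurentPolynomial.T ((inversions (pickPerm (2 * m + 2) Hs) : ℤ) - (inversions w : ℤ)) :
        LaurentPolynomial ℤ) = (Hs.map fun H => Polynomial.toLaurent (qInt H)).prod := by
  rw [← sum_boxes]
  symm
  refine sum_bij (fun hs _ => pickPerm (2 * m + 2) hs) ?_ ?_ ?_ ?_
  · intro hs hhs
    rw [mem_boxes] at hhs
    have hl := hhs.length_eq
    rw [mem_filter, isIncreasingDownUp_iff, ofFn_pickPerm]
    refine ⟨mem_univ _, ?_, ?_⟩
    · exact minSecond_pickWord hs _ (List.pairwise_lt_finRange _) (by simp; omega)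
        (fits_of_forall₂ hhs hf)
    · exact bruhatLE_pickPerm hhs [] (by simp; omega) hf
  · intro hs hhs hs' hhs' heq
    rw [mem_boxes] at hhs hhs'
    have hl := hhs.length_eq
    have hl' := hhs'.length_eq
    have h1 := congrArg (fun w : Equiv.Perm (Fin (2 * m + 2)) => List.ofFn w) heq
    simp only [ofFn_pickPerm] at h1
    exact pickWord_injective hs hs' _ (List.pairwise_lt_finRange _) (by simp; omega)
      (fits_of_forall₂ hhs hf) (fits_of_forall₂ hhs' hf) (by omega) h1
  · intro w hw
    obtain ⟨-, hw1, hw2⟩ := mem_filter.1 hw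
    rw [isIncreasingDownUp_iff] at hw1
    obtain ⟨hs, h1, h2, h3⟩ := exists_pickWord_eq m (List.ofFn w) (List.finRange _)
      (List.pairwise_lt_finRange _) (ofFn_perm w) (by simp) hw1
    have hwp : pickPerm (2 * m + 2) hs = w := perm_ext_ofFn (by rw [ofFn_pickPerm, h3])
    refine ⟨hs, ?_, hwp⟩
    rw [mem_boxes, List.forall₂_iff_get]
    refine ⟨by omega, fun i hi hi' => ?_⟩
    have hfi := (fits_iff hs).1 h2 i hs[i] (by simp)
    refine ⟨hfi.1, ?_⟩
    simp only [List.get_eq_getElem]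
    -- In the maximal case `Fits` already gives the bound. Otherwise the first `2 * i + 1` letters
    -- are at most `Hs[i] + 2 * i`, for the upper permutation and hence for `w`; counting letters up
    -- to this bound gives `hs[i] ≤ Hs[i]`.
    rcases hH i Hs[i] (by simp) with h4 | h4
    · omega
    · have hget : ∀ (v : Equiv.Perm (Fin (2 * m + 2))) (p : ℕ) (x : Fin (2 * m + 2)),
          (List.ofFn v)[p]? = some x ↔ ∃ hp : p < 2 * m + 2, v ⟨p, hp⟩ = x := by
        intro v p x
        rw [List.getElem?_ofFn]
        split_ifs with hp
        · simp [hp]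
        · simp [hp]
      have h5 : ∀ k : Fin (2 * m + 2), k.val ≤ 2 * i →
          (pickPerm (2 * m + 2) Hs k).val ≤ Hs[i] + 2 * i := by
        intro k hk
        refine getElem?_pickWord_le Hs (List.finRange (2 * m + 2)) 0 i (Hs[i] + 2 * i)
          (by simp; omega) hf ?_ hi' (fun j hj H hH => by simpa using h4 j hj H hH) k.val _ hk ?_
        · intro j x hx
          obtain ⟨hj, rfl⟩ := List.getElem?_eq_some_iff.1 hx
          simp
        · rw [← ofFn_pickPerm, hget]
          exact ⟨k.2, rfl⟩
      have h6 := hw2.forall_le h5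
      have h7 := add_le_countP hs (List.finRange (2 * m + 2)) i hs[i] (Hs[i] + 2 * i)
        (List.pairwise_lt_finRange _) (by simp; omega) h2 (by simp) (by
          intro p x hp hx
          rw [h3, hget] at hx
          obtain ⟨hp', rfl⟩ := hx
          exact h6 ⟨p, hp'⟩ hp)
      have h8 := countP_finRange_le (2 * m + 2) (Hs[i] + 2 * i)
      omega
  · intro hs hhs
    rw [mem_boxes] at hhs
    have hl := hhs.length_eq
    rw [inversions_pickPerm (by omega) hf, inversions_pickPerm (by omega)
      (fits_of_forall₂ hhs hf)]
    congr 1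
    push_cast
    ring

end BallotTiling

/-! ### The main theorem -/

open BallotTiling in
open Classical in
theorem mainTheorem5 (N : ℕ) (hN : Odd N) (mu : Path N) (hmu : IsBallot mu) :
    upperGenFun mu = (∏ d : Fin N with zigzag N d = Step.D, qInt (ht mu d)) ∧
      Polynomial.toLaurent (upperGenFun mu) =
        ∑ w : Equiv.Perm (Fin (N + 1)) with IsIncreasingDownUp w ∧ BruhatLE w (sigma mu),
          LaurentPolynomial.T ((inversions (sigma mu) : ℤ) - (inversions w : ℤ)) := by
  obtain ⟨m, rfl⟩ := hN
  have hprod := upperGenFun_eq_prod m _ rfl mu hmu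
  refine ⟨hprod.trans (prod_qInt_ht mu).symm, ?_⟩
  have hsigma : sigma mu = pickPerm (2 * m + 2) ((List.range m).map (htSeq mu)) := by
    refine perm_ext_ofFn ?_
    rw [ofFn_pickPerm, sigma_eq_wordPerm, ofFn_wordPerm, sigmaWord]
    exact congrArg (fun l => pickWord l _) (map_ht_eq mu id)
  have hget : ∀ i H, ((List.range m).map (htSeq mu))[i]? = some H → i < m ∧ htSeq mu i = H := by
    intro i H h
    obtain ⟨h1, h2⟩ := List.getElem?_eq_some_iff.1 h
    simp only [List.length_map, List.length_range] at h1
    exact ⟨h1, by simpa using h2⟩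
  rw [hsigma, hprod]
  refine Eq.trans ?_ (sum_bruhatLE_pickPerm (m := m) (by simp) ?_ ?_).symm
  · rw [map_list_prod, List.map_map, List.map_map]
    rfl
  · rw [fits_iff]
    intro i H h
    obtain ⟨h1, rfl⟩ := hget i H h
    have h2 := one_le_htSeq mu i
    have h3 := htSeq_le mu (i := i) (by omega)
    simp only [List.length_map, List.length_range]
    omega
  · intro i H h
    obtain ⟨h1, rfl⟩ := hget i H h
    refine (htSeq_cases mu (i := i) (by omega)).imp (fun h2 => by omega) ?_
    intro h2 j hj H' h'
    obtain ⟨h3, rfl⟩ := hget j H' h'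
    exact h2 j hj
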